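/- Let $k\ge 1$, $\beta>0$, and write $\mathcal A_{1/N}=M_k(\mathbb C)^{\otimes N}$ with its operator norm. Let $S_N$ be the symmetrisation operator on $\mathcal A_{1/N}$ (the average over all permutations of the $N$ tensor factors) and, for $a\in\mathcal A_{1/M}$ and $N\ge M$, let $S_{M,N}(a)=S_N(a\otimes I^{\otimes(N-M)})$. A sequence $(A_{1/N})_N$, $A_{1/N}\in\mathcal A_{1/N}$, is *symmetric* if for some $M$ and $a\in\mathcal A_{1/M}$ one has $A_{1/N}=S_{M,N}(a)$ for all $N\ge M$; it is *quasi-symmetric* if $S_N(A_{1/N})=A_{1/N}$ for all $N$ and for every $\varepsilon>0$ there are a symmetric sequence $(A'_{1/N})_N$ and an $M$ with $\|A_{1/N}-A'_{1/N}\|<\varepsilon$ for all $N>M$. Let $\mathcal A_0$ be the quasi-local algebra of $M_k(\mathbb C)$, i.e. the $C^*$-algebra of quasi-local sequences (those uniformly approximated, asymptotically, by local sequences $a\otimes I^{\otimes (N-M)}$, $a\in\mathcal A_{1/M}$) modulo norm-null sequences. For a state $\omega$ of $\mathcal A_0$ let $\omega|_{1/N}$ be its restriction to $\mathcal A_{1/N}$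 and $\rho^\omega_{1/N}$ the density matrix of that restriction; $\omega$ is *permutation invariant* if $\omega|_{1/N}\circ S_N=\omega|_{1/N}$ for all $N$. Let $H=(H_{1/N})_N$ be a quasi-symmetric sequence of self-adjoint elements, $\tilde H_{1/N}=NH_{1/N}$, and let $$\omega^\beta_{1/N}(a)=\frac{\mathrm{Tr}(e^{-\beta\tilde H_{1/N}}a)}{\mathrm{Tr}(e^{-\beta\tilde H_{1/N}})}\qquad(a\in\mathcal A_{1/N})$$ be the local Gibbs states. For a quasi-symmetric sequence $A=(A_{1/N})_N$ of self-adjoint elements put $\tilde A_{1/N}=NA_{1/N}$ and, for $t\in\mathbb R$ and a permutation invariant state $\omega$ of $\mathcal A_0$, $$F^\beta(\tilde H,\omega,t)=\lim_{N\to\infty}\tfrac1N\,\omega|_{1/N}(\tilde H_{1/N}+t\tilde A_{1/N})-\frac1\beta\lim_{N\to\infty}\Big(-\tfrac1N\mathrm{Tr}\big(\rho^\omega_{1/N}\log\rho^\omega_{1/N}\big)\Big),\qquad F_A(t):=F^\beta(\tilde H,t)=\inf_\omega F^\beta(\tilde H,\omega,t),$$ the infimum being over all permutation invariant states of $\mathcal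 A_0$. **(1)** For every quasi-symmetric sequence $A$ of self-adjoint elements, the two limits exist for all permutation invariant $\omega$ and all $t\in\mathbb R$, the infimum is that of a non-empty set bounded below, and $F_A:\mathbb R\to\mathbb R$ is concave. If $F_A$ is differentiable at $0$, then $$\lim_{N\to\infty}\omega^\beta_{1/N}(A_{1/N})=F_A'(0).$$ **(2)** Let $T_1,\dots,T_{k^2-1}$ be any basis of the real vector space of traceless self-adjoint $k\times k$ matrices. Let $Q_{1/N}$ be the linear map on polynomials in $x_1,\dots,x_{k^2-1}$ with $Q_{1/N}(x_{j_1}\cdots x_{j_L})=S_{L,N}(S_L(T_{j_1}\otimes\cdots\otimes T_{j_L}))$ for $N\ge L$ and $0$ for $N<L$ (so $Q_{1/N}(1)=I$), and view polynomials as functions on the state space $S(M_k(\mathbb C))$ through $x_j(\rho)=\mathrm{Tr}(\rho T_j)$. Suppose that $F_A$ is differentiable at $0$ for $A=(Q_{1/N}(p))_N$, for every real polynomial $p$ (in particular, this holds if $F_A$ is differentiable at $0$ for every quasi-symmetric sequence $A$ of self-adjoint elements). Then the classical limit of the Gibbs state exists: there is a state $\omega_0^\beta$ of the $C^*$-algebra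 $C(S(M_k(\mathbb C)))$ such that $$\lim_{N\to\infty}\omega^\beta_{1/N}(Q_{1/N}(f))=\omega_0^\beta(f)\quad\text{for every complex polynomial } f,$$ and moreover $\lim_{N\to\infty}\omega^\beta_{1/N}(A_{1/N})=\omega_0^\beta(a_0)$ for every quasi-symmetric sequence $A$, where $a_0\in C(S(M_k(\mathbb C)))$ is the function $a_0(\rho)=\lim_{N\to\infty}\mathrm{Tr}(\rho^{\otimes N}A_{1/N})$, this limit existing for every $\rho$. -/

import Mathlib

open Filter Topology
open scoped Matrix ComplexOrder Matrix.Norms.L2Operator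

noncomputable section

namespace MeanField

/-- `M_k(ℂ)^{⊗N}`, realised as the operators on `(ℂ^k)^{⊗N}`: matrices indexed by the product basis
`x : Fin N → Fin k`. The norm is the operator norm. -/
abbrev LocalAlg (k N : ℕ) : Type := Matrix (Fin N → Fin k) (Fin N → Fin k) ℂ

/-- Sequences `(A_{1/N})_N` with `A_{1/N} ∈ M_k(ℂ)^{⊗N}`. All notions below only depend on the
behaviour as `N → ∞`, apart from the permutation invariance required of every term; the entry at
`N = 0` is a dummy. -/
abbrev LocalSeq (k : ℕ) : Type := ∀ N : ℕ, LocalAlg k N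

/-- A state of a unital complex `*`-algebra: a positive normalised linear functional. -/
def IsAlgState {𝓐 : Type*} [Ring 𝓐] [StarRing 𝓐] [Algebra ℂ 𝓐] (φ : 𝓐 →ₗ[ℂ] ℂ) : Prop :=
  (∀ a : 𝓐, 0 ≤ φ (star a * a)) ∧ φ 1 = 1

/-! ### Tensoring with the identity -/

/-- A basis index of `N` sites is a pair of an index of the first `M` sites and an index of the
remaining ones. -/
def splitEquiv {k M N : ℕ} (h : M ≤ N) :
    (Fin N → Fin k) ≃ (Fin M → Fin k) × ({i : Fin N // M ≤ i.val} → Fin k) where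
  toFun x := (fun i => x (Fin.castLE h i), fun j => x j.1)
  invFun p := fun i => if hi : i.val < M then p.1 ⟨i.val, hi⟩ else p.2 ⟨i, not_lt.mp hi⟩
  left_inv x := by
    funext i
    by_cases hi : i.val < M
    · simp only [hi, dif_pos]
      rfl
    · simp only [hi, dif_neg, not_false_eq_true]
  right_inv p := by
    refine Prod.ext ?_ ?_
    · funext i
      simp
    · funext j
      have : ¬ (j.1.val < M) := not_lt.mpr j.2
      simp [this]

/-- The embedding `a ↦ a ⊗ I^{⊗(N-M)}` of `M_k(ℂ)^{⊗M}` into `M_k(ℂ)^{⊗N}`. -/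
def embed {k M N : ℕ} (h : M ≤ N) : LocalAlg k M →⋆ₐ[ℂ] LocalAlg k N where
  toFun a := (Matrix.kronecker a (1 : Matrix ({i : Fin N // M ≤ i.val} → Fin k)
    ({i : Fin N // M ≤ i.val} → Fin k) ℂ)).submatrix (splitEquiv h) (splitEquiv h)
  map_one' := by
    simp only [Matrix.kronecker]
    rw [show (Matrix.kroneckerMap (· * ·) (1 : LocalAlg k M)
      (1 : Matrix ({i : Fin N // M ≤ i.val} → Fin k) ({i : Fin N // M ≤ i.val} → Fin k) ℂ)) = 1
      from Matrix.one_kronecker_one]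
    exact Matrix.submatrix_one_equiv _
  map_mul' a b := by
    rw [Matrix.submatrix_mul_equiv]
    congr 1
    have := Matrix.mul_kronecker_mul a b
      (1 : Matrix ({i : Fin N // M ≤ i.val} → Fin k) ({i : Fin N // M ≤ i.val} → Fin k) ℂ)
      (1 : Matrix ({i : Fin N // M ≤ i.val} → Fin k) ({i : Fin N // M ≤ i.val} → Fin k) ℂ)
    simpa [Matrix.kronecker] using this
  map_zero' := by
    ext x y
    simp [Matrix.kronecker]
  map_add' a b := by
    ext x y
    simp [Matrix.kronecker, add_mul]
  commutes' r := by
    ext x y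
    simp only [Matrix.kronecker, Matrix.submatrix_apply, Matrix.kroneckerMap_apply,
      Matrix.algebraMap_matrix_apply, Matrix.one_apply]
    have e : x = y ↔ (splitEquiv h x).1 = (splitEquiv h y).1 ∧
        (splitEquiv h x).2 = (splitEquiv h y).2 := by
      rw [← (splitEquiv (k := k) h).injective.eq_iff, Prod.ext_iff]
    by_cases h1 : (splitEquiv h x).1 = (splitEquiv h y).1 <;>
      by_cases h2 : (splitEquiv h x).2 = (splitEquiv h y).2 <;> simp [e, h1, h2]
  map_star' a := by
    ext x y
    simp only [Matrix.kronecker, Matrix.submatrix_apply, Matrix.kroneckerMap_apply,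
      Matrix.star_apply, Matrix.one_apply, star_mul']
    congr 1
    by_cases h2 : (splitEquiv h x).2 = (splitEquiv h y).2
    · simp [h2]
    · simp [h2, Ne.symm h2]

theorem embed_apply {k M N : ℕ} (h : M ≤ N) (a : LocalAlg k M) (x y : Fin N → Fin k) :
    embed h a x y = a (fun i => x (Fin.castLE h i)) (fun i => y (Fin.castLE h i)) *
      (if ∀ i : Fin N, M ≤ i.val → x i = y i then 1 else 0) := by
  simp [embed, splitEquiv, Matrix.kronecker, Matrix.one_apply, funext_iff]

theorem embed_embed {k L M N : ℕ} (h : L ≤ M) (h' : M ≤ N) (a : LocalAlg k L) :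
    embed h' (embed h a) = embed (h.trans h') a := by
  ext x y
  simp only [embed_apply, mul_assoc]
  congr 1
  have e : (∀ i : Fin N, L ≤ i.val → x i = y i) ↔
      (∀ i : Fin M, L ≤ i.val → x (Fin.castLE h' i) = y (Fin.castLE h' i)) ∧
      (∀ i : Fin N, M ≤ i.val → x i = y i) := by
    refine ⟨fun h1 => ⟨fun i hi => h1 _ hi, fun i hi => h1 i (h.trans hi)⟩, fun ⟨h1, h2⟩ i hi => ?_⟩
    by_cases hM : i.val < M
    · exact h1 ⟨i.val, hM⟩ hi
    · exact h2 i (not_lt.mp hM)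
  simp only [e, ite_and]
  split_ifs <;> simp

theorem norm_embed_le {k M N : ℕ} (h : M ≤ N) (a : LocalAlg k M) : ‖embed h a‖ ≤ ‖a‖ :=
  NonUnitalStarAlgHom.norm_apply_le (embed h) a

/-! ### The quasi-local algebra and its states -/

/-- The local sequence `N ↦ a ⊗ I^{⊗(N-M)}` (`N ≥ M`) generated by `a ∈ M_k(ℂ)^{⊗M}`. The finitely
many terms with `N < M` are irrelevant in the quotient and set to zero. -/
def localSeq {k : ℕ} (M : ℕ) (a : LocalAlg k M) : LocalSeq k :=
  fun N => if h : M ≤ N then embed h a else 0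

theorem localSeq_of_le {k M N : ℕ} (a : LocalAlg k M) (h : M ≤ N) :
    localSeq M a N = embed h a := dif_pos h

/-- `(A_N)` is quasi-local: asymptotically it is uniformly approximated by local sequences. -/
def IsQuasiLocal {k : ℕ} (A : LocalSeq k) : Prop :=
  ∀ ε : ℝ, 0 < ε → ∃ (M : ℕ) (a : LocalAlg k M), ∀ᶠ N in atTop, ‖A N - localSeq M a N‖ < ε

theorem isQuasiLocal_localSeq {k : ℕ} (M : ℕ) (a : LocalAlg k M) : IsQuasiLocal (localSeq M a) :=
  fun ε hε => ⟨M, a, Eventually.of_forall fun N => by simpa using hε⟩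

/-- The `*`-algebra of quasi-local sequences. -/
def quasiLocal (k : ℕ) : StarSubalgebra ℂ (LocalSeq k) where
  carrier := {A | IsQuasiLocal A}
  algebraMap_mem' r := fun ε hε => ⟨0, algebraMap ℂ _ r, Eventually.of_forall fun N => by
    rw [localSeq_of_le _ (Nat.zero_le N), AlgHomClass.commutes]
    simpa using hε⟩
  star_mem' := by
    intro A hA ε hε
    obtain ⟨M, a, h⟩ := hA ε hε
    refine ⟨M, star a, ?_⟩
    filter_upwards [h, eventually_ge_atTop M] with N hN hMN
    rw [localSeq_of_le _ hMN] at hN ⊢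
    rw [map_star, Pi.star_apply, ← star_sub, norm_star]
    exact hN
  add_mem' := by
    intro A B hA hB ε hε
    obtain ⟨M, a, ha⟩ := hA (ε / 2) (half_pos hε)
    obtain ⟨M', b, hb⟩ := hB (ε / 2) (half_pos hε)
    refine ⟨max M M', embed (le_max_left _ _) a + embed (le_max_right _ _) b, ?_⟩
    filter_upwards [ha, hb, eventually_ge_atTop (max M M')] with N h1 h2 hN
    rw [localSeq_of_le _ ((le_max_left _ _).trans hN)] at h1
    rw [localSeq_of_le _ ((le_max_right _ _).trans hN)] at h2
    rw [localSeq_of_le _ hN, map_add, embed_embed, embed_embed, Pi.add_apply, add_sub_add_comm]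
    calc _ ≤ _ := norm_add_le _ _
      _ < ε / 2 + ε / 2 := add_lt_add h1 h2
      _ = ε := add_halves ε
  mul_mem' := by
    intro A B hA hB ε hε
    obtain ⟨M₀, b₀, hb₀⟩ := hB 1 one_pos
    have hCpos : 0 < ‖b₀‖ + 1 := by positivity
    obtain ⟨M, a, ha⟩ := hA (ε / 2 / (‖b₀‖ + 1)) (by positivity)
    have hDpos : 0 < ‖a‖ + 1 := by positivity
    obtain ⟨M', b, hb⟩ := hB (ε / 2 / (‖a‖ + 1)) (by positivity)
    refine ⟨max M M', embed (le_max_left _ _) a * embed (le_max_right _ _) b, ?_⟩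
    filter_upwards [hb₀, ha, hb, eventually_ge_atTop (max M M'), eventually_ge_atTop M₀]
      with N h0 h1 h2 hN hN0
    rw [localSeq_of_le _ hN0] at h0
    rw [localSeq_of_le _ ((le_max_left _ _).trans hN)] at h1
    rw [localSeq_of_le _ ((le_max_right _ _).trans hN)] at h2
    rw [localSeq_of_le _ hN, map_mul, embed_embed, embed_embed, Pi.mul_apply]
    have hBN : ‖B N‖ ≤ ‖b₀‖ + 1 := by
      have h3 : B N = embed hN0 b₀ + (B N - embed hN0 b₀) := by abel
      rw [h3]
      exact (norm_add_le _ _).trans (add_le_add (norm_embed_le _ _) h0.le)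
    set a' := embed ((le_max_left M M').trans hN) a
    set b' := embed ((le_max_right M M').trans hN) b
    have ha' : ‖a'‖ ≤ ‖a‖ + 1 := (norm_embed_le _ _).trans (le_add_of_nonneg_right zero_le_one)
    have e : A N * B N - a' * b' = (A N - a') * B N + a' * (B N - b') := by noncomm_ring
    rw [e]
    calc ‖(A N - a') * B N + a' * (B N - b')‖
        ≤ ‖A N - a'‖ * ‖B N‖ + ‖a'‖ * ‖B N - b'‖ :=
          (norm_add_le _ _).trans (add_le_add (norm_mul_le _ _) (norm_mul_le _ _))
      _ ≤ ‖A N - a'‖ * (‖b₀‖ + 1) + (‖a‖ + 1) * ‖B N - b'‖ := by gcongr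
      _ < ε / 2 / (‖b₀‖ + 1) * (‖b₀‖ + 1) + (‖a‖ + 1) * (ε / 2 / (‖a‖ + 1)) := by gcongr
      _ = ε := by field_simp; ring

/-- The canonical map of `M_k(ℂ)^{⊗M}` into the quasi-local algebra, on representatives. -/
def localMap (k M : ℕ) : LocalAlg k M →ₗ[ℂ] quasiLocal k where
  toFun a := ⟨localSeq M a, isQuasiLocal_localSeq M a⟩
  map_add' a b := by
    refine Subtype.ext (funext fun N => ?_)
    by_cases h : M ≤ N <;> simp [localSeq, h]
  map_smul' r a := by
    refine Subtype.ext (funext fun N => ?_)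
    by_cases h : M ≤ N <;> simp [localSeq, h]

/-- A state of the quasi-local algebra (quasi-local sequences modulo norm-null sequences). -/
structure QuasiLocalState (k : ℕ) where
  toLinearMap : quasiLocal k →ₗ[ℂ] ℂ
  isState : IsAlgState toLinearMap
  map_null : ∀ A : quasiLocal k,
    Tendsto (fun N => ‖(A : LocalSeq k) N‖) atTop (𝓝 0) → toLinearMap A = 0

/-- The restriction of a state of the quasi-local algebra to `M_k(ℂ)^{⊗N}`. -/
def QuasiLocalState.restrict {k : ℕ} (ω : QuasiLocalState k) (N : ℕ) : LocalAlg k N →ₗ[ℂ] ℂ :=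
  ω.toLinearMap ∘ₗ localMap k N

/-! ### Symmetrisation and quasi-symmetric sequences -/

/-- The symmetrisation operator `S_N`, averaging over all permutations of the `N` tensor factors. -/
def symmetrize {k N : ℕ} (A : LocalAlg k N) : LocalAlg k N :=
  ((N.factorial : ℂ)⁻¹) • ∑ σ : Equiv.Perm (Fin N), A.submatrix (fun x => x ∘ σ) (fun x => x ∘ σ)

/-- `S_{M,N}(a) = S_N(a ⊗ I^{⊗(N-M)})`. -/
def symEmbed {k M N : ℕ} (h : M ≤ N) (a : LocalAlg k M) : LocalAlg k N :=
  symmetrize (embed h a)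

/-- Symmetric sequences. -/
def IsSymmetricSeq {k : ℕ} (A : LocalSeq k) : Prop :=
  ∃ (M : ℕ) (a : LocalAlg k M), ∀ (N : ℕ) (h : M ≤ N), A N = symEmbed h a

/-- Quasi-symmetric (macroscopic) sequences, i.e. the continuous cross-sections of the bundle with
fibres `S_N(M_k(ℂ)^{⊗N})` and `C(S(M_k(ℂ)))`. -/
def IsQuasiSymmetric {k : ℕ} (A : LocalSeq k) : Prop :=
  (∀ N, symmetrize (A N) = A N) ∧
  ∀ ε : ℝ, 0 < ε → ∃ A' : LocalSeq k, IsSymmetricSeq A' ∧ ∃ M : ℕ, ∀ N, M < N → ‖A N - A' N‖ < ε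

/-- Permutation invariance of a state of the quasi-local algebra. -/
def QuasiLocalState.IsPermInvariant {k : ℕ} (ω : QuasiLocalState k) : Prop :=
  ∀ (M : ℕ) (a : LocalAlg k M), ω.restrict M (symmetrize a) = ω.restrict M a

/-- The permutation invariant states of the quasi-local algebra. -/
abbrev PermInvState (k : ℕ) : Type := {ω : QuasiLocalState k // ω.IsPermInvariant}

/-! ### Gibbs states and mean-field free energy -/

/-- `H̃_{1/N} = N H_{1/N}`. -/
def scaled {k : ℕ} (H : LocalSeq k) : LocalSeq k := fun N => (N : ℂ) • H N

/-- The local Gibbs state `Tr(e^{-βK} a) / Tr(e^{-βK})`. -/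
def gibbs {k N : ℕ} (β : ℝ) (K a : LocalAlg k N) : ℂ :=
  (NormedSpace.exp ((-β : ℂ) • K) * a).trace / (NormedSpace.exp ((-β : ℂ) • K)).trace

/-- The matrix `ρ` with `φ(a) = Tr(ρ a)`. -/
def densityMatrix {k N : ℕ} (φ : LocalAlg k N →ₗ[ℂ] ℂ) : LocalAlg k N :=
  Matrix.of fun x y => φ (Matrix.single y x 1)

/-- The local entropy `-Tr(ρ log ρ)`, via the functional calculus of `s ↦ -s log s`. -/
def localEntropy {k N : ℕ} (φ : LocalAlg k N →ₗ[ℂ] ℂ) : ℝ :=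
  (cfc Real.negMulLog (densityMatrix φ)).trace.re

/-- `(1/N) ω|_{1/N}(K_{1/N})`, real for self-adjoint `K`. -/
def energyDensity {k : ℕ} (K : LocalSeq k) (ω : QuasiLocalState k) (N : ℕ) : ℝ :=
  (1 / (N : ℝ)) * (ω.restrict N (K N)).re

/-- `(1/N)` times the entropy of the restriction of `ω` to `N` sites. -/
def entropyDensity {k : ℕ} (ω : QuasiLocalState k) (N : ℕ) : ℝ :=
  (1 / (N : ℝ)) * localEntropy (ω.restrict N)

/-- The mean-field internal energy `U(K, ω)`. -/
def internalEnergy {k : ℕ} (K : LocalSeq k) (ω : QuasiLocalState k) : ℝ :=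
  limUnder atTop (energyDensity K ω)

/-- The mean-field entropy `S(ω)`. -/
def meanEntropy {k : ℕ} (ω : QuasiLocalState k) : ℝ :=
  limUnder atTop (entropyDensity ω)

/-- The mean-field free energy `F^β(H̃, ω, t) = U(H̃ + tÃ, ω) - S(ω)/β` of a state, for the
perturbation of `H̃ = N H` by `t Ã = t N A`. -/
def stateFreeEnergy {k : ℕ} (β : ℝ) (H A : LocalSeq k) (t : ℝ) (ω : QuasiLocalState k) : ℝ :=
  internalEnergy (scaled H + (t : ℂ) • scaled A) ω - 1 / β * meanEntropy ω

/-- The mean-field free energy `F^β(H̃, t) = inf_ω F^β(H̃, ω, t)`, the infimum being over the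
permutation invariant states of the quasi-local algebra. -/
def freeEnergy {k : ℕ} (β : ℝ) (H A : LocalSeq k) (t : ℝ) : ℝ :=
  ⨅ ω : PermInvState k, stateFreeEnergy β H A t ω.1

/-! ### The classical side: `C(S(M_k(ℂ)))` and the quantisation maps -/

/-- The state space `S(M_k(ℂ))`, a state being given by its density matrix. -/
abbrev StateSpace (k : ℕ) : Type :=
  {ρ : Matrix (Fin k) (Fin k) ℂ // ρ.PosSemidef ∧ ρ.trace = 1}

/-- The elementary tensor `B_1 ⊗ ⋯ ⊗ B_L`. -/
def elemTensor {k L : ℕ} (B : Fin L → Matrix (Fin k) (Fin k) ℂ) : LocalAlg k L :=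
  Matrix.of fun x y => ∏ i, B i (x i) (y i)

/-- The value `ρ^{⊗N}(a)` of the product state. -/
def productState {k : ℕ} (ρ : StateSpace k) (N : ℕ) (a : LocalAlg k N) : ℂ :=
  (elemTensor (fun _ : Fin N => ρ.1) * a).trace

/-- The real vector space of traceless self-adjoint `k × k` matrices. -/
def tracelessHermitian (k : ℕ) : Submodule ℝ (Matrix (Fin k) (Fin k) ℂ) where
  carrier := {B | B.IsHermitian ∧ B.trace = 0}
  add_mem' ha hb := ⟨ha.1.add hb.1, by rw [Matrix.trace_add, ha.2, hb.2, add_zero]⟩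
  zero_mem' := ⟨Matrix.isHermitian_zero, Matrix.trace_zero _ _⟩
  smul_mem' r B hB := ⟨by
    rw [Matrix.IsHermitian, Matrix.conjTranspose_smul, hB.1.eq, star_trivial], by
    rw [Matrix.trace_smul, hB.2, smul_zero]⟩

/-- A basis `T_1, …, T_{k²-1}` of the traceless self-adjoint matrices. -/
abbrev SpinBasis (k : ℕ) : Type := Module.Basis (Fin (k ^ 2 - 1)) ℝ (tracelessHermitian k)

/-- The function on `S(M_k(ℂ))` given by a polynomial in the coordinates `x_j(ρ) = Tr(ρ T_j)`. -/
def polyFun {k : ℕ} (T : SpinBasis k) (f : MvPolynomial (Fin (k ^ 2 - 1)) ℂ) :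
    C(StateSpace k, ℂ) where
  toFun ρ := MvPolynomial.eval (fun j => (ρ.1 * (T j : Matrix (Fin k) (Fin k) ℂ)).trace) f
  continuous_toFun := by
    refine (MvPolynomial.continuous_eval f).comp (continuous_pi fun j => ?_)
    exact (continuous_subtype_val.mul continuous_const).matrix_trace

/-- `Q_{1/N}` on the monomial `x_{j_1} ⋯ x_{j_L}`: it is `S_{L,N}(T_{j_1} ⊗_s ⋯ ⊗_s T_{j_L})` if
`N ≥ L`, and `0` otherwise. -/
def quantMonomial {k : ℕ} (T : SpinBasis k) (N : ℕ) (l : List (Fin (k ^ 2 - 1))) : LocalAlg k N :=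
  if h : l.length ≤ N then
    symEmbed h (symmetrize (elemTensor fun i : Fin l.length =>
      (T (l.get i) : Matrix (Fin k) (Fin k) ℂ)))
  else 0

/-- The quantisation map `Q_{1/N}`, the linear extension of `quantMonomial`. The order in which the
variables of a monomial are listed is irrelevant, because of the symmetrisation. -/
def quantize {k : ℕ} (T : SpinBasis k) (f : MvPolynomial (Fin (k ^ 2 - 1)) ℂ) : LocalSeq k :=
  fun N => ∑ m ∈ f.support, f.coeff m • quantMonomial T N (Finsupp.toMultiset m).toList

/-- The states `ω_N` (evaluated along sequences of observables) have a classical limit: there is a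
state `ω₀` of `C(S(M_k(ℂ)))` with `ω_N(Q_{1/N}(f)) → ω₀(f)` for all polynomials `f`, and more
generally `ω_N(A_{1/N}) → ω₀(a₀)` for all quasi-symmetric sequences `A`, where
`a₀(ρ) = lim ρ^{⊗N}(A_{1/N})`. -/
def HasClassicalLimit {k : ℕ} (T : SpinBasis k) (ω : ∀ N, LocalAlg k N → ℂ) : Prop :=
  ∃ ω₀ : C(StateSpace k, ℂ) →ₗ[ℂ] ℂ, IsAlgState ω₀ ∧
    (∀ f : MvPolynomial (Fin (k ^ 2 - 1)) ℂ,
      Tendsto (fun N => ω N (quantize T f N)) atTop (𝓝 (ω₀ (polyFun T f)))) ∧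
    ∀ A : LocalSeq k, IsQuasiSymmetric A → ∃ a₀ : C(StateSpace k, ℂ),
      (∀ ρ, Tendsto (fun N => productState ρ N (A N)) atTop (𝓝 (a₀ ρ))) ∧
      Tendsto (fun N => ω N (A N)) atTop (𝓝 (ω₀ a₀))

end MeanField

end

open MeanField

/-! Convergence of Gibbs expectations. By the Gibbs variational principle (`vnEntropy_add_le`, with
equality at the Gibbs state by `vnEntropy_gibbs`), the N-site free energy density f_N(t) = -(βN)⁻¹
log Tr exp(-βN(H+tA)_N) is the minimum over all N-site states of energy density minus β⁻¹ times
entropy density. Restrictions of a permutation invariant state are trial states, so limsup f_N(t) ≤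
F_A(t). Conversely, the Gibbs states have permutation invariant limits along ultrafilters. A
permutation invariant state cannot distinguish a⊗I from its symmetrisation, so energies of
quasi-symmetric sequences pass to these limits. Entropy is an infimum of continuous functions and is
subadditive, so its density can only increase in the limit (`eventually_entropy_le_ultraLimit`).
This gives liminf f_N(t) ≥ F_A(t), hence `tendsto_gibbsFreeEnergy`.

F_A is concave as an infimum of affine functions of t. The Gibbs state of H as a trial state for
H+tA gives f_N(t) ≤ f_N(0) + t ω_N(A_N): the expectation is a supergradient of f_N at 0. Such
supergradients converge to F_A'(0) when this derivative exists (`tendsto_supergradient`).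

Existence of the classical limit. The limits L(p) of the expectations of Q(p) form a linear
functional on real polynomials, and everything rests on its positivity, obtained here without a
quantum de Finetti theorem. A product of affine functions attached to positive matrices quantises to
a symmetrised tensor product of those matrices (`quantizeₗ_prod_affPoly`), on which permutation
invariant states are nonnegative. These products generate an Archimedean semiring, and the
characters nonnegative on it are evaluations at states ρ (`exists_state_of_character`). The
Krivine/Kadison–Dubois theorem (`map_nonneg_of_forall_character`) then yields L(p) ≥ 0 whenever p ≥
0 on the state space. The M. Riesz extension theorem and complexification turn L into a state of the
continuous functions, and norm approximation by quantised polynomials covers all quasi-symmetric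
sequences. -/

noncomputable section

namespace MeanField

/-! ### States of unital *-algebras -/

section AlgState

variable {𝓐 : Type*} [Ring 𝓐] [StarRing 𝓐] [Algebra ℂ 𝓐] [StarModule ℂ 𝓐] {φ : 𝓐 →ₗ[ℂ] ℂ}

/-- Polarisation: reality of φ on the squares of 1 + a and 1 + ia forces φ(a) + φ(a*) and i(φ(a) -
φ(a*)) to be real. -/
theorem IsAlgState.map_star (h : IsAlgState φ) (a : 𝓐) : φ (star a) = star (φ a) := by
  have h0 := (Complex.nonneg_iff.mp (h.1 a)).2
  have h1 := (Complex.nonneg_iff.mp (h.1 (1 + a))).2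
  have h2 := (Complex.nonneg_iff.mp (h.1 (1 + Complex.I • a))).2
  have e1 : star (1 + a) * (1 + a) = 1 + a + star a + star a * a := by
    rw [star_add, star_one]; noncomm_ring
  have e2 : star (1 + Complex.I • a) * (1 + Complex.I • a) =
      1 + Complex.I • a - Complex.I • star a + star a * a := by
    rw [star_add, star_one, star_smul, add_mul, mul_add, mul_add, smul_mul_smul_comm]
    simp only [RCLike.star_def, Complex.conj_I, neg_mul, Complex.I_mul_I, neg_neg, one_smul,
      one_mul, mul_one, neg_smul]
    abel
  rw [e1] at h1
  rw [e2] at h2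
  simp only [map_add, map_sub, map_smul, h.2, Complex.add_im, Complex.sub_im, smul_eq_mul,
    Complex.mul_im, Complex.I_re, Complex.I_im, Complex.one_im, one_mul, zero_mul, zero_add,
    add_zero, ← h0] at h1 h2
  apply Complex.ext
  · simp only [RCLike.star_def, Complex.conj_re]; linarith
  · simp only [RCLike.star_def, Complex.conj_im]; linarith

theorem IsAlgState.im_eq_zero (h : IsAlgState φ) {a : 𝓐} (ha : IsSelfAdjoint a) :
    (φ a).im = 0 := by
  have := h.map_star a
  rw [ha.star_eq] at this
  exact Complex.conj_eq_iff_im.mp this.symm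

theorem IsAlgState.ofReal_re (h : IsAlgState φ) {a : 𝓐} (ha : IsSelfAdjoint a) :
    (((φ a).re : ℝ) : ℂ) = φ a :=
  Complex.ext rfl (by simp [h.im_eq_zero ha])

/-- The variance, i.e. φ at the square of a - φ(a)·1, is nonnegative. -/
theorem IsAlgState.normSq_le (h : IsAlgState φ) (a : 𝓐) :
    ‖φ a‖ ^ 2 ≤ (φ (star a * a)).re := by
  have h1 := (Complex.nonneg_iff.mp (h.1 (a - φ a • 1))).1
  have e : star (a - φ a • (1 : 𝓐)) * (a - φ a • 1) =
      star a * a - φ a • star a - star (φ a) • a + (star (φ a) * φ a) • 1 := by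
    rw [star_sub, star_smul, star_one, sub_mul, mul_sub, mul_sub, smul_mul_smul_comm]
    simp only [mul_smul_comm, smul_mul_assoc, one_mul, mul_one]
    abel
  rw [e] at h1
  simp only [map_add, map_sub, map_smul, h.2, h.map_star, smul_eq_mul, mul_one] at h1
  rw [mul_comm (star (φ a)) (φ a), sub_add_cancel, RCLike.star_def, Complex.mul_conj,
    Complex.sub_re, Complex.ofReal_re, Complex.normSq_eq_norm_sq] at h1
  linarith

end AlgState

/-! ### States of matrix algebras and density matrices -/

section MatrixState

variable {n : Type*} [Fintype n] [DecidableEq n] {φ : Matrix n n ℂ →ₗ[ℂ] ℂ}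

theorem IsAlgState.map_posSemidef (h : IsAlgState φ) {a : Matrix n n ℂ} (ha : a.PosSemidef) :
    0 ≤ φ a := by
  open scoped MatrixOrder in
  obtain ⟨b, rfl⟩ := CStarAlgebra.nonneg_iff_eq_star_mul_self.mp
    (Matrix.nonneg_iff_posSemidef.mpr ha)
  exact h.1 b

theorem posSemidef_smul_one_sub (a : Matrix n n ℂ) (ha : a.IsHermitian) :
    (((‖a‖ : ℝ) : ℂ) • (1 : Matrix n n ℂ) - a).PosSemidef := by
  open scoped MatrixOrder in
  have := IsSelfAdjoint.le_algebraMap_norm_self (a := a) ha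
  rw [Matrix.le_iff, Algebra.algebraMap_eq_smul_one] at this
  have e : ((‖a‖ : ℝ) : ℂ) • (1 : Matrix n n ℂ) = ‖a‖ • 1 := by ext i j; simp
  rw [e]
  exact this

/-- Combine nonnegativity of the variance with a*a ≤ ‖a*a‖·1 = ‖a‖²·1. -/
theorem IsAlgState.norm_le (h : IsAlgState φ) (a : Matrix n n ℂ) : ‖φ a‖ ≤ ‖a‖ := by
  have h1 := h.normSq_le a
  have h2 := h.map_posSemidef
    (posSemidef_smul_one_sub (star a * a) (Matrix.isHermitian_conjTranspose_mul_self a))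
  rw [map_sub, map_smul, h.2, CStarRing.norm_star_mul_self] at h2
  have h3 := (Complex.nonneg_iff.mp h2).1
  simp only [smul_eq_mul, mul_one, Complex.sub_re, Complex.ofReal_re] at h3
  exact abs_le_of_sq_le_sq' (by nlinarith) (norm_nonneg a) |>.2

/-- The matrix `ρ` with `φ(a) = Tr(ρ a)`. -/
def density (φ : Matrix n n ℂ →ₗ[ℂ] ℂ) : Matrix n n ℂ :=
  Matrix.of fun x y => φ (Matrix.single y x 1)

theorem trace_density_mul (φ : Matrix n n ℂ →ₗ[ℂ] ℂ) (a : Matrix n n ℂ) :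
    (density φ * a).trace = φ a := by
  conv_rhs => rw [Matrix.matrix_eq_sum_single a]
  simp only [Matrix.trace, Matrix.diag, Matrix.mul_apply, density, Matrix.of_apply, map_sum]
  rw [Finset.sum_comm]
  refine Finset.sum_congr rfl fun i _ => Finset.sum_congr rfl fun j _ => ?_
  rw [show Matrix.single i j (a i j) = a i j • Matrix.single i j (1 : ℂ) by simp, map_smul,
    smul_eq_mul, mul_comm]

theorem trace_density (h : IsAlgState φ) : (density φ).trace = 1 := by
  rw [← h.2, ← trace_density_mul φ 1, mul_one]

theorem isAlgState_of_nonneg (h : ∀ a : Matrix n n ℂ, a.PosSemidef → 0 ≤ φ a) (h1 : φ 1 = 1) :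
    IsAlgState φ :=
  ⟨fun a => h _ (Matrix.posSemidef_conjTranspose_mul_self a), h1⟩

/-- The quadratic form of the density matrix at v is φ of the positive rank-one matrix vv*. -/
theorem posSemidef_density (h : IsAlgState φ) : (density φ).PosSemidef := by
  have key (v : n → ℂ) : star v ⬝ᵥ (density φ *ᵥ v) = φ (Matrix.vecMulVec v (star v)) := by
    rw [← trace_density_mul, Matrix.mul_vecMulVec, Matrix.trace_vecMulVec, dotProduct_comm]
  refine Matrix.PosSemidef.of_dotProduct_mulVec_nonneg ?_ fun v => ?_
  · ext i j
    simp only [Matrix.conjTranspose_apply, density, Matrix.of_apply]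
    rw [← h.map_star]
    congr 1
    rw [Matrix.star_eq_conjTranspose, Matrix.conjTranspose_single, star_one]
  · rw [key]
    exact h.map_posSemidef (Matrix.posSemidef_vecMulVec_self_star v)

end MatrixState

/-! ### Von Neumann entropy and the Gibbs variational principle -/

section Spectral

variable {n : Type*} [Fintype n] [DecidableEq n]

/-- Joint spectral form of the trace of a product of functions of two Hermitian matrices: the
weights are the squared overlaps of the eigenbases. -/
theorem exists_trace_cfc_mul_cfc {A B : Matrix n n ℂ} (hA : A.IsHermitian) (hB : B.IsHermitian) :
    ∃ c : n → n → ℝ, (∀ i j, 0 ≤ c i j) ∧ (∀ i, ∑ j, c i j = 1) ∧ (∀ j, ∑ i, c i j = 1) ∧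
      ∀ f g : ℝ → ℝ, (cfc f A * cfc g B).trace =
        ((∑ i, ∑ j, c i j * f (hA.eigenvalues i) * g (hB.eigenvalues j) : ℝ) : ℂ) := by
  set U : Matrix n n ℂ := (hA.eigenvectorUnitary).1
  set W : Matrix n n ℂ := (hB.eigenvectorUnitary).1
  -- The overlap matrix of the two eigenbases; its unitarity makes the weights |V i j|² doubly
  -- stochastic.
  set V := star U * W
  have hU : star U * U = 1 := Unitary.star_mul_self_of_mem hA.eigenvectorUnitary.2
  have hU' : U * star U = 1 := Unitary.mul_star_self_of_mem hA.eigenvectorUnitary.2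
  have hW : star W * W = 1 := Unitary.star_mul_self_of_mem hB.eigenvectorUnitary.2
  have hW' : W * star W = 1 := Unitary.mul_star_self_of_mem hB.eigenvectorUnitary.2
  have hV : V * star V = 1 := by
    simp only [V, star_mul, star_star]
    rw [mul_assoc, ← mul_assoc W, hW', one_mul, hU]
  have hV' : star V * V = 1 := by
    simp only [V, star_mul, star_star]
    rw [mul_assoc, ← mul_assoc U, hU', one_mul, hW]
  have e (i j) : V i j * star (V i j) = ((Complex.normSq (V i j) : ℝ) : ℂ) := Complex.mul_conj _
  refine ⟨fun i j => Complex.normSq (V i j), fun _ _ => Complex.normSq_nonneg _, fun i => ?_,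
    fun j => ?_, fun f g => ?_⟩
  · have := congrFun (congrFun hV i) i
    simp only [Matrix.mul_apply, Matrix.star_apply, e, Matrix.one_apply_eq] at this
    exact_mod_cast this
  · have := congrFun (congrFun hV' j) j
    simp only [Matrix.mul_apply, Matrix.star_apply, Matrix.one_apply_eq] at this
    simp only [mul_comm (star _), e] at this
    exact_mod_cast this
  · rw [hA.cfc_eq, hB.cfc_eq, Matrix.IsHermitian.cfc, Matrix.IsHermitian.cfc,
      Unitary.conjStarAlgAut_apply, Unitary.conjStarAlgAut_apply]
    change (U * _ * star U * (W * _ * star W)).trace = _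
    set D := Matrix.diagonal (RCLike.ofReal (K := ℂ) ∘ f ∘ hA.eigenvalues)
    set E := Matrix.diagonal (RCLike.ofReal (K := ℂ) ∘ g ∘ hB.eigenvalues)
    have : (U * D * star U * (W * E * star W)).trace = ((D * V) * (E * star V)).trace := by
      rw [show U * D * star U * (W * E * star W) = U * (D * V * (E * star W)) by
        simp only [V, mul_assoc], Matrix.trace_mul_comm]
      simp only [V, star_mul, star_star, mul_assoc]
    rw [this]
    simp only [Matrix.trace, Matrix.diag, Matrix.mul_apply (M := D * V), D, E,
      Matrix.diagonal_mul, Function.comp_apply, Matrix.star_apply]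
    push_cast
    refine Finset.sum_congr rfl fun i _ => Finset.sum_congr rfl fun j _ => ?_
    rw [← e]
    simp only [Complex.coe_algebraMap, RCLike.star_def]
    ring

theorem trace_cfc {A : Matrix n n ℂ} (hA : A.IsHermitian) (f : ℝ → ℝ) :
    (cfc f A).trace = ((∑ i, f (hA.eigenvalues i) : ℝ) : ℂ) := by
  obtain ⟨c, -, h1, -, h⟩ := exists_trace_cfc_mul_cfc hA hA
  have h2 := h f (fun _ => 1)
  rw [cfc_const_one ℝ A, mul_one] at h2
  rw [h2]
  congr 1
  refine Finset.sum_congr rfl fun i _ => ?_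
  simp_rw [mul_one, ← Finset.sum_mul, h1, one_mul]

theorem exp_eq_cfc {K : Matrix n n ℂ} (hK : K.IsHermitian) :
    NormedSpace.exp K = cfc Real.exp K :=
  (CFC.real_exp_eq_normedSpace_exp (a := K) hK).symm

theorem trace_exp {K : Matrix n n ℂ} (hK : K.IsHermitian) :
    (NormedSpace.exp K).trace = ((∑ i, Real.exp (hK.eigenvalues i) : ℝ) : ℂ) := by
  rw [exp_eq_cfc hK, trace_cfc hK]

theorem trace_exp_re_pos [Nonempty n] {K : Matrix n n ℂ} (hK : K.IsHermitian) :
    0 < (NormedSpace.exp K).trace.re := by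
  rw [trace_exp hK, Complex.ofReal_re]
  exact Finset.sum_pos (fun i _ => Real.exp_pos _) Finset.univ_nonempty

/-- The von Neumann entropy `-Tr(ρ log ρ)`. -/
def vnEntropy (ρ : Matrix n n ℂ) : ℝ := (cfc Real.negMulLog ρ).trace.re

theorem eigenvalues_nonneg_sum {ρ : Matrix n n ℂ} (hρ : ρ.PosSemidef) (h1 : ρ.trace = 1) :
    (∀ i, 0 ≤ hρ.1.eigenvalues i) ∧ ∑ i, hρ.1.eigenvalues i = 1 := by
  refine ⟨hρ.eigenvalues_nonneg, ?_⟩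
  have := hρ.1.trace_eq_sum_eigenvalues
  rw [h1, ← RCLike.ofReal_sum] at this
  exact (Complex.ofReal_injective (by simpa using this)).symm

theorem vnEntropy_nonneg {ρ : Matrix n n ℂ} (hρ : ρ.PosSemidef) (h1 : ρ.trace = 1) :
    0 ≤ vnEntropy ρ := by
  obtain ⟨hp, hs⟩ := eigenvalues_nonneg_sum hρ h1
  rw [vnEntropy, trace_cfc hρ.1, Complex.ofReal_re]
  refine Finset.sum_nonneg fun i _ => Real.negMulLog_nonneg (hp i) ?_
  rw [← hs]
  exact Finset.single_le_sum (fun j _ => hp j) (Finset.mem_univ i)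

/-- This is p times log x ≤ x - 1 at x = e^κ/(Zp). The error e^κ/Z - p is kept because it averages
to zero over the two spectra when Σp = 1 and Z = Σe^κ. -/
theorem mul_sub_log_le {p κ Z : ℝ} (hp : 0 ≤ p) (hZ : 0 < Z) :
    Real.negMulLog p + p * κ ≤ p * Real.log Z + (Real.exp κ / Z - p) := by
  rcases hp.eq_or_lt with rfl | hp
  · simp; positivity
  have h := Real.log_le_sub_one_of_pos (x := Real.exp κ / (Z * p)) (by positivity)
  rw [Real.log_div (by positivity) (by positivity), Real.log_mul hZ.ne' hp.ne', Real.log_exp] at h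
  have h2 := mul_le_mul_of_nonneg_left h hp.le
  have e : p * (Real.exp κ / (Z * p) - 1) = Real.exp κ / Z - p := by field_simp
  rw [e] at h2
  rw [Real.negMulLog]
  linarith

/-- The Gibbs variational inequality. -/
theorem vnEntropy_add_le {ρ K : Matrix n n ℂ} (hρ : ρ.PosSemidef) (h1 : ρ.trace = 1)
    (hK : K.IsHermitian) :
    vnEntropy ρ + (ρ * K).trace.re ≤ Real.log (NormedSpace.exp K).trace.re := by
  obtain ⟨hp, hs⟩ := eigenvalues_nonneg_sum hρ h1
  obtain ⟨c, c0, c1, c2, h⟩ := exists_trace_cfc_mul_cfc hρ.1 hK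
  have hne : Nonempty n := by
    by_contra hn
    rw [not_nonempty_iff] at hn
    simp at hs
  have hZ := trace_exp_re_pos hK
  have hZ' := congrArg Complex.re (trace_exp hK)
  rw [Complex.ofReal_re] at hZ'
  set Z := (NormedSpace.exp K).trace.re
  have hE := h id id
  rw [show cfc id ρ = ρ from cfc_id ℝ ρ hρ.1, show cfc id K = K from cfc_id ℝ K hK] at hE
  rw [vnEntropy, trace_cfc hρ.1, hE, Complex.ofReal_re, Complex.ofReal_re]
  set p := hρ.1.eigenvalues
  set κ := hK.eigenvalues
  -- The scalar inequality is averaged with the doubly stochastic weights: row sums restore the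
  -- entropy and log Z, column sums give Σ e^κ/Z = 1, which cancels Σ p = 1.
  calc ∑ i, Real.negMulLog (p i) + ∑ i, ∑ j, c i j * p i * κ j
      = ∑ i, ∑ j, c i j * (Real.negMulLog (p i) + p i * κ j) := by
        rw [← Finset.sum_add_distrib]
        refine Finset.sum_congr rfl fun i _ => ?_
        simp_rw [mul_add, Finset.sum_add_distrib, ← Finset.sum_mul, c1, one_mul, mul_assoc]
    _ ≤ ∑ i, ∑ j, c i j * (p i * Real.log Z + (Real.exp (κ j) / Z - p i)) := by
        exact Finset.sum_le_sum fun i _ => Finset.sum_le_sum fun j _ =>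
          mul_le_mul_of_nonneg_left (mul_sub_log_le (hp i) hZ) (c0 i j)
    _ = ∑ i, ∑ j, c i j * (p i * Real.log Z - p i) + ∑ j, ∑ i, c i j * (Real.exp (κ j) / Z) := by
        rw [Finset.sum_comm (f := fun j i => c i j * (Real.exp (κ j) / Z)),
          ← Finset.sum_add_distrib]
        refine Finset.sum_congr rfl fun i _ => ?_
        rw [← Finset.sum_add_distrib]
        refine Finset.sum_congr rfl fun j _ => ?_
        ring
    _ = Real.log Z := by
        simp_rw [← Finset.sum_mul, c1, c2, one_mul, Finset.sum_sub_distrib, ← Finset.sum_mul,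
          ← Finset.sum_div, hs, ← hZ', div_self hZ.ne']
        ring

/-- The Gibbs variational inequality is an equality at the Gibbs state. -/
theorem vnEntropy_gibbs [Nonempty n] {K : Matrix n n ℂ} (hK : K.IsHermitian) {ρ : Matrix n n ℂ}
    (hρ : ρ = (NormedSpace.exp K).trace⁻¹ • NormedSpace.exp K) :
    vnEntropy ρ + (ρ * K).trace.re = Real.log (NormedSpace.exp K).trace.re := by
  have hZ := trace_exp_re_pos hK
  have hZ' := trace_exp hK
  have hZ'' := congrArg Complex.re hZ'
  rw [Complex.ofReal_re] at hZ''
  rw [← hZ''] at hZ'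
  set Z := (NormedSpace.exp K).trace.re
  have hc (f : ℝ → ℝ) : ContinuousOn f (spectrum ℝ K) :=
    (Matrix.finite_real_spectrum (A := K)).continuousOn f
  have e : ρ = cfc (fun x => Real.exp x / Z) K := by
    rw [hρ, hZ', exp_eq_cfc hK]
    have : (fun x => Real.exp x / Z) = fun x => Z⁻¹ • Real.exp x := by
      ext x; simp [div_eq_inv_mul]
    rw [this, cfc_smul (Z⁻¹) Real.exp K (hc _)]
    ext i j
    simp
  have hKsa : IsSelfAdjoint K := hK
  have h1 : cfc Real.negMulLog ρ = cfc (fun x => Real.negMulLog (Real.exp x / Z)) K := by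
    rw [e]
    exact (cfc_comp' Real.negMulLog (fun x => Real.exp x / Z) K
      (Real.continuous_negMulLog.continuousOn) (hc _) hKsa).symm
  have h2 : ρ * K = cfc (fun x => Real.exp x / Z * x) K := by
    rw [cfc_mul (fun x => Real.exp x / Z) (fun x => x) K (hc _) (hc _), ← e, cfc_id' ℝ K hKsa]
  rw [vnEntropy, h1, h2, trace_cfc hK, trace_cfc hK, Complex.ofReal_re, Complex.ofReal_re,
    ← Finset.sum_add_distrib]
  have (x : ℝ) : Real.negMulLog (Real.exp x / Z) + Real.exp x / Z * x =
      Real.exp x / Z * Real.log Z := by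
    rw [Real.negMulLog, Real.log_div (Real.exp_pos x).ne' hZ.ne', Real.log_exp]
    ring
  simp_rw [this]
  rw [← Finset.sum_mul, ← Finset.sum_div, ← hZ'', div_self hZ.ne', one_mul]

/-- The entropy is the infimum over `K` of `log Tr e^K - Tr ρK`. -/
theorem exists_log_trace_exp_sub_le {ρ : Matrix n n ℂ} (hρ : ρ.PosSemidef) (h1 : ρ.trace = 1)
    {ε : ℝ} (hε : 0 < ε) : ∃ K : Matrix n n ℂ, K.IsHermitian ∧
      Real.log (NormedSpace.exp K).trace.re - (ρ * K).trace.re ≤ vnEntropy ρ + ε := by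
  obtain ⟨hp, hs⟩ := eigenvalues_nonneg_sum hρ h1
  -- The optimal choice would be K = log ρ, undefined on the kernel of ρ. The regularisation K =
  -- log(ρ + δ) has Tr e^K = 1 + card·δ, whose logarithm is at most ε.
  set δ := ε / (Fintype.card n + 1)
  have hδ : 0 < δ := by positivity
  have hδ' : Fintype.card n * δ ≤ ε := by
    have : ε = (Fintype.card n + 1) * δ := by simp only [δ]; field_simp
    nlinarith
  have hc (f : ℝ → ℝ) : ContinuousOn f (spectrum ℝ ρ) :=
    (Matrix.finite_real_spectrum (A := ρ)).continuousOn f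
  have hsa : IsSelfAdjoint ρ := hρ.1
  set K := cfc (fun x => Real.log (x + δ)) ρ
  have hK : K.IsHermitian := cfc_predicate (fun x => Real.log (x + δ)) ρ
  refine ⟨K, hK, ?_⟩
  have e1 : (NormedSpace.exp K).trace.re = 1 + Fintype.card n * δ := by
    rw [exp_eq_cfc hK, ← cfc_comp' Real.exp (fun x => Real.log (x + δ)) ρ
      (Real.continuous_exp.continuousOn) (hc _) hsa, trace_cfc hρ.1, Complex.ofReal_re,
      Finset.sum_congr rfl fun i _ => Real.exp_log (add_pos_of_nonneg_of_pos (hp i) hδ),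
      Finset.sum_add_distrib, hs]
    simp
  have e2 : (ρ * K).trace.re = ∑ i, hρ.1.eigenvalues i * Real.log (hρ.1.eigenvalues i + δ) := by
    have : ρ * K = cfc (fun x => x * Real.log (x + δ)) ρ := by
      rw [cfc_mul (fun x => x) (fun x => Real.log (x + δ)) ρ (hc _) (hc _), cfc_id' ℝ ρ hsa]
    rw [this, trace_cfc hρ.1, Complex.ofReal_re]
  have e3 : Real.log (1 + Fintype.card n * δ) ≤ ε := by
    have := Real.log_le_sub_one_of_pos (x := 1 + Fintype.card n * δ) (by positivity)
    linarith
  have e4 : -vnEntropy ρ ≤ (ρ * K).trace.re := by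
    rw [e2, vnEntropy, trace_cfc hρ.1, Complex.ofReal_re, ← Finset.sum_neg_distrib]
    refine Finset.sum_le_sum fun i _ => ?_
    rw [Real.negMulLog, neg_mul, neg_neg]
    rcases (hp i).eq_or_lt with h | h
    · simp [← h]
    · gcongr
      linarith
  rw [e1]
  linarith

/-- The case K = 0 of the variational inequality. -/
theorem vnEntropy_le_log_card {ρ : Matrix n n ℂ} (hρ : ρ.PosSemidef) (h1 : ρ.trace = 1) :
    vnEntropy ρ ≤ Real.log (Fintype.card n) := by
  have := vnEntropy_add_le hρ h1 Matrix.isHermitian_zero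
  simpa [NormedSpace.exp_zero] using this

end Spectral

/-! ### Permutations of the sites, symmetrisation and restriction -/

section Permute

variable {k M N : ℕ}

/-- The action of a permutation of the tensor factors. -/
def permute (σ : Equiv.Perm (Fin N)) : LocalAlg k N ≃ₐ[ℂ] LocalAlg k N :=
  Matrix.reindexAlgEquiv ℂ ℂ (Equiv.arrowCongr σ (Equiv.refl (Fin k)))

theorem permute_apply (σ : Equiv.Perm (Fin N)) (a : LocalAlg k N) (x y : Fin N → Fin k) :
    permute σ a x y = a (x ∘ σ) (y ∘ σ) := rfl

theorem permute_permute (σ τ : Equiv.Perm (Fin N)) (a : LocalAlg k N) :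
    permute σ (permute τ a) = permute (σ * τ) a := rfl

theorem permute_star (σ : Equiv.Perm (Fin N)) (a : LocalAlg k N) :
    permute σ (star a) = star (permute σ a) := rfl

theorem continuous_permute (σ : Equiv.Perm (Fin N)) :
    Continuous (permute σ : LocalAlg k N → LocalAlg k N) :=
  ((permute σ).toLinearMap : LocalAlg k N →ₗ[ℂ] LocalAlg k N).continuous_of_finiteDimensional

theorem trace_permute (σ : Equiv.Perm (Fin N)) (a : LocalAlg k N) :
    (permute σ a).trace = a.trace :=
  (Equiv.sum_comp (Equiv.arrowCongr σ (Equiv.refl (Fin k))).symm (fun x => a x x))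

theorem symmetrize_eq (a : LocalAlg k N) :
    symmetrize a = ((N.factorial : ℂ)⁻¹) • ∑ σ : Equiv.Perm (Fin N), permute σ a := rfl

/-- The symmetrisation operator as a linear map. -/
def symmetrizeₗ : LocalAlg k N →ₗ[ℂ] LocalAlg k N :=
  ((N.factorial : ℂ)⁻¹) • ∑ σ : Equiv.Perm (Fin N), (permute σ).toLinearMap

theorem symmetrizeₗ_apply (a : LocalAlg k N) : symmetrizeₗ a = symmetrize a := by
  simp [symmetrizeₗ, symmetrize_eq]

theorem permute_symmetrize (τ : Equiv.Perm (Fin N)) (a : LocalAlg k N) :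
    permute τ (symmetrize a) = symmetrize a := by
  rw [symmetrize_eq, map_smul, map_sum]
  congr 1
  simp_rw [permute_permute]
  exact Fintype.sum_equiv (Equiv.mulLeft τ) _ _ fun σ => rfl

theorem symmetrize_permute (τ : Equiv.Perm (Fin N)) (a : LocalAlg k N) :
    symmetrize (permute τ a) = symmetrize a := by
  rw [symmetrize_eq, symmetrize_eq]
  congr 1
  simp_rw [permute_permute]
  exact Fintype.sum_equiv (Equiv.mulRight τ) _ _ fun σ => rfl

theorem average_const {V : Type*} [AddCommGroup V] [Module ℂ V] (v : V) :
    ((N.factorial : ℂ)⁻¹) • ∑ _σ : Equiv.Perm (Fin N), v = v := by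
  rw [Finset.sum_const, Finset.card_univ, Fintype.card_perm, Fintype.card_fin,
    ← Nat.cast_smul_eq_nsmul ℂ, smul_smul, inv_mul_cancel₀, one_smul]
  exact_mod_cast N.factorial_ne_zero

theorem symmetrize_of_permute_eq {a : LocalAlg k N} (h : ∀ σ, permute σ a = a) :
    symmetrize a = a := by
  simp_rw [symmetrize_eq, h]
  exact average_const a

theorem symmetrize_symmetrize (a : LocalAlg k N) : symmetrize (symmetrize a) = symmetrize a :=
  symmetrize_of_permute_eq fun σ => permute_symmetrize σ a

theorem permute_eq_of_symmetrize_eq {a : LocalAlg k N} (h : symmetrize a = a)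
    (σ : Equiv.Perm (Fin N)) : permute σ a = a := by
  rw [← h, permute_symmetrize]

theorem symmetrize_star (a : LocalAlg k N) : symmetrize (star a) = star (symmetrize a) := by
  simp_rw [symmetrize_eq, permute_star, star_smul, star_sum]
  congr 1
  simp

theorem exists_extend_perm (h : M ≤ N) (σ : Equiv.Perm (Fin M)) :
    ∃ τ : Equiv.Perm (Fin N), (∀ i, τ (Fin.castLE h i) = Fin.castLE h (σ i)) ∧
      ∀ i : Fin N, M ≤ i.val → τ i = i := by
  let f : Fin M ≃ {i : Fin N // i.val < M} :=
    { toFun i := ⟨Fin.castLE h i, i.2⟩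
      invFun i := ⟨i.1.1, i.2⟩
      left_inv i := rfl
      right_inv i := rfl }
  refine ⟨σ.extendDomain f, fun i => ?_, fun i hi => ?_⟩
  · exact Equiv.Perm.extendDomain_apply_image σ f i
  · exact Equiv.Perm.extendDomain_apply_not_subtype σ f (not_lt.mpr hi)

/-- Extend σ by the identity on the other sites. This gives S_{M,N} ∘ S_M = S_{M,N} and the
permutation invariance of marginals. -/
theorem embed_permute (h : M ≤ N) (σ : Equiv.Perm (Fin M)) :
    ∃ τ : Equiv.Perm (Fin N), ∀ a : LocalAlg k M,
      embed h (permute σ a) = permute τ (embed h a) := by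
  obtain ⟨τ, h1, h2⟩ := exists_extend_perm h σ
  refine ⟨τ, fun a => ?_⟩
  ext x y
  rw [embed_apply, permute_apply, permute_apply, embed_apply]
  have e : (∀ i : Fin N, M ≤ i.val → x i = y i) ↔
      (∀ i : Fin N, M ≤ i.val → (x ∘ τ) i = (y ∘ τ) i) := by
    refine forall_congr' fun i => forall_congr' fun hi => ?_
    simp [h2 i hi]
  simp only [e]
  congr 2 <;> (ext i; simp [h1])

theorem symEmbed_permute (h : M ≤ N) (σ : Equiv.Perm (Fin M)) (a : LocalAlg k M) :
    symEmbed h (permute σ a) = symEmbed h a := by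
  obtain ⟨τ, hτ⟩ := embed_permute (k := k) h σ
  rw [symEmbed, hτ, symmetrize_permute, symEmbed]

/-- `S_{M,N}` as a linear map. -/
def symEmbedₗ (h : M ≤ N) : LocalAlg k M →ₗ[ℂ] LocalAlg k N :=
  symmetrizeₗ ∘ₗ (embed h).toAlgHom.toLinearMap

theorem symEmbedₗ_apply (h : M ≤ N) (a : LocalAlg k M) : symEmbedₗ h a = symEmbed h a :=
  symmetrizeₗ_apply _

theorem symEmbed_symmetrize (h : M ≤ N) (a : LocalAlg k M) :
    symEmbed h (symmetrize a) = symEmbed h a := by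
  rw [← symEmbedₗ_apply, symmetrize_eq, map_smul, map_sum]
  simp_rw [symEmbedₗ_apply, symEmbed_permute]
  exact average_const _

/-- Permutation invariance of a functional on `M_k(ℂ)^{⊗N}`. -/
def IsPermInv (φ : LocalAlg k N →ₗ[ℂ] ℂ) : Prop :=
  ∀ (σ : Equiv.Perm (Fin N)) (a : LocalAlg k N), φ (permute σ a) = φ a

theorem IsPermInv.map_symmetrize {φ : LocalAlg k N →ₗ[ℂ] ℂ} (hφ : IsPermInv φ)
    (a : LocalAlg k N) : φ (symmetrize a) = φ a := by
  rw [symmetrize_eq, map_smul, map_sum]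
  simp_rw [hφ _ a]
  exact average_const _

theorem isPermInv_of_map_symmetrize {φ : LocalAlg k N →ₗ[ℂ] ℂ}
    (hφ : ∀ a, φ (symmetrize a) = φ a) : IsPermInv φ := fun σ a => by
  rw [← hφ, symmetrize_permute, hφ]

/-- The restriction of a functional on `N` sites to the first `M` sites. -/
def restr (h : M ≤ N) (φ : LocalAlg k N →ₗ[ℂ] ℂ) : LocalAlg k M →ₗ[ℂ] ℂ :=
  φ ∘ₗ (embed h).toAlgHom.toLinearMap

theorem restr_apply (h : M ≤ N) (φ : LocalAlg k N →ₗ[ℂ] ℂ) (a : LocalAlg k M) :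
    restr h φ a = φ (embed h a) := rfl

theorem restr_restr {L : ℕ} (h : L ≤ M) (h' : M ≤ N) (φ : LocalAlg k N →ₗ[ℂ] ℂ) :
    restr h (restr h' φ) = restr (h.trans h') φ := by
  ext1 a
  rw [restr_apply, restr_apply, restr_apply, embed_embed]

theorem embed_self (a : LocalAlg k N) : embed le_rfl a = a := by
  ext x y
  rw [embed_apply, if_pos fun i hi => absurd i.2 (not_lt.mpr hi), mul_one]
  rfl

theorem restr_self (φ : LocalAlg k N →ₗ[ℂ] ℂ) : restr le_rfl φ = φ := by
  ext1 a
  rw [restr_apply, embed_self]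

theorem IsPermInv.restr {φ : LocalAlg k N →ₗ[ℂ] ℂ} (hφ : IsPermInv φ) (h : M ≤ N) :
    IsPermInv (restr h φ) := fun σ a => by
  obtain ⟨τ, hτ⟩ := embed_permute (k := k) h σ
  rw [restr_apply, hτ, hφ, restr_apply]

theorem IsAlgState.restr {φ : LocalAlg k N →ₗ[ℂ] ℂ} (hφ : IsAlgState φ) (h : M ≤ N) :
    IsAlgState (restr h φ) := by
  refine ⟨fun a => ?_, ?_⟩
  · rw [restr_apply, map_mul, StarHomClass.map_star]
    exact hφ.1 _
  · rw [restr_apply, map_one, hφ.2]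

end Permute

/-! ### Observables on disjoint blocks -/

section Blocks

variable {k m n : ℕ}

/-- The permutation of `m + n` sites moving the first `n` sites to the last `n` sites. -/
def blockFlip (m n : ℕ) : Equiv.Perm (Fin (m + n)) :=
  (finCongr (add_comm m n)).trans finAddFlip

theorem blockFlip_castLE (i : Fin n) :
    blockFlip m n (Fin.castLE (Nat.le_add_left n m) i) = Fin.natAdd m i := by
  have : finCongr (add_comm m n) (Fin.castLE (Nat.le_add_left n m) i) = Fin.castAdd m i := by
    ext; simp
  rw [blockFlip, Equiv.trans_apply, this, finAddFlip_apply_castAdd]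

theorem blockFlip_add (i : Fin m) (h : n + i.1 < m + n) :
    blockFlip m n ⟨n + i, h⟩ = Fin.castAdd n i := by
  have : finCongr (add_comm m n) ⟨n + i, h⟩ = Fin.natAdd n i := by
    ext; simp
  rw [blockFlip, Equiv.trans_apply, this, finAddFlip_apply_natAdd]

theorem embed_eq_kronecker (a : LocalAlg k m) :
    embed (Nat.le_add_right m n) a = Matrix.reindexAlgEquiv ℂ ℂ (Fin.appendEquiv m n)
      (Matrix.kronecker a (1 : LocalAlg k n)) := by
  ext x y
  rw [embed_apply]
  simp only [Matrix.coe_reindexAlgEquiv, Matrix.reindex_apply, Matrix.submatrix_apply,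
    Matrix.kronecker, Matrix.kroneckerMap_apply, Matrix.one_apply]
  congr 1
  refine if_congr ⟨fun h => funext fun i => ?_, fun h i hi => ?_⟩ rfl rfl
  · exact h (Fin.natAdd m i) (by simp)
  · have := congrFun h (⟨i.1 - m, by omega⟩ : Fin n)
    convert this using 1
    all_goals
      simp only [Fin.appendEquiv, Equiv.coe_fn_symm_mk]
      congr 1
      ext
      simp
      omega

theorem permute_embed_eq_kronecker (b : LocalAlg k n) :
    permute (blockFlip m n) (embed (Nat.le_add_left n m) b) =
      Matrix.reindexAlgEquiv ℂ ℂ (Fin.appendEquiv m n)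
      (Matrix.kronecker (1 : LocalAlg k m) b) := by
  ext x y
  rw [permute_apply, embed_apply, mul_comm]
  simp only [Matrix.coe_reindexAlgEquiv, Matrix.reindex_apply, Matrix.submatrix_apply,
    Matrix.kronecker, Matrix.kroneckerMap_apply, Matrix.one_apply, Function.comp_apply,
    blockFlip_castLE]
  congr 1
  refine if_congr ⟨fun h => funext fun i => ?_, fun h i hi => ?_⟩ rfl rfl
  · have := h ⟨n + i, by omega⟩ (by simp)
    rwa [blockFlip_add] at this
  · have := congrFun h (⟨i.1 - n, by omega⟩ : Fin m)
    have e : i = ⟨n + (⟨i.1 - n, by omega⟩ : Fin m).1, by simp; omega⟩ := by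
      ext; simp; omega
    rw [e, blockFlip_add]
    exact this

/-- Up to reindexing the two elements are a⊗1 and 1⊗b. -/
theorem commute_blocks (a : LocalAlg k m) (b : LocalAlg k n) :
    Commute (embed (Nat.le_add_right m n) a)
      (permute (blockFlip m n) (embed (Nat.le_add_left n m) b)) := by
  rw [embed_eq_kronecker, permute_embed_eq_kronecker]
  refine Commute.map ?_ _
  change Matrix.kronecker _ _ * Matrix.kronecker _ _ = Matrix.kronecker _ _ * Matrix.kronecker _ _
  simp only [Matrix.kronecker]
  erw [← Matrix.mul_kronecker_mul, ← Matrix.mul_kronecker_mul]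
  simp

theorem trace_blocks (a : LocalAlg k m) (b : LocalAlg k n) :
    (embed (Nat.le_add_right m n) a *
      permute (blockFlip m n) (embed (Nat.le_add_left n m) b)).trace = a.trace * b.trace := by
  rw [embed_eq_kronecker, permute_embed_eq_kronecker, ← map_mul]
  have e : Matrix.kronecker a (1 : LocalAlg k n) * Matrix.kronecker (1 : LocalAlg k m) b =
      Matrix.kronecker a b := by
    simp only [Matrix.kronecker]
    erw [← Matrix.mul_kronecker_mul]
    simp
  rw [e, ← Matrix.trace_kronecker a b]
  exact Equiv.sum_comp (Fin.appendEquiv m n).symm (fun x => Matrix.kronecker a b x x)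

theorem continuous_embed {M N : ℕ} (h : M ≤ N) :
    Continuous (embed h : LocalAlg k M → LocalAlg k N) :=
  ((embed h).toAlgHom.toLinearMap : LocalAlg k M →ₗ[ℂ] LocalAlg k N).continuous_of_finiteDimensional

theorem map_exp_localAlg {M N : ℕ} {F : Type*} [FunLike F (LocalAlg k M) (LocalAlg k N)]
    [RingHomClass F (LocalAlg k M) (LocalAlg k N)] (f : F) (hf : Continuous f) (x : LocalAlg k M) :
    f (NormedSpace.exp x) = NormedSpace.exp (f x) :=
  NormedSpace.map_exp_of_mem_ball (𝕂 := ℂ) f hf x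
    ((NormedSpace.expSeries_radius_eq_top ℂ (LocalAlg k M)).symm ▸ edist_lt_top _ _)

/-- Exponentials of commuting block observables factorise. Additivity of log Tr e^K over blocks is
the dual form of entropy subadditivity. -/
theorem trace_exp_blocks (a : LocalAlg k m) (b : LocalAlg k n) :
    (NormedSpace.exp (embed (Nat.le_add_right m n) a +
      permute (blockFlip m n) (embed (Nat.le_add_left n m) b))).trace =
      (NormedSpace.exp a).trace * (NormedSpace.exp b).trace := by
  rw [Matrix.exp_add_of_commute _ _ (commute_blocks a b), ← trace_blocks,
    map_exp_localAlg (embed _) (continuous_embed _),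
    map_exp_localAlg (embed _) (continuous_embed _),
    map_exp_localAlg (permute _) (continuous_permute _)]

end Blocks

/-! ### Subadditivity of the entropy and finite-size bounds -/

section Entropy

variable {k N : ℕ} {φ : LocalAlg k N →ₗ[ℂ] ℂ}

theorem localEntropy_add_le (hφ : IsAlgState φ) {K : LocalAlg k N} (hK : K.IsHermitian) :
    localEntropy φ + (φ K).re ≤ Real.log (NormedSpace.exp K).trace.re := by
  rw [← trace_density_mul φ K]
  exact vnEntropy_add_le (posSemidef_density hφ) (trace_density hφ) hK

theorem exists_log_trace_exp_sub_le_localEntropy (hφ : IsAlgState φ) {ε : ℝ} (hε : 0 < ε) :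
    ∃ K : LocalAlg k N, K.IsHermitian ∧
      Real.log (NormedSpace.exp K).trace.re - (φ K).re ≤ localEntropy φ + ε := by
  obtain ⟨K, hK, h⟩ :=
    exists_log_trace_exp_sub_le (posSemidef_density hφ) (trace_density hφ) hε
  rw [trace_density_mul φ K] at h
  exact ⟨K, hK, h⟩

theorem localEntropy_nonneg (hφ : IsAlgState φ) : 0 ≤ localEntropy φ :=
  vnEntropy_nonneg (posSemidef_density hφ) (trace_density hφ)

theorem localEntropy_le (hφ : IsAlgState φ) : localEntropy φ ≤ N * Real.log k := by
  have := vnEntropy_le_log_card (posSemidef_density hφ) (trace_density hφ)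
  simp only [Fintype.card_pi, Fintype.card_fin, Finset.prod_const, Finset.card_univ, Nat.cast_pow,
    Real.log_pow] at this
  exact this

theorem isHermitian_embed {M : ℕ} (h : M ≤ N) {a : LocalAlg k M} (ha : a.IsHermitian) :
    (embed h a).IsHermitian := by
  have : IsSelfAdjoint a := ha
  exact this.map (embed h)

theorem isHermitian_permute (σ : Equiv.Perm (Fin N)) {a : LocalAlg k N} (ha : a.IsHermitian) :
    (permute σ a).IsHermitian := by
  have : star (permute σ a) = permute σ a := by
    rw [← permute_star, Matrix.star_eq_conjTranspose, ha.eq]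
  exact this

/-- Subadditivity of the entropy for permutation invariant states. -/
theorem localEntropy_add_blocks_le [NeZero k] {m n : ℕ} {φ : LocalAlg k (m + n) →ₗ[ℂ] ℂ}
    (hφ : IsAlgState φ) (hp : IsPermInv φ) :
    localEntropy φ ≤ localEntropy (restr (Nat.le_add_right m n) φ) +
      localEntropy (restr (Nat.le_add_left n m) φ) := by
  refine le_of_forall_pos_le_add fun ε hε => ?_
  obtain ⟨K, hK, h1⟩ := exists_log_trace_exp_sub_le_localEntropy
    (hφ.restr (Nat.le_add_right m n)) (half_pos hε)
  obtain ⟨L, hL, h2⟩ := exists_log_trace_exp_sub_le_localEntropy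
    (hφ.restr (Nat.le_add_left n m)) (half_pos hε)
  -- The sum K⊗1 + 1⊗L of nearly optimal observables for the two marginals is tested against φ.
  -- Permutation invariance identifies the expectation on the last n sites with that on the first n.
  have h3 := localEntropy_add_le hφ ((isHermitian_embed (Nat.le_add_right m n) hK).add
    (isHermitian_permute (blockFlip m n) (isHermitian_embed (Nat.le_add_left n m) hL)))
  have hK' := trace_exp_re_pos hK
  have hL' := trace_exp_re_pos hL
  have e : ((NormedSpace.exp K).trace * (NormedSpace.exp L).trace).re =
      (NormedSpace.exp K).trace.re * (NormedSpace.exp L).trace.re := by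
    rw [trace_exp hK, trace_exp hL, ← Complex.ofReal_mul]
    simp only [Complex.ofReal_re]
  rw [trace_exp_blocks, e, Real.log_mul hK'.ne' hL'.ne', map_add, hp, Complex.add_re] at h3
  rw [restr_apply] at h1 h2
  linarith

/-- Split off blocks of M sites one by one; by permutation invariance all of them have the same
marginal. -/
theorem localEntropy_restr_mul_add_le [NeZero k] (hφ : IsAlgState φ) (hp : IsPermInv φ) {M : ℕ}
    (hM : M ≤ N) (q r : ℕ) (h : q * M + r ≤ N) :
    localEntropy (restr h φ) ≤
      q * localEntropy (restr hM φ) + localEntropy (restr (le_of_add_le_right h) φ) := by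
  have sub : ∀ (m n L : ℕ) (hm : m ≤ N) (hn : n ≤ N) (hL : L ≤ N), L = m + n →
      localEntropy (restr hL φ) ≤ localEntropy (restr hm φ) + localEntropy (restr hn φ) := by
    rintro m n _ hm hn hL rfl
    have := localEntropy_add_blocks_le (hφ.restr hL) (hp.restr hL)
    rwa [restr_restr, restr_restr] at this
  induction q with
  | zero =>
    have e : 0 * M + r = r := by ring
    simp only [Nat.cast_zero, zero_mul, zero_add]
    have : ∀ (s : ℕ) (hs : s ≤ N) (hr : r ≤ N), s = r →
        localEntropy (restr hs φ) ≤ localEntropy (restr hr φ) := by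
      rintro s hs hr rfl
      exact le_rfl
    exact this _ _ _ e
  | succ q ih =>
    have e : (q + 1) * M + r = M + (q * M + r) := by ring
    have h' : q * M + r ≤ N := by omega
    have := sub _ _ _ hM h' h e
    have := ih h'
    push_cast
    linarith

/-- Divide N by M: the fewer than M remaining sites contribute at most M log k. Apart from a
vanishing error, only a marginal of fixed size remains, and that is what a limit of states controls.
-/
theorem localEntropy_div_le [NeZero k] (hφ : IsAlgState φ) (hp : IsPermInv φ) {M : ℕ}
    (hM0 : 0 < M) (hM : M ≤ N) :
    localEntropy φ / N ≤ localEntropy (restr hM φ) / M + M * Real.log k / N := by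
  have hN : 0 < N := hM0.trans_le hM
  have e : N / M * M + N % M = N := Nat.div_add_mod' N M
  have h1 := localEntropy_restr_mul_add_le hφ hp hM (N / M) (N % M) e.le
  have h2 : localEntropy (restr e.le φ) = localEntropy φ := by
    have : ∀ (s : ℕ) (hs : s ≤ N), s = N → localEntropy (restr hs φ) = localEntropy φ := by
      rintro s hs rfl
      rw [restr_self]
    exact this _ _ e
  rw [h2] at h1
  have h3 := localEntropy_le (hφ.restr (le_of_add_le_right e.le))
  have hlog : 0 ≤ Real.log k := Real.log_natCast_nonneg k
  have h4 : ((N % M : ℕ) : ℝ) * Real.log k ≤ M * Real.log k := by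
    gcongr
    exact (Nat.mod_lt _ hM0).le
  have h5 : ((N / M : ℕ) : ℝ) ≤ N / M := Nat.cast_div_le
  have h6 := mul_le_mul_of_nonneg_right h5 (localEntropy_nonneg (hφ.restr hM))
  have hN' : (0 : ℝ) < N := by exact_mod_cast hN
  have hM' : (0 : ℝ) < M := by exact_mod_cast hM0
  rw [div_le_iff₀ hN', add_mul, div_mul_cancel₀ _ hN'.ne']
  calc localEntropy φ ≤ N / M * localEntropy (restr hM φ) + M * Real.log k := by linarith
    _ = _ := by ring

end Entropy

/-! ### States given by density matrices -/

section TraceStates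

variable {n : Type*} [Fintype n] [DecidableEq n]

/-- The functional `a ↦ Tr(ρ a)`. -/
def traceMul (ρ : Matrix n n ℂ) : Matrix n n ℂ →ₗ[ℂ] ℂ :=
  Matrix.traceLinearMap n ℂ ℂ ∘ₗ LinearMap.mulLeft ℂ ρ

theorem traceMul_apply (ρ a : Matrix n n ℂ) : traceMul ρ a = (ρ * a).trace := rfl

theorem density_traceMul (ρ : Matrix n n ℂ) : density (traceMul ρ) = ρ := by
  ext x y
  simp [density, traceMul_apply, Matrix.trace_mul_single]

theorem isAlgState_traceMul {ρ : Matrix n n ℂ} (hρ : ρ.PosSemidef) (h1 : ρ.trace = 1) :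
    IsAlgState (traceMul ρ) := by
  refine ⟨fun a => ?_, by rw [traceMul_apply, mul_one, h1]⟩
  rw [traceMul_apply, ← mul_assoc, Matrix.trace_mul_comm, ← mul_assoc]
  exact (hρ.mul_mul_conjTranspose_same a).trace_nonneg

theorem posSemidef_exp {K : Matrix n n ℂ} (hK : K.IsHermitian) :
    (NormedSpace.exp K).PosSemidef := by
  open scoped MatrixOrder in
  rw [exp_eq_cfc hK, ← Matrix.nonneg_iff_posSemidef]
  exact cfc_nonneg fun x _ => (Real.exp_pos x).le

end TraceStates

/-! ### Local Gibbs states -/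

section Gibbs

variable {k N : ℕ} {β : ℝ} {K : LocalAlg k N}

/-- The Gibbs state as a linear functional. -/
def gibbsₗ (β : ℝ) (K : LocalAlg k N) : LocalAlg k N →ₗ[ℂ] ℂ :=
  traceMul ((NormedSpace.exp ((-β : ℂ) • K)).trace⁻¹ • NormedSpace.exp ((-β : ℂ) • K))

theorem gibbsₗ_apply (β : ℝ) (K a : LocalAlg k N) : gibbsₗ β K a = gibbs β K a := by
  rw [gibbsₗ, traceMul_apply, gibbs, smul_mul_assoc, Matrix.trace_smul, smul_eq_mul, div_eq_inv_mul]

theorem isHermitian_real_smul {r : ℝ} (hK : K.IsHermitian) : ((r : ℂ) • K).IsHermitian := by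
  rw [Matrix.IsHermitian, Matrix.conjTranspose_smul, hK.eq]
  simp

theorem isHermitian_neg_smul (hK : K.IsHermitian) : ((-β : ℂ) • K).IsHermitian := by
  rw [← Complex.ofReal_neg]
  exact isHermitian_real_smul hK

theorem isAlgState_gibbs [NeZero k] (hK : K.IsHermitian) : IsAlgState (gibbsₗ β K) := by
  have hK' := isHermitian_neg_smul (β := β) hK
  have hZ := trace_exp_re_pos hK'
  have hZ' : (NormedSpace.exp ((-β : ℂ) • K)).trace =
      (((NormedSpace.exp ((-β : ℂ) • K)).trace.re : ℝ) : ℂ) := by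
    rw [trace_exp hK', Complex.ofReal_re]
  refine isAlgState_traceMul ((posSemidef_exp hK').smul ?_) ?_
  · rw [hZ', ← Complex.ofReal_inv]
    exact_mod_cast (inv_pos.mpr hZ).le
  · rw [Matrix.trace_smul, smul_eq_mul, inv_mul_cancel₀]
    rw [hZ']
    exact_mod_cast hZ.ne'

/-- Permutations act by trace-preserving automorphisms which fix K, hence also e^{-βK}. -/
theorem isPermInv_gibbs (hK : symmetrize K = K) : IsPermInv (gibbsₗ β K) := fun σ a => by
  have h : permute σ (NormedSpace.exp ((-β : ℂ) • K)) = NormedSpace.exp ((-β : ℂ) • K) := by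
    rw [map_exp_localAlg (permute σ) (continuous_permute σ), map_smul,
      permute_eq_of_symmetrize_eq hK]
  rw [gibbsₗ_apply, gibbsₗ_apply, gibbs, gibbs]
  congr 1
  conv_lhs => rw [← h]
  rw [← map_mul, trace_permute]

theorem localEntropy_gibbs [NeZero k] (hK : K.IsHermitian) :
    localEntropy (gibbsₗ β K) + (gibbsₗ β K ((-β : ℂ) • K)).re =
      Real.log (NormedSpace.exp ((-β : ℂ) • K)).trace.re := by
  have := vnEntropy_gibbs (isHermitian_neg_smul (β := β) hK) rfl
  rw [← traceMul_apply] at this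
  rw [← this]
  congr 1
  exact congrArg vnEntropy (density_traceMul _)

end Gibbs

/-! ### Restrictions and mean entropy of quasi-local states -/

section QuasiLocal

variable {k : ℕ} (ω : QuasiLocalState k)

/-- The difference is norm-null. Hence the zero terms that pad local sequences at small N never
matter. -/
theorem QuasiLocalState.map_eq_of_eventuallyEq {A B : quasiLocal k}
    (h : ∀ᶠ N in atTop, (A : LocalSeq k) N = (B : LocalSeq k) N) :
    ω.toLinearMap A = ω.toLinearMap B := by
  rw [← sub_eq_zero, ← map_sub]
  refine ω.map_null _ (tendsto_const_nhds.congr' ?_)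
  filter_upwards [h] with N hN
  change 0 = ‖(A : LocalSeq k) N - (B : LocalSeq k) N‖
  rw [hN, sub_self, norm_zero]

theorem QuasiLocalState.restrict_embed {M N : ℕ} (h : M ≤ N) (a : LocalAlg k M) :
    ω.restrict N (embed h a) = ω.restrict M a := by
  refine ω.map_eq_of_eventuallyEq ?_
  filter_upwards [eventually_ge_atTop N] with L hL
  change localSeq N (embed h a) L = localSeq M a L
  rw [localSeq_of_le _ hL, localSeq_of_le _ (h.trans hL), embed_embed]

theorem QuasiLocalState.restr_restrict {M N : ℕ} (h : M ≤ N) :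
    restr h (ω.restrict N) = ω.restrict M :=
  LinearMap.ext fun a => ω.restrict_embed h a

theorem QuasiLocalState.isAlgState_restrict (N : ℕ) : IsAlgState (ω.restrict N) := by
  refine ⟨fun a => ?_, ?_⟩
  · have : ω.restrict N (star a * a) = ω.toLinearMap (star (localMap k N a) * localMap k N a) := by
      refine ω.map_eq_of_eventuallyEq ?_
      filter_upwards [eventually_ge_atTop N] with L hL
      change localSeq N (star a * a) L = star (localSeq N a L) * localSeq N a L
      rw [localSeq_of_le _ hL, localSeq_of_le _ hL, map_mul, map_star]
    rw [this]
    exact ω.isState.1 _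
  · rw [← ω.isState.2]
    refine ω.map_eq_of_eventuallyEq ?_
    filter_upwards [eventually_ge_atTop N] with L hL
    change localSeq N 1 L = 1
    rw [localSeq_of_le _ hL, map_one]

variable {ω}

theorem QuasiLocalState.IsPermInvariant.isPermInv (hω : ω.IsPermInvariant) (N : ℕ) :
    IsPermInv (ω.restrict N) :=
  isPermInv_of_map_symmetrize (hω N)

theorem QuasiLocalState.IsPermInvariant.subadditive [NeZero k] (hω : ω.IsPermInvariant) :
    Subadditive fun N => localEntropy (ω.restrict N) := fun m n => by
  have := localEntropy_add_blocks_le (ω.isAlgState_restrict (m + n)) (hω.isPermInv (m + n))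
  rwa [ω.restr_restrict, ω.restr_restrict] at this

/-- Fekete's lemma for the subadditive, nonnegative local entropies. -/
theorem QuasiLocalState.IsPermInvariant.tendsto_entropy [NeZero k] (hω : ω.IsPermInvariant) :
    Tendsto (fun N : ℕ => localEntropy (ω.restrict N) / N) atTop (𝓝 (meanEntropy ω)) := by
  have h : Tendsto (fun N : ℕ => localEntropy (ω.restrict N) / N) atTop
      (𝓝 hω.subadditive.lim) := by
    refine hω.subadditive.tendsto_lim ⟨0, ?_⟩
    rintro _ ⟨N, rfl⟩
    exact div_nonneg (localEntropy_nonneg (ω.isAlgState_restrict N)) (Nat.cast_nonneg N)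
  have e : entropyDensity ω = fun N : ℕ => localEntropy (ω.restrict N) / N := by
    ext N
    rw [entropyDensity, one_div, div_eq_inv_mul]
  have : meanEntropy ω = hω.subadditive.lim := by
    rw [meanEntropy, e]
    exact h.limUnder_eq
  rwa [this]

theorem QuasiLocalState.IsPermInvariant.tendsto_entropyDensity [NeZero k]
    (hω : ω.IsPermInvariant) : Tendsto (entropyDensity ω) atTop (𝓝 (meanEntropy ω)) := by
  refine hω.tendsto_entropy.congr fun N => ?_
  rw [entropyDensity, one_div, div_eq_inv_mul]

end QuasiLocal

/-! ### Quasi-symmetric sequences and mean energy -/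

section QuasiSymmetric

variable {k : ℕ} {G : LocalSeq k}

/-- The image filter is Cauchy: near the limit of one approximant, u stays in a ball of arbitrarily
small radius. Convergence of the approximants' limits need not be known beforehand. -/
theorem exists_tendsto_of_approx {l : Filter ℕ} [NeBot l] {u : ℕ → ℂ}
    (h : ∀ ε : ℝ, 0 < ε → ∃ (v : ℕ → ℂ) (x : ℂ), Tendsto v l (𝓝 x) ∧ ∀ᶠ N in l, ‖u N - v N‖ < ε) :
    ∃ x, Tendsto u l (𝓝 x) := by
  refine CompleteSpace.complete (Metric.cauchy_iff.mpr ⟨inferInstance, fun ε hε => ?_⟩)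
  obtain ⟨v, x, hv, hu⟩ := h (ε / 4) (by positivity)
  refine ⟨Metric.ball x (ε / 2), ?_, fun y hy z hz => ?_⟩
  · rw [Filter.mem_map]
    filter_upwards [hu, Metric.tendsto_nhds.mp hv (ε / 4) (by positivity)] with N h1 h2
    rw [Set.mem_preimage, Metric.mem_ball]
    rw [← dist_eq_norm] at h1
    linarith [dist_triangle (u N) (v N) x]
  · rw [Metric.mem_ball] at hy hz
    linarith [dist_triangle_right y z x]

theorem IsQuasiSymmetric.exists_approx (hG : IsQuasiSymmetric G) {ε : ℝ} (hε : 0 < ε) :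
    ∃ (M : ℕ) (a : LocalAlg k M), ∀ᶠ N in atTop, ∀ h : M ≤ N, ‖G N - symEmbed h a‖ < ε := by
  obtain ⟨A, ⟨M, a, ha⟩, M', h'⟩ := hG.2 ε hε
  refine ⟨M, a, ?_⟩
  filter_upwards [eventually_gt_atTop M'] with N hN h
  rw [← ha N h]
  exact h' N hN

/-- A permutation invariant state takes the same value on a⊗I and on its symmetrisation, and it is
contractive. This allows a quasi-symmetric sequence to be replaced by one local observable inside
expectations. -/
theorem norm_sub_embed_le {M N : ℕ} {φ : LocalAlg k N →ₗ[ℂ] ℂ} (hφ : IsAlgState φ)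
    (hp : IsPermInv φ) (b : LocalAlg k N) (h : M ≤ N) (a : LocalAlg k M) :
    ‖φ b - φ (embed h a)‖ ≤ ‖b - symEmbed h a‖ := by
  rw [← hp.map_symmetrize (embed h a), ← map_sub]
  exact hφ.norm_le _

theorem norm_symmetrize_le {N : ℕ} (a : LocalAlg k N) : ‖symmetrize a‖ ≤ ‖a‖ := by
  rw [symmetrize_eq, norm_smul, norm_inv, Complex.norm_natCast]
  have h (σ : Equiv.Perm (Fin N)) : ‖permute σ a‖ ≤ ‖a‖ :=
    NonUnitalStarAlgHom.norm_apply_le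
      ({ (permute σ).toAlgHom with map_star' := fun a => rfl } : LocalAlg k N →⋆ₐ[ℂ] LocalAlg k N) a
  have hN : (0 : ℝ) < N.factorial := by exact_mod_cast N.factorial_pos
  rw [inv_mul_le_iff₀ hN]
  refine (norm_sum_le _ _).trans ((Finset.sum_le_sum fun σ _ => h σ).trans ?_)
  rw [Finset.sum_const, Finset.card_univ, Fintype.card_perm, Fintype.card_fin, nsmul_eq_mul]

theorem IsQuasiSymmetric.exists_norm_le (hG : IsQuasiSymmetric G) :
    ∃ C : ℝ, ∀ᶠ N in atTop, ‖G N‖ ≤ C := by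
  obtain ⟨M, a, h⟩ := hG.exists_approx one_pos
  refine ⟨1 + ‖a‖, ?_⟩
  filter_upwards [h, eventually_ge_atTop M] with N h1 h2
  have h3 : ‖symEmbed h2 a‖ ≤ ‖a‖ := (norm_symmetrize_le _).trans (norm_embed_le _ _)
  linarith [norm_le_norm_add_norm_sub' (G N) (symEmbed h2 a), h1 h2]

theorem IsQuasiSymmetric.add {A : LocalSeq k} (hG : IsQuasiSymmetric G) (hA : IsQuasiSymmetric A) :
    IsQuasiSymmetric (G + A) := by
  refine ⟨fun N => ?_, fun ε hε => ?_⟩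
  · rw [Pi.add_apply, ← symmetrizeₗ_apply, map_add, symmetrizeₗ_apply, symmetrizeₗ_apply, hG.1,
      hA.1]
  · obtain ⟨G', ⟨M₁, a₁, h₁⟩, L₁, hL₁⟩ := hG.2 (ε / 2) (half_pos hε)
    obtain ⟨A', ⟨M₂, a₂, h₂⟩, L₂, hL₂⟩ := hA.2 (ε / 2) (half_pos hε)
    refine ⟨G' + A', ⟨max M₁ M₂, embed (le_max_left _ _) a₁ + embed (le_max_right _ _) a₂,
      fun N h => ?_⟩, max L₁ L₂, fun N hN => ?_⟩
    · rw [Pi.add_apply, h₁ N ((le_max_left _ _).trans h), h₂ N ((le_max_right _ _).trans h),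
        ← symEmbedₗ_apply h, map_add, symEmbedₗ_apply, symEmbedₗ_apply]
      simp only [symEmbed, embed_embed]
    · rw [Pi.add_apply, Pi.add_apply, add_sub_add_comm]
      refine (norm_add_le _ _).trans_lt ?_
      linarith [hL₁ N ((le_max_left _ _).trans_lt hN), hL₂ N ((le_max_right _ _).trans_lt hN)]

theorem IsQuasiSymmetric.smul (hG : IsQuasiSymmetric G) (c : ℂ) : IsQuasiSymmetric (c • G) := by
  refine ⟨fun N => ?_, fun ε hε => ?_⟩
  · rw [Pi.smul_apply, ← symmetrizeₗ_apply, map_smul, symmetrizeₗ_apply, hG.1]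
  · obtain ⟨G', ⟨M, a, h⟩, L, hL⟩ := hG.2 (ε / (‖c‖ + 1)) (by positivity)
    refine ⟨c • G', ⟨M, c • a, fun N hN => ?_⟩, L, fun N hN => ?_⟩
    · rw [Pi.smul_apply, h N hN, ← symEmbedₗ_apply hN, ← symEmbedₗ_apply hN, map_smul]
    · rw [Pi.smul_apply, Pi.smul_apply, ← smul_sub, norm_smul]
      have := hL N hN
      rw [lt_div_iff₀ (by positivity)] at this
      nlinarith [norm_nonneg (G N - G' N)]

variable {ω : QuasiLocalState k}

/-- The approximating expectations ω(a⊗I) do not depend on N, by consistency of the restrictions. -/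
theorem QuasiLocalState.IsPermInvariant.exists_tendsto (hω : ω.IsPermInvariant)
    (hG : IsQuasiSymmetric G) : ∃ x, Tendsto (fun N => ω.restrict N (G N)) atTop (𝓝 x) := by
  refine exists_tendsto_of_approx fun ε hε => ?_
  obtain ⟨M, a, h⟩ := hG.exists_approx hε
  refine ⟨fun _ => ω.restrict M a, _, tendsto_const_nhds, ?_⟩
  filter_upwards [h, eventually_ge_atTop M] with N h1 h2
  rw [← ω.restrict_embed h2]
  exact (norm_sub_embed_le (ω.isAlgState_restrict N) (hω.isPermInv N) _ h2 a).trans_lt (h1 h2)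

theorem energyDensity_scaled {N : ℕ} (hN : N ≠ 0) :
    energyDensity (scaled G) ω N = (ω.restrict N (G N)).re := by
  have : (N : ℝ) ≠ 0 := by exact_mod_cast hN
  rw [energyDensity, scaled, map_smul, smul_eq_mul, ← Complex.ofReal_natCast, Complex.re_ofReal_mul]
  field_simp

theorem QuasiLocalState.IsPermInvariant.tendsto_energyDensity (hω : ω.IsPermInvariant)
    (hG : IsQuasiSymmetric G) : Tendsto (energyDensity (scaled G) ω) atTop
      (𝓝 (internalEnergy (scaled G) ω)) := by
  obtain ⟨x, hx⟩ := hω.exists_tendsto hG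
  refine tendsto_nhds_limUnder ⟨x.re, ?_⟩
  refine ((Complex.continuous_re.tendsto x).comp hx).congr' ?_
  filter_upwards [eventually_ne_atTop 0] with N hN
  rw [energyDensity_scaled hN, Function.comp_apply]

theorem QuasiLocalState.IsPermInvariant.tendsto_energy (hω : ω.IsPermInvariant)
    (hG : IsQuasiSymmetric G) : Tendsto (fun N => (ω.restrict N (G N)).re) atTop
      (𝓝 (internalEnergy (scaled G) ω)) := by
  refine (hω.tendsto_energyDensity hG).congr' ?_
  filter_upwards [eventually_ne_atTop 0] with N hN
  rw [energyDensity_scaled hN]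

end QuasiSymmetric

/-! ### Limits of local states along ultrafilters -/

section UltrafilterLimit

variable {k : ℕ} {U : Ultrafilter ℕ} {φ : ∀ N, LocalAlg k N →ₗ[ℂ] ℂ}

/-- Quasi-local sequences are eventually bounded, so the expectations eventually lie in a compact
disc, where every ultrafilter converges. -/
theorem exists_tendsto_ultrafilter (hU : ↑U ≤ (atTop : Filter ℕ)) (hφ : ∀ N, IsAlgState (φ N))
    (A : quasiLocal k) : ∃ x, Tendsto (fun N => φ N ((A : LocalSeq k) N)) U (𝓝 x) := by
  obtain ⟨M, a, h⟩ := A.2 1 one_pos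
  have hb : ∀ᶠ N in (U : Filter ℕ),
      φ N ((A : LocalSeq k) N) ∈ Metric.closedBall (0 : ℂ) (1 + ‖a‖) := by
    filter_upwards [hU h, hU (eventually_ge_atTop M)] with N h1 h2
    rw [mem_closedBall_zero_iff]
    refine ((hφ N).norm_le _).trans ?_
    rw [localSeq_of_le _ h2] at h1
    linarith [norm_le_norm_add_norm_sub' ((A : LocalSeq k) N) (embed h2 a), norm_embed_le h2 a]
  obtain ⟨x, -, hx⟩ := (isCompact_closedBall (0 : ℂ) (1 + ‖a‖)).ultrafilter_le_nhds
    (U.map fun N => φ N ((A : LocalSeq k) N)) (le_principal_iff.mpr hb)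
  exact ⟨x, hx⟩

/-- The limit along an ultrafilter of states of the local algebras, a state of the quasi-local
algebra. -/
def ultraLimit (hU : ↑U ≤ (atTop : Filter ℕ)) (hφ : ∀ N, IsAlgState (φ N)) :
    QuasiLocalState k where
  toLinearMap :=
    { toFun A := (exists_tendsto_ultrafilter hU hφ A).choose
      map_add' A B := by
        refine tendsto_nhds_unique (exists_tendsto_ultrafilter hU hφ (A + B)).choose_spec ?_
        refine ((exists_tendsto_ultrafilter hU hφ A).choose_spec.add
          (exists_tendsto_ultrafilter hU hφ B).choose_spec).congr fun N => ?_
        rw [← map_add]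
        rfl
      map_smul' c A := by
        refine tendsto_nhds_unique (exists_tendsto_ultrafilter hU hφ (c • A)).choose_spec ?_
        refine ((exists_tendsto_ultrafilter hU hφ A).choose_spec.const_smul c).congr fun N => ?_
        rw [← map_smul]
        rfl }
  isState := by
    refine ⟨fun A => ?_, ?_⟩
    · refine ge_of_tendsto (exists_tendsto_ultrafilter hU hφ (star A * A)).choose_spec ?_
      exact Eventually.of_forall fun N => (hφ N).1 ((A : LocalSeq k) N)
    · refine tendsto_nhds_unique (exists_tendsto_ultrafilter hU hφ 1).choose_spec ?_
      exact tendsto_const_nhds.congr fun N => ((hφ N).2).symm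
  map_null A hA := by
    refine tendsto_nhds_unique (exists_tendsto_ultrafilter hU hφ A).choose_spec ?_
    exact squeeze_zero_norm (fun N => (hφ N).norm_le _) (hA.mono_left hU)

theorem tendsto_ultraLimit (hU : ↑U ≤ (atTop : Filter ℕ)) (hφ : ∀ N, IsAlgState (φ N)) {M : ℕ}
    (a : LocalAlg k M) :
    Tendsto (fun N => φ N (localSeq M a N)) U (𝓝 ((ultraLimit hU hφ).restrict M a)) :=
  (exists_tendsto_ultrafilter hU hφ (localMap k M a)).choose_spec

theorem isPermInvariant_ultraLimit (hU : ↑U ≤ (atTop : Filter ℕ)) (hφ : ∀ N, IsAlgState (φ N))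
    (hp : ∀ N, IsPermInv (φ N)) : (ultraLimit hU hφ).IsPermInvariant := fun M a => by
  refine tendsto_nhds_unique (tendsto_ultraLimit hU hφ (symmetrize a)) ?_
  refine (tendsto_ultraLimit hU hφ a).congr' ?_
  filter_upwards [hU (eventually_ge_atTop M)] with N hN
  have hN' : M ≤ N := hN
  rw [localSeq_of_le _ hN', localSeq_of_le _ hN', ← (hp N).map_symmetrize,
    ← (hp N).map_symmetrize (embed hN' (symmetrize a))]
  exact congrArg _ (symEmbed_symmetrize hN' a).symm

/-- A single local observable approximates G simultaneously in all late states φ_N and in their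
limit, which justifies exchanging the two limits. -/
theorem tendsto_energy_ultraLimit {G : LocalSeq k} (hG : IsQuasiSymmetric G)
    (hU : ↑U ≤ (atTop : Filter ℕ)) (hφ : ∀ N, IsAlgState (φ N)) (hp : ∀ N, IsPermInv (φ N)) :
    Tendsto (fun N => (φ N (G N)).re) U
      (𝓝 (internalEnergy (scaled G) (ultraLimit hU hφ))) := by
  have hω := isPermInvariant_ultraLimit hU hφ hp
  rw [Metric.tendsto_nhds]
  intro ε hε
  obtain ⟨M, a, h⟩ := hG.exists_approx (show 0 < ε / 4 by positivity)
  have h0 : dist ((ultraLimit hU hφ).restrict M a).re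
      (internalEnergy (scaled G) (ultraLimit hU hφ)) ≤ ε / 4 := by
    rw [dist_comm]
    refine le_of_tendsto ((hω.tendsto_energy hG).dist tendsto_const_nhds) ?_
    filter_upwards [h, eventually_ge_atTop M] with N h1 h2
    rw [Real.dist_eq, ← Complex.sub_re, ← (ultraLimit hU hφ).restrict_embed h2]
    exact (Complex.abs_re_le_norm _).trans ((norm_sub_embed_le
      ((ultraLimit hU hφ).isAlgState_restrict N) (hω.isPermInv N) _ h2 a).trans (h1 h2).le)
  filter_upwards [hU h, hU (eventually_ge_atTop M),
    Metric.tendsto_nhds.mp (tendsto_ultraLimit hU hφ a) (ε / 4) (by positivity)] with N h1 h2 h3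
  have h2' : M ≤ N := h2
  rw [localSeq_of_le _ h2'] at h3
  have h4 := (Complex.abs_re_le_norm _).trans ((norm_sub_embed_le (hφ N) (hp N) _ h2' a).trans
    (h1 h2').le)
  rw [Complex.sub_re, ← Real.dist_eq] at h4
  have h5 := Complex.abs_re_le_norm (φ N (embed h2' a) - (ultraLimit hU hφ).restrict M a)
  rw [Complex.sub_re, ← Real.dist_eq, ← dist_eq_norm] at h5
  linarith [dist_triangle4 (φ N (G N)).re (φ N (embed h2' a)).re
    ((ultraLimit hU hφ).restrict M a).re (internalEnergy (scaled G) (ultraLimit hU hφ))]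

/-- The mean entropy is upper semicontinuous along ultrafilter limits. -/
theorem eventually_entropy_le_ultraLimit [NeZero k] (hU : ↑U ≤ (atTop : Filter ℕ))
    (hφ : ∀ N, IsAlgState (φ N)) (hp : ∀ N, IsPermInv (φ N)) {δ : ℝ} (hδ : 0 < δ) :
    ∀ᶠ N in (U : Filter ℕ),
      localEntropy (φ N) / N ≤ meanEntropy (ultraLimit hU hφ) + δ := by
  set ω := ultraLimit hU hφ
  have hω : ω.IsPermInvariant := isPermInvariant_ultraLimit hU hφ hp
  -- A block size at which the entropy density of the limit state is already almost its mean
  -- entropy.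
  obtain ⟨M, hM, hM0⟩ := ((hω.tendsto_entropy.eventually_lt_const
    (show meanEntropy ω < meanEntropy ω + δ / 4 by linarith)).and (eventually_gt_atTop 0)).exists
  have hM' : (1 : ℝ) ≤ M := by exact_mod_cast hM0
  -- Semicontinuity comes from fixing a K nearly optimal for the limit: log Tr e^K - φ_N(K) bounds
  -- the M-site entropy of every φ_N and depends on φ_N only through one local expectation.
  obtain ⟨K, hK, hKle⟩ := exists_log_trace_exp_sub_le_localEntropy (ω.isAlgState_restrict M)
    (show 0 < δ / 4 by positivity)
  have hlim : Tendsto (fun N : ℕ => M * Real.log k / (N : ℝ)) atTop (𝓝 0) :=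
    tendsto_const_div_atTop_nhds_zero_nat _
  filter_upwards [hU (hlim.eventually_lt_const (show 0 < δ / 4 by positivity)),
    hU (eventually_ge_atTop M),
    Metric.tendsto_nhds.mp (tendsto_ultraLimit hU hφ K) (δ / 4) (by positivity)] with N h1 h2 h3
  have h2' : M ≤ N := h2
  have h1' : M * Real.log k / (N : ℝ) < δ / 4 := h1
  rw [localSeq_of_le _ h2'] at h3
  have h4 := localEntropy_div_le (hφ N) (hp N) hM0 h2'
  have h5 := localEntropy_add_le ((hφ N).restr h2') hK
  have h6 := (Complex.abs_re_le_norm (φ N (embed h2' K) - ω.restrict M K))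
  rw [← dist_eq_norm, Complex.sub_re] at h6
  have h7 := (abs_le.mp (h6.trans h3.le)).1
  rw [restr_apply] at h5
  have h8 : localEntropy (restr h2' (φ N)) ≤ localEntropy (ω.restrict M) + (δ / 4 + δ / 4) := by
    linarith
  have h9 : localEntropy (restr h2' (φ N)) / M ≤
      localEntropy (ω.restrict M) / M + (δ / 4 + δ / 4) := by
    calc _ ≤ (localEntropy (ω.restrict M) + (δ / 4 + δ / 4)) / M := by gcongr
      _ = localEntropy (ω.restrict M) / M + (δ / 4 + δ / 4) / M := add_div _ _ _
      _ ≤ _ := by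
        gcongr
        exact div_le_self (by positivity) hM'
  linarith

end UltrafilterLimit

/-! ### The variational principle in the thermodynamic limit -/

section FreeEnergy

variable {k : ℕ} {β : ℝ} {G : LocalSeq k}

/-- The free energy density of the Gibbs state on `N` sites. -/
def gibbsFreeEnergy {k : ℕ} (β : ℝ) (G : LocalSeq k) (N : ℕ) : ℝ :=
  -(Real.log (NormedSpace.exp ((-β : ℂ) • scaled G N)).trace.re / (β * N))

theorem isHermitian_scaled (hGsa : ∀ N, IsSelfAdjoint (G N)) (N : ℕ) :
    (scaled G N).IsHermitian := by
  rw [scaled, ← Complex.ofReal_natCast]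
  exact isHermitian_real_smul (hGsa N)

theorem symmetrize_scaled (hG : IsQuasiSymmetric G) (N : ℕ) :
    symmetrize (scaled G N) = scaled G N := by
  rw [scaled, ← symmetrizeₗ_apply, map_smul, symmetrizeₗ_apply, hG.1]

theorem re_map_neg_smul_scaled {N : ℕ} (φ : LocalAlg k N →ₗ[ℂ] ℂ) :
    (φ ((-β : ℂ) • scaled G N)).re = -(β * N * (φ (G N)).re) := by
  rw [scaled, map_smul, map_smul, smul_eq_mul, smul_eq_mul, ← Complex.ofReal_neg,
    Complex.re_ofReal_mul, ← Complex.ofReal_natCast, Complex.re_ofReal_mul]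
  ring

theorem gibbsFreeEnergy_le (hβ : 0 < β) (hGsa : ∀ N, IsSelfAdjoint (G N)) {N : ℕ} (hN : 0 < N)
    {φ : LocalAlg k N →ₗ[ℂ] ℂ} (hφ : IsAlgState φ) :
    gibbsFreeEnergy β G N ≤ (φ (G N)).re - 1 / β * (localEntropy φ / N) := by
  have h := localEntropy_add_le hφ (isHermitian_neg_smul (β := β) (isHermitian_scaled hGsa N))
  rw [re_map_neg_smul_scaled] at h
  have hN' : (0 : ℝ) < N := by exact_mod_cast hN
  have e : (φ (G N)).re - 1 / β * (localEntropy φ / N) =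
      -((localEntropy φ + -(β * N * (φ (G N)).re)) / (β * N)) := by
    field_simp
    ring
  rw [e, gibbsFreeEnergy]
  gcongr

theorem gibbsFreeEnergy_eq [NeZero k] (hβ : 0 < β) (hGsa : ∀ N, IsSelfAdjoint (G N)) {N : ℕ}
    (hN : 0 < N) : gibbsFreeEnergy β G N = (gibbsₗ β (scaled G N) (G N)).re -
      1 / β * (localEntropy (gibbsₗ β (scaled G N)) / N) := by
  have h := localEntropy_gibbs (β := β) (isHermitian_scaled hGsa N)
  rw [re_map_neg_smul_scaled] at h
  have hN' : (0 : ℝ) < N := by exact_mod_cast hN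
  rw [gibbsFreeEnergy, ← h]
  field_simp
  ring

/-- The mean-field free energy of a state, for the sequence `N G_N`. -/
def meanFreeEnergy {k : ℕ} (β : ℝ) (G : LocalSeq k) (ω : PermInvState k) : ℝ :=
  internalEnergy (scaled G) ω.1 - 1 / β * meanEntropy ω.1

theorem tendsto_meanFreeEnergy [NeZero k] (hG : IsQuasiSymmetric G) (ω : PermInvState k) :
    Tendsto (fun N : ℕ => (ω.1.restrict N (G N)).re - 1 / β * (localEntropy (ω.1.restrict N) / N))
      atTop (𝓝 (meanFreeEnergy β G ω)) :=
  (ω.2.tendsto_energy hG).sub (ω.2.tendsto_entropy.const_mul _)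

theorem bddBelow_meanFreeEnergy [NeZero k] (hβ : 0 < β) (hG : IsQuasiSymmetric G) :
    BddBelow (Set.range (meanFreeEnergy β G)) := by
  obtain ⟨C, hC⟩ := hG.exists_norm_le
  refine ⟨-C - 1 / β * Real.log k, ?_⟩
  rintro _ ⟨ω, rfl⟩
  refine ge_of_tendsto (tendsto_meanFreeEnergy hG ω) ?_
  filter_upwards [hC, eventually_gt_atTop 0] with N h1 h2
  have hN' : (0 : ℝ) < N := by exact_mod_cast h2
  have h3 := (abs_le.mp ((Complex.abs_re_le_norm _).trans
    ((ω.1.isAlgState_restrict N).norm_le (G N)))).1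
  have h4 : localEntropy (ω.1.restrict N) / N ≤ Real.log k := by
    rw [div_le_iff₀ hN', mul_comm]
    exact localEntropy_le (ω.1.isAlgState_restrict N)
  have h5 : 1 / β * (localEntropy (ω.1.restrict N) / N) ≤ 1 / β * Real.log k := by gcongr
  linarith

/-- An ultrafilter limit of the normalised traces, i.e. of Gibbs states at β = 0. -/
instance [NeZero k] : Nonempty (PermInvState k) := by
  have h0 (N : ℕ) : symmetrize (0 : LocalAlg k N) = 0 := by
    rw [← symmetrizeₗ_apply, map_zero]
  have hφ (N : ℕ) : IsAlgState (gibbsₗ 0 (0 : LocalAlg k N)) :=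
    isAlgState_gibbs Matrix.isHermitian_zero
  obtain ⟨U, hU⟩ := Ultrafilter.exists_le (atTop : Filter ℕ)
  exact ⟨⟨ultraLimit hU hφ, isPermInvariant_ultraLimit hU hφ fun N => isPermInv_gibbs (h0 N)⟩⟩

/-- The Gibbs variational principle: the free energy density of the Gibbs states converges to the
infimum of the mean-field free energies of permutation invariant states. -/
theorem tendsto_gibbsFreeEnergy [NeZero k] (hβ : 0 < β) (hG : IsQuasiSymmetric G)
    (hGsa : ∀ N, IsSelfAdjoint (G N)) :
    Tendsto (gibbsFreeEnergy β G) atTop (𝓝 (⨅ ω, meanFreeEnergy β G ω)) := by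
  have hbdd := bddBelow_meanFreeEnergy hβ hG
  refine tendsto_order.mpr ⟨fun c hc => ?_, fun c hc => ?_⟩
  -- It suffices to prove the lower bound along each ultrafilter finer than `atTop`, where the Gibbs
  -- states have a limit competing in the infimum.
  · refine mem_iff_ultrafilter.mpr fun U hU => ?_
    have hφ (N : ℕ) : IsAlgState (gibbsₗ β (scaled G N)) :=
      isAlgState_gibbs (isHermitian_scaled hGsa N)
    have hp (N : ℕ) : IsPermInv (gibbsₗ β (scaled G N)) := isPermInv_gibbs (symmetrize_scaled hG N)
    have hω := isPermInvariant_ultraLimit hU hφ hp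
    set δ := (⨅ ω, meanFreeEnergy β G ω) - c
    have hδ : 0 < δ := sub_pos.mpr hc
    have h0 : (⨅ ω, meanFreeEnergy β G ω) ≤ meanFreeEnergy β G ⟨ultraLimit hU hφ, hω⟩ :=
      ciInf_le hbdd _
    rw [meanFreeEnergy] at h0
    have h1 := Metric.tendsto_nhds.mp (tendsto_energy_ultraLimit hG hU hφ hp) (δ / 2) (half_pos hδ)
    -- The factor β is cancelled by the 1/β in front of the entropy, leaving an error δ/2.
    have h2 := eventually_entropy_le_ultraLimit hU hφ hp (δ := β * (δ / 2)) (by positivity)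
    filter_upwards [h1, h2, hU (eventually_gt_atTop 0)] with N h1 h2 h3
    rw [gibbsFreeEnergy_eq hβ hGsa h3]
    rw [Real.dist_eq] at h1
    have h4 := (abs_lt.mp h1).1
    have h5 : 1 / β * (localEntropy (gibbsₗ β (scaled G N)) / N) ≤
        1 / β * (meanEntropy (ultraLimit hU hφ) + β * (δ / 2)) := by gcongr
    have h6 : 1 / β * (meanEntropy (ultraLimit hU hφ) + β * (δ / 2)) =
        1 / β * meanEntropy (ultraLimit hU hφ) + δ / 2 := by field_simp
    have h7 : c = (⨅ ω, meanFreeEnergy β G ω) - δ := by simp [δ]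
    linarith
  -- Upper bound: an almost minimising ω, restricted to N sites, is a trial state.
  · obtain ⟨ω, hω⟩ := exists_lt_of_ciInf_lt hc
    filter_upwards [(tendsto_meanFreeEnergy hG ω).eventually_lt_const hω,
      eventually_gt_atTop 0] with N h1 h2
    exact (gibbsFreeEnergy_le hβ hGsa h2 (ω.1.isAlgState_restrict N)).trans_lt h1

end FreeEnergy

/-! ### Perturbed free energy, concavity and Griffiths' lemma -/

section Perturbation

variable {k : ℕ} {β : ℝ} {H A : LocalSeq k}

theorem scaled_add_smul (H A : LocalSeq k) (t : ℝ) :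
    scaled H + (t : ℂ) • scaled A = scaled (H + (t : ℂ) • A) := by
  funext N
  simp only [scaled, Pi.add_apply, Pi.smul_apply, smul_add]
  rw [smul_comm]

theorem isSelfAdjoint_add_smul (hHsa : ∀ N, IsSelfAdjoint (H N)) (hAsa : ∀ N, IsSelfAdjoint (A N))
    (t : ℝ) (N : ℕ) : IsSelfAdjoint ((H + (t : ℂ) • A) N) :=
  (hHsa N).add (isHermitian_real_smul (hAsa N))

theorem stateFreeEnergy_eq (t : ℝ) (ω : PermInvState k) :
    stateFreeEnergy β H A t ω.1 = meanFreeEnergy β (H + (t : ℂ) • A) ω := by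
  rw [stateFreeEnergy, scaled_add_smul, meanFreeEnergy]

theorem freeEnergy_eq (t : ℝ) :
    freeEnergy β H A t = ⨅ ω, meanFreeEnergy β (H + (t : ℂ) • A) ω := by
  simp_rw [freeEnergy, stateFreeEnergy_eq]

theorem internalEnergy_add_smul (hH : IsQuasiSymmetric H) (hA : IsQuasiSymmetric A) (t : ℝ)
    (ω : PermInvState k) : internalEnergy (scaled (H + (t : ℂ) • A)) ω.1 =
      internalEnergy (scaled H) ω.1 + t * internalEnergy (scaled A) ω.1 := by
  refine tendsto_nhds_unique (ω.2.tendsto_energy (hH.add (hA.smul t))) ?_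
  refine ((ω.2.tendsto_energy hH).add ((ω.2.tendsto_energy hA).const_mul t)).congr fun N => ?_
  rw [Pi.add_apply, Pi.smul_apply, map_add, map_smul, Complex.add_re, smul_eq_mul,
    Complex.re_ofReal_mul]

theorem isGLB_freeEnergy [NeZero k] (hβ : 0 < β) (hH : IsQuasiSymmetric H)
    (hA : IsQuasiSymmetric A) (t : ℝ) :
    IsGLB (Set.range fun ω : PermInvState k => stateFreeEnergy β H A t ω.1)
      (freeEnergy β H A t) := by
  simp_rw [stateFreeEnergy_eq, freeEnergy_eq]
  exact isGLB_ciInf (bddBelow_meanFreeEnergy hβ (hH.add (hA.smul t)))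

/-- For a fixed state the free energy is affine in t, and an infimum of affine functions is concave.
-/
theorem concaveOn_freeEnergy [NeZero k] (hβ : 0 < β) (hH : IsQuasiSymmetric H)
    (hA : IsQuasiSymmetric A) : ConcaveOn ℝ Set.univ (freeEnergy β H A) := by
  refine ⟨convex_univ, fun s _ t _ a b ha hb hab => ?_⟩
  rw [freeEnergy_eq (a • s + b • t)]
  refine le_ciInf fun ω => ?_
  have h1 := (isGLB_freeEnergy hβ hH hA s).1 ⟨ω, rfl⟩
  have h2 := (isGLB_freeEnergy hβ hH hA t).1 ⟨ω, rfl⟩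
  simp only [stateFreeEnergy_eq, meanFreeEnergy] at h1 h2
  rw [meanFreeEnergy, internalEnergy_add_smul hH hA]
  rw [internalEnergy_add_smul hH hA] at h1 h2
  simp only [smul_eq_mul]
  calc a * freeEnergy β H A s + b * freeEnergy β H A t
      ≤ a * (internalEnergy (scaled H) ω.1 + s * internalEnergy (scaled A) ω.1
          - 1 / β * meanEntropy ω.1) + b * (internalEnergy (scaled H) ω.1
          + t * internalEnergy (scaled A) ω.1 - 1 / β * meanEntropy ω.1) := by gcongr
    _ = (a + b) * internalEnergy (scaled H) ω.1 + (a * s + b * t) * internalEnergy (scaled A) ω.1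
          - (a + b) * (1 / β * meanEntropy ω.1) := by ring
    _ = _ := by rw [hab]; ring

theorem tendsto_gibbsFreeEnergy_perturbed [NeZero k] (hβ : 0 < β) (hH : IsQuasiSymmetric H)
    (hHsa : ∀ N, IsSelfAdjoint (H N)) (hA : IsQuasiSymmetric A) (hAsa : ∀ N, IsSelfAdjoint (A N))
    (t : ℝ) : Tendsto (gibbsFreeEnergy β (H + (t : ℂ) • A)) atTop (𝓝 (freeEnergy β H A t)) := by
  rw [freeEnergy_eq]
  exact tendsto_gibbsFreeEnergy hβ (hH.add (hA.smul t)) (isSelfAdjoint_add_smul hHsa hAsa t)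

/-- The unperturbed Gibbs state serves as a trial state for the perturbed problem. -/
theorem gibbsFreeEnergy_add_smul_le [NeZero k] (hβ : 0 < β) (hHsa : ∀ N, IsSelfAdjoint (H N))
    (hAsa : ∀ N, IsSelfAdjoint (A N)) (t : ℝ) {N : ℕ} (hN : 0 < N) :
    gibbsFreeEnergy β (H + (t : ℂ) • A) N ≤ gibbsFreeEnergy β (H + ((0 : ℝ) : ℂ) • A) N +
      t * (gibbs β (scaled H N) (A N)).re := by
  have h := gibbsFreeEnergy_le hβ (isSelfAdjoint_add_smul hHsa hAsa t) hN
    (isAlgState_gibbs (β := β) (isHermitian_scaled hHsa N))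
  rw [Complex.ofReal_zero, zero_smul, add_zero, gibbsFreeEnergy_eq hβ hHsa hN, ← gibbsₗ_apply]
  rw [Pi.add_apply, Pi.smul_apply, map_add, map_smul, Complex.add_re, smul_eq_mul,
    Complex.re_ofReal_mul] at h
  linarith

/-- **Griffiths' lemma**: supergradients at `0` of functions converging pointwise to a function
differentiable at `0` converge to the derivative of the limit. -/
theorem tendsto_supergradient {f : ℕ → ℝ → ℝ} {F : ℝ → ℝ} {g : ℕ → ℝ}
    (hf : ∀ t, Tendsto (fun N => f N t) atTop (𝓝 (F t)))
    (hg : ∀ t, ∀ᶠ N in atTop, f N t ≤ f N 0 + t * g N) (hF : DifferentiableAt ℝ F 0) :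
    Tendsto g atTop (𝓝 (deriv F 0)) := by
  have hs := hasDerivAt_iff_tendsto_slope.mp hF.hasDerivAt
  have hlim (t : ℝ) : Tendsto (fun N => (f N t - f N 0) / t) atTop (𝓝 (slope F 0 t)) := by
    rw [slope_def_field, sub_zero]
    exact ((hf t).sub (hf 0)).div_const t
  refine tendsto_order.mpr ⟨fun c hc => ?_, fun c hc => ?_⟩
  -- For t > 0 the supergradient dominates the difference quotient; for t < 0, used in the other
  -- bound, it is dominated by it. One fixed t of each sign suffices.
  · have h1 := (hs.mono_left (nhdsGT_le_nhdsNE 0)).eventually_const_lt hc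
    obtain ⟨t, h1, ht⟩ := (h1.and self_mem_nhdsWithin).exists
    have ht' : 0 < t := ht
    filter_upwards [(hlim t).eventually_const_lt h1, hg t] with N h2 h3
    refine h2.trans_le ?_
    rw [div_le_iff₀ ht']
    linarith
  · have h1 := (hs.mono_left (nhdsLT_le_nhdsNE 0)).eventually_lt_const hc
    obtain ⟨t, h1, ht⟩ := (h1.and self_mem_nhdsWithin).exists
    have ht' : t < 0 := ht
    filter_upwards [(hlim t).eventually_lt_const h1, hg t] with N h2 h3
    refine lt_of_le_of_lt ?_ h2
    rw [le_div_iff_of_neg ht']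
    linarith

theorem tendsto_gibbs [NeZero k] (hβ : 0 < β) (hH : IsQuasiSymmetric H)
    (hHsa : ∀ N, IsSelfAdjoint (H N)) (hA : IsQuasiSymmetric A) (hAsa : ∀ N, IsSelfAdjoint (A N))
    (hF : DifferentiableAt ℝ (freeEnergy β H A) 0) :
    Tendsto (fun N => gibbs β (scaled H N) (A N)) atTop
      (𝓝 ((deriv (freeEnergy β H A) 0 : ℝ) : ℂ)) := by
  have h := tendsto_supergradient (g := fun N => (gibbs β (scaled H N) (A N)).re)
    (tendsto_gibbsFreeEnergy_perturbed hβ hH hHsa hA hAsa)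
    (fun t => (eventually_gt_atTop 0).mono fun N hN =>
      gibbsFreeEnergy_add_smul_le hβ hHsa hAsa t hN) hF
  refine ((Complex.continuous_ofReal.tendsto _).comp h).congr fun N => ?_
  rw [Function.comp_apply, ← gibbsₗ_apply]
  exact (isAlgState_gibbs (isHermitian_scaled hHsa N)).ofReal_re (hAsa N)

end Perturbation

/-! ### Positivity over Archimedean semirings -/

section Characters

variable {R : Type*} [CommRing R] [Algebra ℝ R]

/-- The normalised linear functionals which are nonnegative on a subsemiring. -/
def normalizedFunctionals (T : Subsemiring R) : Set (R → ℝ) :=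
  {f | (∀ x y, f (x + y) = f x + f y) ∧ (∀ (c : ℝ) x, f (c • x) = c * f x) ∧ f 1 = 1 ∧
    ∀ t ∈ T, 0 ≤ f t}

theorem isClosed_normalizedFunctionals (T : Subsemiring R) :
    IsClosed (normalizedFunctionals T) := by
  have e : normalizedFunctionals T =
      (⋂ x, ⋂ y, {f : R → ℝ | f (x + y) = f x + f y}) ∩
      ((⋂ c : ℝ, ⋂ x, {f : R → ℝ | f (c • x) = c * f x}) ∩
      ({f : R → ℝ | f 1 = 1} ∩ ⋂ t ∈ T, {f : R → ℝ | 0 ≤ f t})) := by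
    ext f
    simp [normalizedFunctionals]
  rw [e]
  refine (isClosed_iInter fun x => isClosed_iInter fun y => isClosed_eq (by fun_prop)
    (by fun_prop)).inter ((isClosed_iInter fun c => isClosed_iInter fun x => isClosed_eq
    (by fun_prop) (by fun_prop)).inter ((isClosed_eq (by fun_prop) (by fun_prop)).inter
    (isClosed_biInter fun t _ => isClosed_le (by fun_prop) (by fun_prop))))

variable {T : Subsemiring R}

/-- For `b ∈ T` with `f(b) > 0`, the functional `x ↦ f(b x) / f(b)` is again normalised and
nonnegative on `T`. -/
theorem smul_mul_mem_normalizedFunctionals {f : R → ℝ} (hf : f ∈ normalizedFunctionals T) {b : R}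
    (hb : b ∈ T) (hb0 : 0 < f b) : (fun x => (f b)⁻¹ * f (b * x)) ∈ normalizedFunctionals T := by
  obtain ⟨h1, h2, h3, h4⟩ := hf
  refine ⟨fun x y => ?_, fun c x => ?_, ?_, fun t ht => ?_⟩
  · simp only [mul_add, h1]
  · simp only [mul_smul_comm, h2]
    ring
  · simp only [mul_one]
    exact inv_mul_cancel₀ hb0.ne'
  · exact mul_nonneg (inv_nonneg.mpr hb0.le) (h4 _ (T.mul_mem hb ht))

/-- If C + r ∈ T then 0 ≤ f(b(C + r)) = f(br), since f(b) = 0; the same holds for -r. -/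
theorem map_mul_eq_zero_of_map_eq_zero (harch : ∀ r : R, ∃ C : ℝ, algebraMap ℝ R C + r ∈ T)
    {f : R → ℝ} (hf : f ∈ normalizedFunctionals T) {b : R} (hb : b ∈ T) (hb0 : f b = 0) (r : R) :
    f (b * r) = 0 := by
  obtain ⟨h1, h2, -, h4⟩ := hf
  have key (r : R) : 0 ≤ f (b * r) := by
    obtain ⟨C, hC⟩ := harch r
    have h := h4 _ (T.mul_mem hb hC)
    rwa [mul_add, h1, mul_comm b, ← Algebra.smul_def, h2, hb0, mul_zero, zero_add] at h
  have h5 := key (-r)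
  have h6 : b * -r = (-1 : ℝ) • (b * r) := by simp
  rw [h6, h2] at h5
  linarith [key r]

/-- **Representation theorem of Krivine and Kadison–Dubois**: over an Archimedean subsemiring,
positivity is detected by the characters. -/
theorem map_nonneg_of_forall_character (hc : ∀ c : ℝ, 0 ≤ c → algebraMap ℝ R c ∈ T)
    (harch : ∀ r : R, ∃ C : ℝ, algebraMap ℝ R C + r ∈ T) (L : R →ₗ[ℝ] ℝ)
    (hL : ∀ t ∈ T, 0 ≤ L t) (hL1 : L 1 = 1) (p : R)
    (hp : ∀ χ : R →ₐ[ℝ] ℝ, (∀ t ∈ T, 0 ≤ χ t) → 0 ≤ χ p) : 0 ≤ L p := by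
  set K := normalizedFunctionals T
  -- The Archimedean bounds confine each value f(r) to a fixed interval, so Tychonoff's theorem
  -- applies to functionals regarded as plain functions.
  have hKc : IsCompact K := by
    choose C hC using harch
    refine (isCompact_univ_pi fun r : R =>
      isCompact_Icc (a := -C r) (b := C (-r))).of_isClosed_subset
      (isClosed_normalizedFunctionals T) ?_
    rintro f ⟨h1, h2, h3, h4⟩ r -
    have e (c : ℝ) : f (algebraMap ℝ R c) = c := by
      rw [Algebra.algebraMap_eq_smul_one, h2, h3, mul_one]
    have a1 := h4 _ (hC r)
    have a2 := h4 _ (hC (-r))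
    have a3 : f (-r) = -f r := by
      rw [← neg_one_smul ℝ r, h2]
      ring
    rw [h1, e] at a1 a2
    constructor <;> linarith
  have hLK : (L : R → ℝ) ∈ K := ⟨map_add L, fun c x => by simp, hL1, hL⟩
  obtain ⟨f₀, hf₀, hmin⟩ := hKc.exists_isMinOn ⟨_, hLK⟩ (continuous_apply p).continuousOn
  set F := K ∩ {f | f p = f₀ p}
  have hFc : IsCompact F := hKc.inter_right (isClosed_eq (by fun_prop) (by fun_prop))
  -- An extreme point among the minimisers of evaluation at p. Once shown to be multiplicative it is
  -- a character, so the minimum is nonnegative.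
  obtain ⟨g, hg⟩ := hFc.extremePoints_nonempty ⟨f₀, hf₀, rfl⟩
  rw [mem_extremePoints_iff_left] at hg
  obtain ⟨⟨hgK, hgp⟩, hext⟩ := hg
  obtain ⟨g1, g2, g3, g4⟩ := id hgK
  have hgp' : g p = f₀ p := hgp
  have hneg (x : R) : g (-x) = -g x := by
    rw [← neg_one_smul ℝ x, g2]
    ring
  -- Here g is the convex combination, with weights g(b) and g(1-b), of x ↦ g(bx)/g(b) and x ↦
  -- g((1-b)x)/g(1-b). Extremality makes these equal g; a zero weight is handled separately.
  have mul_unit (b : R) (hb : b ∈ T) (hb' : 1 - b ∈ T) (x : R) : g (b * x) = g b * g x := by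
    have e1 : g (1 - b) = 1 - g b := by rw [sub_eq_add_neg, g1, hneg, g3]; ring
    have e2 (x : R) : g ((1 - b) * x) = g x - g (b * x) := by
      rw [sub_mul, one_mul, sub_eq_add_neg, g1, hneg]; ring
    rcases (g4 b hb).eq_or_lt with h0 | h0
    · rw [map_mul_eq_zero_of_map_eq_zero harch hgK hb h0.symm, ← h0, zero_mul]
    have h1 := g4 _ hb'
    rcases h1.eq_or_lt with h1 | h1
    · have := map_mul_eq_zero_of_map_eq_zero harch hgK hb' h1.symm x
      rw [e2] at this
      rw [e1] at h1
      rw [← sub_eq_zero.mp this, ← sub_eq_zero.mp h1.symm, one_mul]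
    have m1 := smul_mul_mem_normalizedFunctionals hgK hb h0
    have m2 := smul_mul_mem_normalizedFunctionals hgK hb' h1
    have l1 : f₀ p ≤ (g b)⁻¹ * g (b * p) := hmin m1
    have l2 : f₀ p ≤ (g (1 - b))⁻¹ * g ((1 - b) * p) := hmin m2
    have k1 : g b * f₀ p ≤ g (b * p) := by rwa [le_inv_mul_iff₀ h0] at l1
    have k2 : g (1 - b) * f₀ p ≤ g ((1 - b) * p) := by rwa [le_inv_mul_iff₀ h1] at l2
    rw [e2, e1, hgp'] at k2
    -- Both rescaled functionals take values at least f₀(p) at p while their average equals it, so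
    -- both are minimisers.
    have k3 : g (b * p) = g b * f₀ p := by nlinarith
    have f1 : (g b)⁻¹ * g (b * p) = f₀ p := by rw [k3]; field_simp
    have f2 : (g (1 - b))⁻¹ * g ((1 - b) * p) = f₀ p := by
      rw [inv_mul_eq_iff_eq_mul₀ h1.ne', e2, k3, hgp', e1]
      ring
    have := hext _ ⟨m1, f1⟩ _ ⟨m2, f2⟩ ⟨g b, g (1 - b), h0, h1, by rw [e1]; ring, by
      funext x
      simp only [Pi.add_apply, Pi.smul_apply, smul_eq_mul]
      rw [mul_inv_cancel_left₀ h0.ne', mul_inv_cancel_left₀ h1.ne', e2]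
      ring⟩
    rw [← congrFun this x, mul_inv_cancel_left₀ h0.ne']
  have hmul (a x : R) : g (a * x) = g a * g x := by
    obtain ⟨C₁, h₁⟩ := harch a
    obtain ⟨C₂, h₂⟩ := harch (-a)
    -- With D = |C₁| + |C₂| + 1, the element b = (|C₁| + 1 + a)/D satisfies b ∈ T and 1 - b = (|C₂|
    -- - a)/D ∈ T, so the case of a reduces to that of b. The summand 1 ensures D > 0.
    have hpos : 0 < |C₁| + |C₂| + 1 := by positivity
    set D := |C₁| + |C₂| + 1
    have b1 : D⁻¹ • (algebraMap ℝ R (|C₁| + 1) + a) ∈ T := by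
      rw [Algebra.smul_def]
      refine T.mul_mem (hc _ (inv_nonneg.mpr hpos.le)) ?_
      have e : algebraMap ℝ R (|C₁| + 1) + a =
          algebraMap ℝ R (|C₁| - C₁ + 1) + (algebraMap ℝ R C₁ + a) := by
        simp only [map_add, map_sub]; ring
      rw [e]
      exact T.add_mem (hc _ (by linarith [le_abs_self C₁])) h₁
    have b2 : 1 - D⁻¹ • (algebraMap ℝ R (|C₁| + 1) + a) ∈ T := by
      have e : 1 - D⁻¹ • (algebraMap ℝ R (|C₁| + 1) + a) =
          algebraMap ℝ R D⁻¹ * (algebraMap ℝ R (|C₂| - C₂) + (algebraMap ℝ R C₂ + -a)) := by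
        have : (1 : R) = algebraMap ℝ R D⁻¹ * algebraMap ℝ R D := by
          rw [← map_mul, inv_mul_cancel₀ hpos.ne', map_one]
        rw [Algebra.smul_def, this]
        simp only [D, map_add, map_sub]; ring
      rw [e]
      exact T.mul_mem (hc _ (inv_nonneg.mpr hpos.le))
        (T.add_mem (hc _ (by linarith [le_abs_self C₂])) h₂)
    have h := mul_unit _ b1 b2 x
    rw [smul_mul_assoc, g2, g2, add_mul, g1, g1, ← Algebra.smul_def, g2,
      Algebra.algebraMap_eq_smul_one, g2, g3] at h
    have := inv_ne_zero hpos.ne'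
    rw [mul_assoc] at h
    have := mul_left_cancel₀ this h
    linarith
  let χ : R →ₐ[ℝ] ℝ := AlgHom.ofLinearMap
    { toFun := g, map_add' := g1, map_smul' := g2 } g3 hmul
  have h1 : 0 ≤ g p := hp χ g4
  have h2 : f₀ p ≤ L p := hmin hLK
  linarith

end Characters

/-! ### Elementary and symmetrised tensors -/

section ElemTensor

variable {k L N : ℕ}

theorem elemTensor_apply (B : Fin L → Matrix (Fin k) (Fin k) ℂ) (x y : Fin L → Fin k) :
    elemTensor B x y = ∏ i, B i (x i) (y i) := rfl

theorem elemTensor_mul (A B : Fin L → Matrix (Fin k) (Fin k) ℂ) :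
    elemTensor A * elemTensor B = elemTensor fun i => A i * B i := by
  ext x y
  simp only [Matrix.mul_apply, elemTensor_apply, ← Finset.prod_mul_distrib]
  exact (Fintype.prod_sum fun i j => A i (x i) j * B i j (y i)).symm

theorem trace_elemTensor (B : Fin L → Matrix (Fin k) (Fin k) ℂ) :
    (elemTensor B).trace = ∏ i, (B i).trace := by
  simp only [Matrix.trace, Matrix.diag, elemTensor_apply]
  exact (Fintype.prod_sum fun i j => B i j j).symm

theorem star_elemTensor (B : Fin L → Matrix (Fin k) (Fin k) ℂ) :
    star (elemTensor B) = elemTensor fun i => star (B i) := by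
  ext x y
  simp [Matrix.star_apply, elemTensor_apply]

theorem permute_elemTensor (σ : Equiv.Perm (Fin N)) (B : Fin N → Matrix (Fin k) (Fin k) ℂ) :
    permute σ (elemTensor B) = elemTensor (B ∘ σ.symm) := by
  ext x y
  rw [permute_apply, elemTensor_apply, elemTensor_apply,
    ← Equiv.prod_comp σ fun i => (B ∘ σ.symm) i (x i) (y i)]
  simp

theorem posSemidef_elemTensor {B : Fin L → Matrix (Fin k) (Fin k) ℂ}
    (hB : ∀ i, (B i).PosSemidef) : (elemTensor B).PosSemidef := by
  have h (i) : ∃ C, B i = star C * C := by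
    open scoped MatrixOrder in
    exact CStarAlgebra.nonneg_iff_eq_star_mul_self.mp (Matrix.nonneg_iff_posSemidef.mpr (hB i))
  choose C hC using h
  have e : elemTensor B = star (elemTensor C) * elemTensor C := by
    rw [star_elemTensor, elemTensor_mul]
    congr
    funext i
    exact hC i
  rw [e]
  exact Matrix.posSemidef_conjTranspose_mul_self _

theorem embed_elemTensor (h : L ≤ N) (l : List (Matrix (Fin k) (Fin k) ℂ)) (hl : l.length ≤ L) :
    embed h (elemTensor fun i : Fin L => l.getD i 1) = elemTensor fun i : Fin N => l.getD i 1 := by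
  obtain ⟨r, rfl⟩ := Nat.exists_eq_add_of_le h
  ext x y
  rw [embed_apply, elemTensor_apply, elemTensor_apply, Fin.prod_univ_add]
  congr 1
  have e (i : Fin r) : l.getD (Fin.natAdd L i) 1 = 1 := by
    rw [Fin.val_natAdd]
    exact List.getD_eq_default _ _ (by omega)
  simp_rw [e, Matrix.one_apply, Finset.prod_ite_zero, Finset.prod_const_one, Finset.mem_univ,
    true_imp_iff]
  refine if_congr ⟨fun h i => h _ (by simp), fun h i hi => ?_⟩ rfl rfl
  have := h ⟨i.1 - L, by omega⟩
  convert this using 2 <;> (ext; simp; omega)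

/-- The symmetrised tensor product on `N` sites of a list of matrices, completed by identities. -/
def symTens (N : ℕ) (l : List (Matrix (Fin k) (Fin k) ℂ)) : LocalAlg k N :=
  symmetrize (elemTensor fun i : Fin N => l.getD i 1)

theorem symEmbed_elemTensor_get (l : List (Matrix (Fin k) (Fin k) ℂ)) (h : l.length ≤ N) :
    symEmbed h (elemTensor l.get) = symTens N l := by
  have e : elemTensor l.get = elemTensor fun i : Fin l.length => l.getD i 1 := by
    congr
    funext i
    simp
  rw [symEmbed, e, embed_elemTensor h l le_rfl, symTens]

theorem symEmbed_elemTensor (B : Fin L → Matrix (Fin k) (Fin k) ℂ) (h : L ≤ N) :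
    symEmbed h (elemTensor B) = symTens N (List.ofFn B) := by
  have e : elemTensor B = elemTensor fun i : Fin L => (List.ofFn B).getD i 1 := by
    congr
    funext i
    simp
  rw [symEmbed, e, embed_elemTensor h _ (by simp), symTens]

theorem symTens_append_one (l : List (Matrix (Fin k) (Fin k) ℂ)) :
    symTens N (l ++ [1]) = symTens N l := by
  rw [symTens, symTens]
  congr 2
  funext i
  rcases lt_trichotomy i.1 l.length with h | h | h
  · rw [List.getD_append _ _ _ _ h]
  · rw [List.getD_append_right _ _ _ _ h.ge, List.getD_eq_default l _ h.ge, h]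
    simp
  · rw [List.getD_eq_default _ _ (by simp; omega), List.getD_eq_default l _ h.le]

/-- Symmetrisation absorbs the transposition of the two sites. The length bound guarantees that both
sites exist, so that truncation at N sites drops neither factor. -/
theorem symTens_swap (l l' : List (Matrix (Fin k) (Fin k) ℂ)) (A B : Matrix (Fin k) (Fin k) ℂ)
    (h : l.length + 2 ≤ N) : symTens N (l ++ A :: B :: l') = symTens N (l ++ B :: A :: l') := by
  rw [symTens, symTens]
  set i₀ : Fin N := ⟨l.length, by omega⟩
  set i₁ : Fin N := ⟨l.length + 1, by omega⟩
  rw [← symmetrize_permute (Equiv.swap i₀ i₁), permute_elemTensor]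
  congr 2
  funext i
  simp only [Function.comp_apply, Equiv.symm_swap]
  by_cases h0 : i = i₀
  · subst h0
    rw [Equiv.swap_apply_left, List.getD_append_right _ _ _ _ (by simp [i₁]),
      List.getD_append_right _ _ _ _ (by simp [i₀])]
    simp [i₀, i₁]
  by_cases h1 : i = i₁
  · subst h1
    rw [Equiv.swap_apply_right, List.getD_append_right _ _ _ _ (by simp [i₀]),
      List.getD_append_right _ _ _ _ (by simp [i₁])]
    simp [i₀, i₁]
  rw [Equiv.swap_apply_of_ne_of_ne h0 h1]
  rcases lt_or_ge i.1 l.length with h | h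
  · rw [List.getD_append _ _ _ _ h, List.getD_append _ _ _ _ h]
  · rw [List.getD_append_right _ _ _ _ h, List.getD_append_right _ _ _ _ h]
    have h0' : i.1 ≠ l.length := fun e => h0 (Fin.ext e)
    have h1' : i.1 ≠ l.length + 1 := fun e => h1 (Fin.ext e)
    obtain ⟨j, hj⟩ : ∃ j, i.1 - l.length = j + 2 := ⟨i.1 - l.length - 2, by omega⟩
    rw [hj]
    simp

theorem symTens_perm {l l' : List (Matrix (Fin k) (Fin k) ℂ)} (h : l.Perm l')
    (hl : l.length ≤ N) : symTens N l = symTens N l' := by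
  -- An arbitrary prefix is carried along so that the induction can move past a common head.
  suffices ∀ pre : List (Matrix (Fin k) (Fin k) ℂ), pre.length + l.length ≤ N →
      symTens N (pre ++ l) = symTens N (pre ++ l') by
    simpa using this [] (by simpa using hl)
  clear hl
  induction h with
  | nil => intro _ _; rfl
  | cons x _ ih =>
    intro pre hpre
    simp only [List.length_cons] at hpre
    have := ih (pre ++ [x]) (by simp; omega)
    simpa using this
  | swap x y l =>
    intro pre hpre
    simp only [List.length_cons] at hpre
    exact symTens_swap _ _ _ _ (by omega)
  | trans h1 _ ih1 ih2 =>
    intro pre hpre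
    rw [ih1 pre hpre, ih2 pre (by rwa [← h1.length_eq])]

/-- Move the identity to the end of the list, where it merges with the padding. -/
theorem symTens_one_cons {l : List (Matrix (Fin k) (Fin k) ℂ)} (hl : l.length + 1 ≤ N) :
    symTens N (1 :: l) = symTens N l := by
  rw [← symTens_append_one l]
  exact symTens_perm
    (by simpa using (List.perm_append_singleton (1 : Matrix (Fin k) (Fin k) ℂ) l).symm)
    (by simpa using hl)

theorem exists_symTens_cons_linear (hN : 0 < N) (l : List (Matrix (Fin k) (Fin k) ℂ)) :
    ∃ Λ : Matrix (Fin k) (Fin k) ℂ →ₗ[ℂ] LocalAlg k N, ∀ B, Λ B = symTens N (B :: l) := by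
  obtain ⟨n, rfl⟩ := Nat.exists_eq_succ_of_ne_zero hN.ne'
  refine ⟨symmetrizeₗ ∘ₗ
    { toFun B := elemTensor fun i : Fin (n + 1) => (B :: l).getD i 1
      map_add' A B := ?_
      map_smul' c A := ?_ }, fun B => ?_⟩
  · ext x y
    simp [elemTensor_apply, Fin.prod_univ_succ, add_mul]
  · ext x y
    simp [elemTensor_apply, Fin.prod_univ_succ, mul_assoc]
  · rw [LinearMap.comp_apply, symmetrizeₗ_apply]
    rfl

theorem prod_getD_trace {ρ : Matrix (Fin k) (Fin k) ℂ} (hρ : ρ.trace = 1)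
    (l : List (Matrix (Fin k) (Fin k) ℂ)) (hl : l.length ≤ N) :
    ∏ i : Fin N, (ρ * l.getD i 1).trace = (l.map fun B => (ρ * B).trace).prod := by
  induction l generalizing N with
  | nil => simp [hρ]
  | cons B l ih =>
    rw [List.length_cons] at hl
    obtain ⟨n, rfl⟩ := Nat.exists_eq_succ_of_ne_zero (show N ≠ 0 by omega)
    rw [Fin.prod_univ_succ]
    simp only [Fin.val_succ, List.getD_cons_succ, List.map_cons, List.prod_cons]
    rw [ih (by omega)]
    simp

theorem isSelfAdjoint_symTens {l : List (Matrix (Fin k) (Fin k) ℂ)}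
    (hl : ∀ B ∈ l, IsSelfAdjoint B) : IsSelfAdjoint (symTens N l) := by
  rw [IsSelfAdjoint, symTens, ← symmetrize_star, star_elemTensor]
  congr 2
  funext i
  rcases lt_or_ge i.1 l.length with h | h
  · rw [List.getD_eq_getElem _ _ h]
    exact hl _ (List.getElem_mem h)
  · rw [List.getD_eq_default _ _ h, star_one]

theorem map_symTens_nonneg {φ : LocalAlg k N →ₗ[ℂ] ℂ} (hφ : IsAlgState φ) (hp : IsPermInv φ)
    {l : List (Matrix (Fin k) (Fin k) ℂ)} (hl : ∀ B ∈ l, B.PosSemidef) :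
    0 ≤ φ (symTens N l) := by
  rw [symTens, hp.map_symmetrize]
  refine hφ.map_posSemidef (posSemidef_elemTensor fun i => ?_)
  rcases lt_or_ge i.1 l.length with h | h
  · rw [List.getD_eq_getElem _ _ h]
    exact hl _ (List.getElem_mem h)
  · rw [List.getD_eq_default _ _ h]
    exact Matrix.PosSemidef.one

end ElemTensor

/-! ### Quantisation of polynomials -/

section Quantize

open MvPolynomial

variable {k : ℕ} (T : SpinBasis k) {N : ℕ}

theorem quantMonomial_eq (l : List (Fin (k ^ 2 - 1))) (h : l.length ≤ N) :
    quantMonomial T N l = symTens N (l.map fun j => (T j : Matrix (Fin k) (Fin k) ℂ)) := by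
  rw [quantMonomial, dif_pos h, symEmbed_symmetrize]
  have e : (elemTensor fun i : Fin l.length => (T (l.get i) : Matrix (Fin k) (Fin k) ℂ)) =
      elemTensor fun i : Fin l.length => (l.map fun j =>
        (T j : Matrix (Fin k) (Fin k) ℂ)).getD i 1 := by
    congr
    funext i
    rw [List.getD_eq_getElem _ _ (by simp)]
    simp
  rw [symEmbed, e, embed_elemTensor h _ (by simp), symTens]

/-- The quantisation map on `N` sites as a linear map. -/
def quantizeₗ (N : ℕ) : MvPolynomial (Fin (k ^ 2 - 1)) ℂ →ₗ[ℂ] LocalAlg k N :=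
  (basisMonomials (Fin (k ^ 2 - 1)) ℂ).constr ℂ fun m =>
    quantMonomial T N (Finsupp.toMultiset m).toList

theorem quantizeₗ_monomial (m : Fin (k ^ 2 - 1) →₀ ℕ) (c : ℂ) :
    quantizeₗ T N (monomial m c) = c • quantMonomial T N (Finsupp.toMultiset m).toList := by
  have : (monomial m c : MvPolynomial (Fin (k ^ 2 - 1)) ℂ) =
      c • basisMonomials (Fin (k ^ 2 - 1)) ℂ m := by
    simp [smul_monomial]
  rw [this, map_smul, quantizeₗ, Module.Basis.constr_basis]

theorem quantizeₗ_apply (f : MvPolynomial (Fin (k ^ 2 - 1)) ℂ) :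
    quantizeₗ T N f = quantize T f N := by
  conv_lhs => rw [← support_sum_monomial_coeff f]
  rw [map_sum, quantize]
  exact Finset.sum_congr rfl fun m _ => quantizeₗ_monomial T m _

theorem quantizeₗ_list (l : List (Fin (k ^ 2 - 1))) (h : l.length ≤ N) :
    quantizeₗ T N (l.map X).prod =
      symTens N (l.map fun j => (T j : Matrix (Fin k) (Fin k) ℂ)) := by
  have e : (l.map X).prod =
      (monomial (Multiset.toFinsupp (l : Multiset (Fin (k ^ 2 - 1)))) (1 : ℂ)) := by
    clear h
    induction l with
    | nil => simp
    | cons j l ih =>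
      rw [List.map_cons, List.prod_cons, ih, ← Multiset.cons_coe, ← Multiset.singleton_add, map_add,
        Multiset.toFinsupp_singleton, X, monomial_mul, one_mul]
  have hperm : (Finsupp.toMultiset
      (Multiset.toFinsupp (l : Multiset (Fin (k ^ 2 - 1))))).toList.Perm l := by
    rw [← Multiset.coe_eq_coe, Multiset.coe_toList, Multiset.toFinsupp_toMultiset]
  rw [e, quantizeₗ_monomial, one_smul, quantMonomial_eq T _ (by rwa [hperm.length_eq])]
  exact symTens_perm (hperm.map _) (by rwa [List.length_map, hperm.length_eq])

/-- The affine function `c + ∑ v_j x_j` attached to `q = (c, v)`. -/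
def affPoly {R : Type*} [CommSemiring R] {d : ℕ} (q : R × (Fin d → R)) : MvPolynomial (Fin d) R :=
  C q.1 + ∑ j, C (q.2 j) * X j

/-- The matrix `c + ∑ v_j T_j` attached to `q = (c, v)`. -/
def affMat (q : ℂ × (Fin (k ^ 2 - 1) → ℂ)) : Matrix (Fin k) (Fin k) ℂ :=
  q.1 • 1 + ∑ j, q.2 j • (T j : Matrix (Fin k) (Fin k) ℂ)

/-- Induction on the affine factors, `js` recording the variables already expanded: a constant term
contributes an identity factor, which is absorbed, and a linear term moves one variable into `js`.
-/
theorem quantizeₗ_mul_affPoly (Bs : List (ℂ × (Fin (k ^ 2 - 1) → ℂ)))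
    (js : List (Fin (k ^ 2 - 1))) (h : js.length + Bs.length ≤ N) :
    quantizeₗ T N ((js.map X).prod * (Bs.map affPoly).prod) =
      symTens N (Bs.map (affMat T) ++ js.map fun j => (T j : Matrix (Fin k) (Fin k) ℂ)) := by
  induction Bs generalizing js with
  | nil => simpa using quantizeₗ_list T js (by simpa using h)
  | cons q Bs ih =>
    rw [List.length_cons] at h
    have e : (js.map X).prod * ((q :: Bs).map affPoly).prod =
        q.1 • ((js.map X).prod * (Bs.map affPoly).prod) +
        ∑ j, q.2 j • (((j :: js).map X).prod * (Bs.map affPoly).prod) := by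
      simp only [List.map_cons, List.prod_cons, smul_eq_C_mul]
      rw [show affPoly q = C q.1 + ∑ j, C (q.2 j) * X j from rfl]
      generalize (js.map (X (R := ℂ))).prod = P
      generalize (Bs.map (affPoly (R := ℂ))).prod = Q
      rw [add_mul, mul_add, Finset.sum_mul, Finset.mul_sum]
      refine congrArg₂ (· + ·) (mul_left_comm _ _ _) (Finset.sum_congr rfl fun j _ => ?_)
      ring
    obtain ⟨Λ, hΛ⟩ := exists_symTens_cons_linear (N := N) (by omega)
      (Bs.map (affMat T) ++ js.map fun j => (T j : Matrix (Fin k) (Fin k) ℂ))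
    have e' : symTens N ((q :: Bs).map (affMat T) ++
        js.map fun j => (T j : Matrix (Fin k) (Fin k) ℂ)) = Λ (affMat T q) := (hΛ _).symm
    rw [e', e, affMat, map_add, map_add, map_smul, map_smul,
      map_sum, map_sum, hΛ, ih js (by omega), symTens_one_cons (by simp; omega)]
    congr 1
    refine Finset.sum_congr rfl fun j _ => ?_
    rw [map_smul, map_smul, hΛ, ih (j :: js) (by simp; omega)]
    congr 1
    refine symTens_perm ?_ (by simp; omega)
    simp only [List.map_cons]
    exact List.perm_middle

theorem quantizeₗ_prod_affPoly (Bs : List (ℂ × (Fin (k ^ 2 - 1) → ℂ))) (h : Bs.length ≤ N) :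
    quantizeₗ T N (Bs.map affPoly).prod = symTens N (Bs.map (affMat T)) := by
  simpa using quantizeₗ_mul_affPoly T Bs [] (by simpa using h)

theorem isQuasiSymmetric_symTens {A : LocalSeq k} (l : List (Matrix (Fin k) (Fin k) ℂ))
    (hA : ∀ N, l.length ≤ N → A N = symTens N l) (hA' : ∀ N, N < l.length → A N = 0) :
    IsQuasiSymmetric A := by
  refine ⟨fun N => ?_, fun ε hε =>
    ⟨A, ⟨l.length, elemTensor l.get, fun N h => ?_⟩, 0, fun N _ => ?_⟩⟩
  · rcases lt_or_ge N l.length with h | h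
    · rw [hA' N h, ← symmetrizeₗ_apply, map_zero]
    · rw [hA N h, symTens, symmetrize_symmetrize]
  · rw [symEmbed_elemTensor_get, hA N h]
  · simpa using hε

theorem isQuasiSymmetric_quantMonomial (l : List (Fin (k ^ 2 - 1))) :
    IsQuasiSymmetric fun N => quantMonomial T N l := by
  refine isQuasiSymmetric_symTens (l.map fun j => (T j : Matrix (Fin k) (Fin k) ℂ))
    (fun N h => quantMonomial_eq T l (by simpa using h)) fun N h => ?_
  rw [quantMonomial, dif_neg (by simpa using h)]

theorem isQuasiSymmetric_quantize (f : MvPolynomial (Fin (k ^ 2 - 1)) ℂ) :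
    IsQuasiSymmetric (quantize T f) := by
  induction f using MvPolynomial.induction_on' with
  | monomial m c =>
    have : quantize T (monomial m c) =
        c • fun N => quantMonomial T N (Finsupp.toMultiset m).toList := by
      funext N
      rw [← quantizeₗ_apply, quantizeₗ_monomial, Pi.smul_apply]
    rw [this]
    exact (isQuasiSymmetric_quantMonomial T _).smul c
  | add p q hp hq =>
    have : quantize T (p + q) = quantize T p + quantize T q := by
      funext N
      rw [Pi.add_apply, ← quantizeₗ_apply, ← quantizeₗ_apply, ← quantizeₗ_apply, map_add]
    rw [this]
    exact hp.add hq

theorem isSelfAdjoint_quantMonomial (l : List (Fin (k ^ 2 - 1))) :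
    IsSelfAdjoint (quantMonomial T N l) := by
  rcases lt_or_ge N l.length with h | h
  · rw [quantMonomial, dif_neg (not_le.mpr h)]
    exact .zero _
  · rw [quantMonomial_eq T l h]
    refine isSelfAdjoint_symTens fun B hB => ?_
    obtain ⟨j, -, rfl⟩ := List.mem_map.mp hB
    exact (T j).2.1

theorem isSelfAdjoint_quantize_real (p : MvPolynomial (Fin (k ^ 2 - 1)) ℝ) :
    IsSelfAdjoint (quantize T (p.map Complex.ofRealHom) N) := by
  rw [quantize]
  refine isSelfAdjoint_sum _ fun m _ => ?_
  rw [coeff_map]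
  exact isHermitian_real_smul (isSelfAdjoint_quantMonomial T _)

/-- Split off (Tr B / k)·1 and expand the traceless rest in the basis. -/
theorem exists_affMat_eq_of_isHermitian [NeZero k] {B : Matrix (Fin k) (Fin k) ℂ}
    (hB : B.IsHermitian) : ∃ (c : ℝ) (v : Fin (k ^ 2 - 1) → ℝ),
      affMat T ((c : ℂ), fun j => (v j : ℂ)) = B := by
  have hk : (k : ℂ) ≠ 0 := by exact_mod_cast NeZero.ne k
  have htr : ((B.trace.re : ℝ) : ℂ) = B.trace := by
    refine Complex.conj_eq_iff_re.mp ?_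
    have := Matrix.trace_conjTranspose B
    rw [hB.eq] at this
    exact this.symm
  have hmem : B - ((B.trace.re / k : ℝ) : ℂ) • (1 : Matrix (Fin k) (Fin k) ℂ) ∈
      tracelessHermitian k := by
    refine ⟨hB.sub ?_, ?_⟩
    · rw [Matrix.IsHermitian, Matrix.conjTranspose_smul, Matrix.conjTranspose_one]
      simp
    · rw [Matrix.trace_sub, Matrix.trace_smul, Matrix.trace_one, Fintype.card_fin]
      push_cast
      rw [htr, smul_eq_mul, div_mul_cancel₀ _ hk, sub_self]
  refine ⟨B.trace.re / k, fun j => T.repr ⟨_, hmem⟩ j, ?_⟩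
  have h := congrArg Subtype.val (T.sum_repr ⟨_, hmem⟩)
  simp only [AddSubmonoidClass.coe_finsetSum, Submodule.coe_smul] at h
  rw [affMat]
  have e (r : ℝ) (M : Matrix (Fin k) (Fin k) ℂ) : (r : ℂ) • M = r • M := by
    ext i j
    simp
  simp only [e] at h ⊢
  rw [h]
  abel

theorem exists_affMat_eq [NeZero k] (B : Matrix (Fin k) (Fin k) ℂ) : ∃ q, affMat T q = B := by
  obtain ⟨c, v, h1⟩ := exists_affMat_eq_of_isHermitian T (B := (realPart B : Matrix _ _ ℂ))
    (realPart B).2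
  obtain ⟨c', v', h2⟩ := exists_affMat_eq_of_isHermitian T (B := (imaginaryPart B : Matrix _ _ ℂ))
    (imaginaryPart B).2
  refine ⟨(c + Complex.I * c', fun j => v j + Complex.I * v' j), ?_⟩
  rw [← realPart_add_I_smul_imaginaryPart B, ← h1, ← h2]
  simp only [affMat, add_smul, mul_smul, Finset.sum_add_distrib, smul_add, Finset.smul_sum]
  abel

/-- Every symmetric sequence is eventually the quantisation of a polynomial. -/
theorem exists_quantize_eq_symEmbed [NeZero k] {M : ℕ} (a : LocalAlg k M) :
    ∃ f, ∀ (N : ℕ) (h : M ≤ N), quantize T f N = symEmbed h a := by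
  choose q hq using fun x y : Fin k => exists_affMat_eq T (Matrix.single x y 1)
  -- Expand a in tensor products of matrix units; each unit is a complex affine combination of 1 and
  -- the T_j.
  refine ⟨∑ x, ∑ y, a x y • ((List.ofFn fun i => q (x i) (y i)).map affPoly).prod, fun N h => ?_⟩
  have e : a = ∑ x, ∑ y, a x y • elemTensor fun i => Matrix.single (x i) (y i) (1 : ℂ) := by
    conv_lhs => rw [Matrix.matrix_eq_sum_single a]
    refine Finset.sum_congr rfl fun x _ => Finset.sum_congr rfl fun y _ => ?_
    ext x' y'
    simp only [Matrix.smul_apply, elemTensor_apply, Matrix.single_apply, smul_eq_mul,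
      Finset.prod_ite_zero, Finset.prod_const_one, Finset.mem_univ, true_imp_iff, mul_ite, mul_one,
      mul_zero, forall_and, funext_iff]
  conv_rhs => rw [e]
  rw [← quantizeₗ_apply, ← symEmbedₗ_apply]
  simp only [map_sum, map_smul]
  refine Finset.sum_congr rfl fun x _ => Finset.sum_congr rfl fun y _ => ?_
  rw [symEmbedₗ_apply, symEmbed_elemTensor, quantizeₗ_prod_affPoly T _ (by simpa using h)]
  have e' : (affMat T ∘ fun i => q (x i) (y i)) = fun i => Matrix.single (x i) (y i) (1 : ℂ) :=
    funext fun i => hq _ _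
  rw [List.map_ofFn, e']

end Quantize

open MvPolynomial

/-! ### The state space and its coordinates -/

section StateSpace

variable {k : ℕ} (T : SpinBasis k)

theorem isAlgState_stateSpace (ρ : StateSpace k) : IsAlgState (traceMul ρ.1) :=
  isAlgState_traceMul ρ.2.1 ρ.2.2

/-- The defining conditions are closed, and the entries ρ_xy = Tr(ρ E_yx) are bounded because states
are contractive. -/
instance : CompactSpace (StateSpace k) := by
  suffices IsCompact {ρ : Matrix (Fin k) (Fin k) ℂ | ρ.PosSemidef ∧ ρ.trace = 1} from
    isCompact_iff_compactSpace.mp this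
  refine Metric.isCompact_of_isClosed_isBounded ?_ ?_
  · have e : {ρ : Matrix (Fin k) (Fin k) ℂ | ρ.PosSemidef ∧ ρ.trace = 1} =
        ({ρ | ρᴴ = ρ} ∩ ⋂ v : Fin k → ℂ, {ρ | 0 ≤ star v ⬝ᵥ (ρ *ᵥ v)}) ∩ {ρ | ρ.trace = 1} := by
      ext ρ
      simp only [Matrix.posSemidef_iff_dotProduct_mulVec, Matrix.IsHermitian, Set.mem_ofPred_eq,
        Set.mem_inter_iff, Set.mem_iInter]
    rw [e]
    refine ((isClosed_eq (by fun_prop) (by fun_prop)).inter (isClosed_iInter fun v =>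
      isClosed_le (by fun_prop) (by fun_prop))).inter (isClosed_eq (by fun_prop) (by fun_prop))
  · refine isBounded_iff_forall_norm_le.mpr
      ⟨∑ x, ∑ y, ‖Matrix.single (n := Fin k) (m := Fin k) y x (1 : ℂ)‖ *
        ‖Matrix.single (n := Fin k) (m := Fin k) x y (1 : ℂ)‖, ?_⟩
    rintro ρ hρ
    have h := isAlgState_traceMul hρ.1 hρ.2
    conv_lhs => rw [Matrix.matrix_eq_sum_single ρ]
    refine (norm_sum_le _ _).trans (Finset.sum_le_sum fun x _ => (norm_sum_le _ _).trans
      (Finset.sum_le_sum fun y _ => ?_))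
    rw [show Matrix.single x y (ρ x y) = ρ x y • Matrix.single x y (1 : ℂ) by simp, norm_smul]
    gcongr
    have := h.norm_le (Matrix.single y x 1)
    rwa [traceMul_apply, Matrix.trace_mul_single, MulOpposite.op_one, one_smul] at this

/-- The coordinate functions `x_j(ρ) = Tr(ρ T_j)`. -/
def coord (j : Fin (k ^ 2 - 1)) : C(StateSpace k, ℝ) where
  toFun ρ := (ρ.1 * (T j : Matrix (Fin k) (Fin k) ℂ)).trace.re
  continuous_toFun := Complex.continuous_re.comp
    ((continuous_subtype_val.mul continuous_const).matrix_trace)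

theorem ofReal_coord (j : Fin (k ^ 2 - 1)) (ρ : StateSpace k) :
    ((coord T j ρ : ℝ) : ℂ) = (ρ.1 * (T j : Matrix (Fin k) (Fin k) ℂ)).trace :=
  (isAlgState_stateSpace ρ).ofReal_re (a := (T j : Matrix (Fin k) (Fin k) ℂ)) (T j).2.1

theorem aeval_coord_apply (p : MvPolynomial (Fin (k ^ 2 - 1)) ℝ) (ρ : StateSpace k) :
    aeval (coord T) p ρ = eval (fun j => coord T j ρ) p := by
  induction p using MvPolynomial.induction_on with
  | C a => simp
  | add p q hp hq => simp [hp, hq]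
  | mul_X p i hp => simp [hp]

theorem polyFun_map (p : MvPolynomial (Fin (k ^ 2 - 1)) ℝ) (ρ : StateSpace k) :
    polyFun T (p.map Complex.ofRealHom) ρ = ((aeval (coord T) p ρ : ℝ) : ℂ) := by
  rw [aeval_coord_apply]
  change eval (fun j => (ρ.1 * (T j : Matrix (Fin k) (Fin k) ℂ)).trace)
    (p.map Complex.ofRealHom) = _
  simp_rw [← ofReal_coord]
  rw [eval_map]
  exact eval₂_comp_left Complex.ofRealHom (RingHom.id ℝ) (fun j => coord T j ρ) p |>.symm

end StateSpace

/-! ### The semiring of positive affine functions and its characters -/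

section Positivity

variable {k : ℕ} (T : SpinBasis k)

/-- The complexification of the data of a real affine function. -/
def complexify {d : ℕ} (q : ℝ × (Fin d → ℝ)) : ℂ × (Fin d → ℂ) := (q.1, fun j => q.2 j)

theorem map_affPoly {d : ℕ} (q : ℝ × (Fin d → ℝ)) :
    (affPoly q).map Complex.ofRealHom = affPoly (complexify q) := by
  simp [affPoly, complexify]

/-- The semiring of real polynomials generated by the affine functions of positive matrices. -/
def positiveSemiring : Subsemiring (MvPolynomial (Fin (k ^ 2 - 1)) ℝ) :=
  Subsemiring.closure (affPoly '' {q | (affMat T (complexify q)).PosSemidef})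

theorem affPoly_mem {q : ℝ × (Fin (k ^ 2 - 1) → ℝ)} (hq : (affMat T (complexify q)).PosSemidef) :
    affPoly q ∈ positiveSemiring T :=
  Subsemiring.subset_closure ⟨q, hq, rfl⟩

theorem C_mem_positiveSemiring {c : ℝ} (hc : 0 ≤ c) : C c ∈ positiveSemiring T := by
  have h : (affMat T (complexify (c, 0))).PosSemidef := by
    have e : affMat T (complexify (c, 0)) = (c : ℂ) • 1 := by simp [affMat, complexify]
    rw [e]
    exact Matrix.PosSemidef.one.smul (by exact_mod_cast hc)
  have := affPoly_mem T h
  simpa [affPoly] using this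

/-- The Archimedean property. Variables are handled by ‖T_j‖ ± T_j ≥ 0, products by cd ± px = ½[(c ±
p)(d + x) + (c ∓ p)(d - x)]. -/
theorem exists_C_add_mem_and_sub_mem (p : MvPolynomial (Fin (k ^ 2 - 1)) ℝ) :
    ∃ c : ℝ, C c + p ∈ positiveSemiring T ∧ C c - p ∈ positiveSemiring T := by
  have hX (j : Fin (k ^ 2 - 1)) :
      ∃ c : ℝ, C c + X j ∈ positiveSemiring T ∧ C c - X j ∈ positiveSemiring T := by
    have hT : (T j : Matrix (Fin k) (Fin k) ℂ).IsHermitian := (T j).2.1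
    refine ⟨‖(T j : Matrix (Fin k) (Fin k) ℂ)‖, ?_, ?_⟩
    · have h : (affMat T (complexify (‖(T j : Matrix (Fin k) (Fin k) ℂ)‖,
          Pi.single j 1))).PosSemidef := by
        have := posSemidef_smul_one_sub _ hT.neg
        rw [norm_neg, sub_neg_eq_add] at this
        convert this using 1
        simp [affMat, complexify, Pi.single_apply]
      have := affPoly_mem T h
      simpa [affPoly, Pi.single_apply] using this
    · have h : (affMat T (complexify (‖(T j : Matrix (Fin k) (Fin k) ℂ)‖,
          -Pi.single j 1))).PosSemidef := by
        have := posSemidef_smul_one_sub _ hT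
        convert this using 1
        simp [affMat, complexify, Pi.single_apply, sub_eq_add_neg]
      have := affPoly_mem T h
      simpa [affPoly, Pi.single_apply, sub_eq_add_neg] using this
  induction p using MvPolynomial.induction_on with
  | C a =>
    refine ⟨|a|, ?_, ?_⟩
    · rw [← C_add]
      exact C_mem_positiveSemiring T (by linarith [neg_abs_le a])
    · rw [← C_sub]
      exact C_mem_positiveSemiring T (by linarith [le_abs_self a])
  | add p q hp hq =>
    obtain ⟨c, h1, h2⟩ := hp
    obtain ⟨d, h3, h4⟩ := hq
    refine ⟨c + d, ?_, ?_⟩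
    · convert add_mem h1 h3 using 1
      rw [C_add]; ring
    · convert add_mem h2 h4 using 1
      rw [C_add]; ring
  | mul_X p i hp =>
    obtain ⟨c, h1, h2⟩ := hp
    obtain ⟨d, h3, h4⟩ := hX i
    have half : (C (1 / 2) : MvPolynomial (Fin (k ^ 2 - 1)) ℝ) ∈ positiveSemiring T :=
      C_mem_positiveSemiring T (by norm_num)
    have e2 : (C (1 / 2) : MvPolynomial (Fin (k ^ 2 - 1)) ℝ) * 2 = 1 := by
      rw [← map_ofNat C 2, ← C_mul]
      norm_num
    refine ⟨c * d, ?_, ?_⟩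
    · convert mul_mem half (add_mem (mul_mem h1 h3) (mul_mem h2 h4)) using 1
      rw [C_mul]
      linear_combination (-C c * C d - p * X i) * e2
    · convert mul_mem half (add_mem (mul_mem h2 h3) (mul_mem h1 h4)) using 1
      rw [C_mul]
      linear_combination (-C c * C d + p * X i) * e2

/-- A linear functional with prescribed values on `1, T_1, …, T_{k²-1}`. -/
theorem exists_functional [NeZero k] (y : Fin (k ^ 2 - 1) → ℝ) :
    ∃ ψ : Matrix (Fin k) (Fin k) ℂ →ₗ[ℂ] ℂ, ψ 1 = 1 ∧
      ∀ j, ψ (T j : Matrix (Fin k) (Fin k) ℂ) = y j := by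
  have hk : (k : ℂ) ≠ 0 := by exact_mod_cast NeZero.ne k
  have hk' : (k : ℝ) ≠ 0 := by exact_mod_cast NeZero.ne k
  let τ : Matrix (Fin k) (Fin k) ℂ →ₗ[ℝ] ℝ :=
    Complex.reLm ∘ₗ (Matrix.traceLinearMap (Fin k) ℝ ℂ)
  have htr (B : Matrix (Fin k) (Fin k) ℂ) :
      (realPart B : Matrix (Fin k) (Fin k) ℂ).trace = ((τ B : ℝ) : ℂ) := by
    rw [realPart_apply_coe, Matrix.trace_smul, Matrix.trace_add, Matrix.star_eq_conjTranspose,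
      Matrix.trace_conjTranspose]
    apply Complex.ext
    · simp [τ]; ring
    · simp [τ]
  let π : Matrix (Fin k) (Fin k) ℂ →ₗ[ℝ] tracelessHermitian k :=
    LinearMap.codRestrict (tracelessHermitian k)
      ((selfAdjoint.submodule ℝ (Matrix (Fin k) (Fin k) ℂ)).subtype ∘ₗ realPart -
        (LinearMap.toSpanSingleton ℝ _ ((k : ℝ)⁻¹ • (1 : Matrix (Fin k) (Fin k) ℂ))) ∘ₗ τ)
      fun B => by
        refine ⟨Matrix.IsHermitian.sub (realPart B).2 ?_, ?_⟩
        · simp [Matrix.IsHermitian, Matrix.conjTranspose_smul]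
        · rw [LinearMap.sub_apply, Matrix.trace_sub]
          change (realPart B : Matrix (Fin k) (Fin k) ℂ).trace - 
            (τ B • (k : ℝ)⁻¹ • (1 : Matrix (Fin k) (Fin k) ℂ)).trace = 0
          rw [htr, Matrix.trace_smul, Matrix.trace_smul, Matrix.trace_one, Fintype.card_fin]
          simp [hk]
  have hπ (B : Matrix (Fin k) (Fin k) ℂ) : (π B : Matrix (Fin k) (Fin k) ℂ) =
      (realPart B : Matrix (Fin k) (Fin k) ℂ) - τ B • ((k : ℝ)⁻¹ • 1) := rfl
  -- On Hermitian matrices f sends c + Σ v_j T_j to c + Σ v_j y_j, and it vanishes on i times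
  -- Hermitian matrices; hence its complex-linear extension agrees with f on Hermitian matrices.
  let f : Matrix (Fin k) (Fin k) ℂ →ₗ[ℝ] ℝ := (k : ℝ)⁻¹ • τ + T.constr ℝ y ∘ₗ π
  have hf (B : Matrix (Fin k) (Fin k) ℂ) : f B = (k : ℝ)⁻¹ * τ B + T.constr ℝ y (π B) := rfl
  have hI (B : Matrix (Fin k) (Fin k) ℂ) (hB : IsSelfAdjoint B) : f (Complex.I • B) = 0 := by
    have h1 : τ (Complex.I • B) = 0 := by
      have := htr (Complex.I • B)
      rw [realPart_I_smul, hB.imaginaryPart] at this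
      simpa using this.symm
    have h2 : π (Complex.I • B) = 0 := by
      refine Subtype.ext ?_
      rw [hπ, h1, realPart_I_smul, hB.imaginaryPart]
      simp
    rw [hf, h1, h2]
    simp
  refine ⟨Module.Dual.extendRCLike f, ?_, fun j => ?_⟩
  · have h1 : τ 1 = k := by simp [τ]
    have h2 : π 1 = 0 := by
      refine Subtype.ext ?_
      rw [hπ, h1, (IsSelfAdjoint.one _).coe_realPart, smul_smul, mul_inv_cancel₀ hk']
      simp
    have h3 : f 1 = 1 := by
      rw [hf, h1, h2, map_zero, inv_mul_cancel₀ hk', add_zero]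
    rw [Module.Dual.extendRCLike_apply]
    have h4 := hI 1 (.one _)
    simp [h3, h4]
  · have hT : IsSelfAdjoint (T j : Matrix (Fin k) (Fin k) ℂ) := (T j).2.1
    have h1 : τ (T j : Matrix (Fin k) (Fin k) ℂ) = 0 := by
      simp [τ, (T j).2.2]
    have h2 : π (T j : Matrix (Fin k) (Fin k) ℂ) = T j := by
      refine Subtype.ext ?_
      rw [hπ, h1, hT.coe_realPart, zero_smul, sub_zero]
    have h3 : f (T j : Matrix (Fin k) (Fin k) ℂ) = y j := by
      rw [hf, h1, h2, Module.Basis.constr_basis, mul_zero, zero_add]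
    rw [Module.Dual.extendRCLike_apply]
    have h4 := hI _ hT
    simp [h3, h4]

/-- The characters which are nonnegative on the positive semiring are given by states. -/
theorem exists_state_of_character [NeZero k] (χ : MvPolynomial (Fin (k ^ 2 - 1)) ℝ →ₐ[ℝ] ℝ)
    (hχ : ∀ t ∈ positiveSemiring T, 0 ≤ χ t) :
    ∃ ρ : StateSpace k, ∀ p, χ p = aeval (coord T) p ρ := by
  obtain ⟨ψ, h1, hT⟩ := exists_functional T fun j => χ (X j)
  have haff (q : ℝ × (Fin (k ^ 2 - 1) → ℝ)) : ψ (affMat T (complexify q)) = χ (affPoly q) := by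
    have hC (c : ℝ) : χ (C c) = c := by
      exact χ.commutes c
    simp [affMat, affPoly, complexify, h1, hT, hC]
  have hψ : IsAlgState ψ := by
    -- Positivity of ψ at a positive matrix B is nonnegativity of χ at the generator of the semiring
    -- attached to B.
    refine isAlgState_of_nonneg (fun B hB => ?_) h1
    obtain ⟨c, v, h⟩ := exists_affMat_eq_of_isHermitian T hB.1
    have h' : affMat T (complexify (c, v)) = B := h
    rw [← h', haff]
    exact_mod_cast hχ _ (affPoly_mem T (by rwa [h']))
  refine ⟨⟨density ψ, posSemidef_density hψ, trace_density hψ⟩, fun p => ?_⟩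
  rw [aeval_coord_apply]
  have hc (j) : coord T j ⟨density ψ, posSemidef_density hψ, trace_density hψ⟩ = χ (X j) := by
    change (density ψ * (T j : Matrix (Fin k) (Fin k) ℂ)).trace.re = _
    rw [trace_density_mul, hT, Complex.ofReal_re]
  simp_rw [hc]
  exact DFunLike.congr_fun (aeval_unique χ) p

/-- A functional on polynomials, nonnegative on products of affine functions of positive matrices,
is nonnegative on all polynomials which are nonnegative on the state space. -/
theorem map_nonneg_of_nonneg_on_stateSpace [NeZero k]
    (L : MvPolynomial (Fin (k ^ 2 - 1)) ℝ →ₗ[ℝ] ℝ) (h1 : L 1 = 1)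
    (hL : ∀ l : List (ℝ × (Fin (k ^ 2 - 1) → ℝ)),
      (∀ q ∈ l, (affMat T (complexify q)).PosSemidef) → 0 ≤ L (l.map affPoly).prod)
    (p : MvPolynomial (Fin (k ^ 2 - 1)) ℝ) (hp : ∀ ρ, 0 ≤ aeval (coord T) p ρ) : 0 ≤ L p := by
  refine map_nonneg_of_forall_character (T := positiveSemiring T)
    (fun c hc => C_mem_positiveSemiring T hc)
    (fun r => (exists_C_add_mem_and_sub_mem T r).imp fun c h => h.1) L (fun t ht => ?_) h1 p
    fun χ hχ => ?_
  · rw [positiveSemiring, Subsemiring.mem_closure_iff_exists_list] at ht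
    obtain ⟨ls, hls, rfl⟩ := ht
    rw [map_list_sum, List.map_map]
    refine List.sum_nonneg fun x hx => ?_
    obtain ⟨l, hl, rfl⟩ := List.mem_map.mp hx
    obtain ⟨l', hl', h'⟩ : ∃ l' : List (ℝ × (Fin (k ^ 2 - 1) → ℝ)),
        (∀ q ∈ l', (affMat T (complexify q)).PosSemidef) ∧ l'.map affPoly = l := by
      have h2 := hls l hl
      clear hl hx
      induction l with
      | nil => exact ⟨[], by simp, rfl⟩
      | cons a l ih =>
        obtain ⟨q, hq, rfl⟩ := h2 a (by simp)
        obtain ⟨l', h3, rfl⟩ := ih fun b hb => h2 b (by simp [hb])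
        exact ⟨q :: l', List.forall_mem_cons.mpr ⟨hq, h3⟩, rfl⟩
    rw [Function.comp_apply, ← h']
    exact hL l' hl'
  · obtain ⟨ρ, hρ⟩ := exists_state_of_character T χ hχ
    rw [hρ]
    exact hp ρ

end Positivity

/-! ### Product states on quantised polynomials -/

section ProductStates

variable {k : ℕ} (T : SpinBasis k) {N : ℕ}

theorem isAlgState_productState (ρ : StateSpace k) (N : ℕ) :
    IsAlgState (traceMul (elemTensor fun _ : Fin N => ρ.1)) :=
  isAlgState_traceMul (posSemidef_elemTensor fun _ => ρ.2.1)
    (by simp [trace_elemTensor, ρ.2.2])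

theorem isPermInv_productState (ρ : StateSpace k) (N : ℕ) :
    IsPermInv (traceMul (elemTensor fun _ : Fin N => ρ.1)) := fun σ a => by
  rw [traceMul_apply, traceMul_apply]
  have e : permute σ (elemTensor fun _ : Fin N => ρ.1) = elemTensor fun _ : Fin N => ρ.1 :=
    permute_elemTensor σ _
  conv_lhs => rw [← e]
  rw [← map_mul, trace_permute]

theorem productState_symTens (ρ : StateSpace k) (l : List (Matrix (Fin k) (Fin k) ℂ))
    (hl : l.length ≤ N) : productState ρ N (symTens N l) =
      (l.map fun B => (ρ.1 * B).trace).prod := by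
  change traceMul _ _ = _
  rw [symTens, (isPermInv_productState ρ N).map_symmetrize, traceMul_apply, elemTensor_mul,
    trace_elemTensor, prod_getD_trace ρ.2.2 l hl]

theorem polyFun_apply (f : MvPolynomial (Fin (k ^ 2 - 1)) ℂ) (ρ : StateSpace k) : polyFun T f ρ =
    eval (fun j => (ρ.1 * (T j : Matrix (Fin k) (Fin k) ℂ)).trace) f := rfl

/-- The values agree exactly once N reaches the degree of each monomial, since a product state
factorises over tensor factors; in particular the threshold does not depend on ρ. -/
theorem eventually_productState_quantize (f : MvPolynomial (Fin (k ^ 2 - 1)) ℂ) :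
    ∀ᶠ N in atTop, ∀ ρ : StateSpace k, productState ρ N (quantize T f N) = polyFun T f ρ := by
  induction f using MvPolynomial.induction_on' with
  | monomial m c =>
    filter_upwards [eventually_ge_atTop (Finsupp.toMultiset m).toList.length] with N hN ρ
    rw [← quantizeₗ_apply, quantizeₗ_monomial, quantMonomial_eq T _ hN]
    change traceMul _ _ = _
    rw [map_smul]
    change _ • productState ρ N _ = _
    rw [productState_symTens ρ _ (by simpa using hN), polyFun_apply, eval_monomial, smul_eq_mul,
      List.map_map, ← Multiset.prod_coe, ← Multiset.map_coe, Multiset.coe_toList,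
      Finsupp.toMultiset_map, Finsupp.prod_toMultiset,
      Finsupp.prod_mapDomain_index (fun _ => pow_zero _) (fun _ _ _ => pow_add _ _ _)]
    rfl
  | add p q hp hq =>
    filter_upwards [hp, hq] with N h1 h2 ρ
    rw [polyFun_apply, map_add, ← polyFun_apply, ← polyFun_apply, ← h1 ρ, ← h2 ρ,
      ← quantizeₗ_apply, map_add, quantizeₗ_apply, quantizeₗ_apply]
    exact map_add (traceMul _) _ _

end ProductStates

/-! ### Extension from polynomials to continuous functions -/

section Extension

variable {k : ℕ} (T : SpinBasis k)

/-- A functional on polynomials which is nonnegative on polynomials nonnegative on the state space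
extends to a positive functional on the continuous functions. -/
theorem exists_positive_extension (L : MvPolynomial (Fin (k ^ 2 - 1)) ℝ →ₗ[ℝ] ℝ)
    (hL : ∀ p, (∀ ρ, 0 ≤ aeval (coord T) p ρ) → 0 ≤ L p) :
    ∃ g : C(StateSpace k, ℝ) →ₗ[ℝ] ℝ, (∀ p, g (aeval (coord T) p) = L p) ∧
      ∀ h, 0 ≤ h → 0 ≤ g h := by
  let P : MvPolynomial (Fin (k ^ 2 - 1)) ℝ →ₗ[ℝ] C(StateSpace k, ℝ) := (aeval (coord T)).toLinearMap
  -- Positivity applied to p and -p shows that L kills polynomials vanishing on the state space, so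
  -- L factors through their functions.
  have hker : L ∈ LinearMap.range P.dualMap := by
    rw [LinearMap.range_dualMap_eq_dualAnnihilator_ker, Submodule.mem_dualAnnihilator]
    intro p hp
    have hp' : aeval (coord T) p = 0 := hp
    refine le_antisymm ?_ (hL p fun ρ => by rw [hp']; exact le_rfl)
    have := hL (-p) fun ρ => by rw [map_neg, hp', neg_zero]; exact le_rfl
    rw [map_neg] at this
    linarith
  obtain ⟨g₀, hg₀⟩ := hker
  have hg₀' (p) : g₀ (P p) = L p := DFunLike.congr_fun hg₀ p
  let s : PointedCone ℝ C(StateSpace k, ℝ) :=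
    { carrier := {h | 0 ≤ h}
      add_mem' := fun ha hb ρ => add_nonneg (ha ρ) (hb ρ)
      zero_mem' := le_refl (0 : C(StateSpace k, ℝ))
      smul_mem' := fun c h hh ρ => mul_nonneg c.2 (hh ρ) }
  let f : C(StateSpace k, ℝ) →ₗ.[ℝ] ℝ := ⟨LinearMap.range P, g₀.domRestrict _⟩
  have hnonneg : ∀ h : f.domain, (h : C(StateSpace k, ℝ)) ∈ s → 0 ≤ f h := by
    rintro ⟨_, p, rfl⟩ hp
    change 0 ≤ g₀ (P p)
    rw [hg₀']
    exact hL p fun ρ => hp ρ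
  -- Constants are polynomial functions and dominate every continuous function on a compact space;
  -- this is the cofinality needed for Riesz extension.
  have hdense : ∀ h, ∃ c : f.domain, (c : C(StateSpace k, ℝ)) + h ∈ s := by
    intro h
    refine ⟨⟨P (C ‖h‖), LinearMap.mem_range_self P _⟩, fun ρ => ?_⟩
    have := (abs_le.mp (h.norm_coe_le_norm ρ)).1
    have e : P (C ‖h‖) ρ = ‖h‖ := by
      change aeval (coord T) (C ‖h‖) ρ = ‖h‖
      rw [aeval_coord_apply, eval_C]
    change 0 ≤ P (C ‖h‖) ρ + h ρ
    rw [e]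
    linarith
  obtain ⟨g, h1, h2⟩ := riesz_extension s f hnonneg hdense
  refine ⟨g, fun p => ?_, h2⟩
  rw [← hg₀']
  exact h1 ⟨P p, LinearMap.mem_range_self P p⟩

/-- The complexification of a positive functional. -/
theorem exists_complexification {X : Type*} [TopologicalSpace X] [CompactSpace X]
    (g : C(X, ℝ) →ₗ[ℝ] ℝ) (h1 : g 1 = 1) (hg : ∀ h, 0 ≤ h → 0 ≤ g h) :
    ∃ ω : C(X, ℂ) →ₗ[ℂ] ℂ, IsAlgState ω ∧
      (∀ (f : C(X, ℂ)) (h : C(X, ℝ)), (∀ x, f x = (h x : ℂ)) → ω f = (g h : ℂ)) ∧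
      ∀ f, ‖ω f‖ ≤ 2 * ‖f‖ := by
  let re : C(X, ℂ) →ₗ[ℝ] C(X, ℝ) :=
    { toFun f := ⟨fun x => (f x).re, Complex.continuous_re.comp f.continuous⟩
      map_add' f h := by ext x; simp
      map_smul' c f := by ext x; simp }
  have hre (f : C(X, ℂ)) (x : X) : re f x = (f x).re := rfl
  let fr : Module.Dual ℝ C(X, ℂ) := g ∘ₗ re
  have hω (f : C(X, ℂ)) : (Module.Dual.extendRCLike fr : Module.Dual ℂ C(X, ℂ)) f =
      (g (re f) : ℂ) - Complex.I * (g (re (Complex.I • f)) : ℂ) := by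
    rw [Module.Dual.extendRCLike_apply]
    rfl
  have hreal (f : C(X, ℂ)) (h : C(X, ℝ)) (hf : ∀ x, f x = (h x : ℂ)) :
      (Module.Dual.extendRCLike fr : Module.Dual ℂ C(X, ℂ)) f = (g h : ℂ) := by
    have e1 : re f = h := by ext x; simp [hre, hf]
    have e2 : re (Complex.I • f) = 0 := by ext x; simp [hre, hf]
    rw [hω, e1, e2]
    simp
  have hb (f : C(X, ℂ)) : |g (re f)| ≤ ‖f‖ := by
    have hc (s : ℝ) (hs : |s| = 1) : s * g (re f) ≤ ‖f‖ := by
      have := hg (‖f‖ • 1 - s • re f) <| ContinuousMap.le_def.mpr fun x => by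
        have h2 := (Complex.abs_re_le_norm (f x)).trans (f.norm_coe_le_norm x)
        have h3 : s * (f x).re ≤ |(f x).re| := by
          refine (le_abs_self _).trans ?_
          rw [abs_mul, hs, one_mul]
        simp only [ContinuousMap.zero_apply, ContinuousMap.sub_apply, ContinuousMap.smul_apply,
          ContinuousMap.one_apply, smul_eq_mul, mul_one, hre]
        linarith
      rw [map_sub, map_smul, map_smul, h1, smul_eq_mul, smul_eq_mul, mul_one] at this
      linarith
    rw [abs_le]
    constructor
    · have := hc (-1) (by simp)
      linarith
    · have := hc 1 (by simp)
      linarith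
  refine ⟨Module.Dual.extendRCLike fr, ⟨fun a => ?_, ?_⟩, hreal, fun f => ?_⟩
  · have e (x : X) : (star a * a) x = ((⟨fun x => Complex.normSq (a x),
        Complex.continuous_normSq.comp a.continuous⟩ : C(X, ℝ)) x : ℂ) := by
      simp [Complex.normSq_eq_conj_mul_self]
    rw [hreal _ _ e]
    exact_mod_cast hg _ (ContinuousMap.le_def.mpr fun x => Complex.normSq_nonneg (a x))
  · rw [hreal 1 1 (by simp), h1, Complex.ofReal_one]
  -- Real and imaginary parts are bounded separately; the resulting constant 2 suffices for
  -- continuity.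
  · rw [hω]
    refine (norm_sub_le _ _).trans ?_
    rw [norm_mul, Complex.norm_I, one_mul, Complex.norm_real, Complex.norm_real, two_mul]
    refine add_le_add (hb f) ((hb _).trans ?_)
    rw [norm_smul, Complex.norm_I, one_mul]

end Extension

/-! ### Existence of the classical limit -/

section ClassicalLimit

variable {k : ℕ} (T : SpinBasis k)

theorem exists_real_polys (f : MvPolynomial (Fin (k ^ 2 - 1)) ℂ) :
    ∃ p q : MvPolynomial (Fin (k ^ 2 - 1)) ℝ,
      f = p.map Complex.ofRealHom + Complex.I • q.map Complex.ofRealHom := by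
  induction f using MvPolynomial.induction_on' with
  | monomial m c =>
    refine ⟨monomial m c.re, monomial m c.im, ?_⟩
    rw [map_monomial, map_monomial, smul_monomial, ← map_add]
    congr 1
    simp only [Complex.ofRealHom_eq_coe, smul_eq_mul]
    rw [mul_comm, Complex.re_add_im]
  | add f₁ f₂ h₁ h₂ =>
    obtain ⟨p₁, q₁, rfl⟩ := h₁
    obtain ⟨p₂, q₂, rfl⟩ := h₂
    refine ⟨p₁ + p₂, q₁ + q₂, ?_⟩
    rw [map_add, map_add, smul_add]
    abel

theorem polyFun_add (f₁ f₂ : MvPolynomial (Fin (k ^ 2 - 1)) ℂ) :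
    polyFun T (f₁ + f₂) = polyFun T f₁ + polyFun T f₂ := by
  ext ρ
  simp [polyFun_apply]

theorem polyFun_smul (c : ℂ) (f : MvPolynomial (Fin (k ^ 2 - 1)) ℂ) :
    polyFun T (c • f) = c • polyFun T f := by
  ext ρ
  simp [polyFun_apply, smul_eval]

theorem IsQuasiSymmetric.exists_quantize_approx [NeZero k] {A : LocalSeq k}
    (hA : IsQuasiSymmetric A) {ε : ℝ} (hε : 0 < ε) :
    ∃ f, ∀ᶠ N in atTop, ‖A N - quantize T f N‖ < ε := by
  obtain ⟨M, a, h⟩ := hA.exists_approx hε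
  obtain ⟨f, hf⟩ := exists_quantize_eq_symEmbed T a
  refine ⟨f, ?_⟩
  filter_upwards [h, eventually_ge_atTop M] with N h1 h2
  rw [hf N h2]
  exact h1 h2

/-- The classical symbol of a quasi-symmetric sequence. -/
theorem IsQuasiSymmetric.exists_symbol [NeZero k] {A : LocalSeq k} (hA : IsQuasiSymmetric A) :
    ∃ a₀ : C(StateSpace k, ℂ),
      (∀ ρ, Tendsto (fun N => productState ρ N (A N)) atTop (𝓝 (a₀ ρ))) ∧
      ∀ (f : MvPolynomial (Fin (k ^ 2 - 1)) ℂ) (ε : ℝ), 0 ≤ ε →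
        (∀ᶠ N in atTop, ‖A N - quantize T f N‖ < ε) → ‖a₀ - polyFun T f‖ ≤ ε := by
  have hclose (f : MvPolynomial (Fin (k ^ 2 - 1)) ℂ) (ε : ℝ)
      (h : ∀ᶠ N in atTop, ‖A N - quantize T f N‖ < ε) :
      ∀ᶠ N in atTop, ∀ ρ : StateSpace k, ‖productState ρ N (A N) - polyFun T f ρ‖ < ε := by
    filter_upwards [h, eventually_productState_quantize T f] with N h1 h2 ρ
    rw [← h2 ρ]
    have h3 := (isAlgState_productState ρ N).norm_le (A N - quantize T f N)
    rw [map_sub] at h3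
    exact h3.trans_lt h1
  have hex (ρ : StateSpace k) : ∃ x, Tendsto (fun N => productState ρ N (A N)) atTop (𝓝 x) := by
    refine exists_tendsto_of_approx fun ε hε => ?_
    obtain ⟨f, hf⟩ := hA.exists_quantize_approx T hε
    exact ⟨fun _ => polyFun T f ρ, _, tendsto_const_nhds, (hclose f ε hf).mono fun N h => h ρ⟩
  choose x hx using hex
  have hdist (f : MvPolynomial (Fin (k ^ 2 - 1)) ℂ) (ε : ℝ)
      (h : ∀ᶠ N in atTop, ‖A N - quantize T f N‖ < ε) (ρ : StateSpace k) :
      ‖x ρ - polyFun T f ρ‖ ≤ ε :=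
    le_of_tendsto ((hx ρ).sub_const _).norm ((hclose f ε h).mono fun N h => (h ρ).le)
  -- The estimates are uniform in ρ, so the symbol is a uniform limit of polynomial functions.
  have hcont : Continuous x := by
    refine continuous_of_uniform_approx_of_continuous fun u hu => ?_
    obtain ⟨ε, hε, hεu⟩ := Metric.mem_uniformity_dist.mp hu
    obtain ⟨f, hf⟩ := hA.exists_quantize_approx T (half_pos hε)
    refine ⟨polyFun T f, (polyFun T f).continuous, fun ρ => hεu ?_⟩
    rw [dist_eq_norm]
    linarith [hdist f _ hf ρ]
  refine ⟨⟨x, hcont⟩, hx, fun f ε hε h => ?_⟩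
  exact (ContinuousMap.norm_le _ hε).mpr fun ρ => hdist f ε h ρ

/-- Permutation invariant states whose values on quantised real polynomials converge have a
classical limit. -/
theorem hasClassicalLimit_of_tendsto [NeZero k] {φ : ∀ N, LocalAlg k N →ₗ[ℂ] ℂ}
    (hφ : ∀ N, IsAlgState (φ N)) (hp : ∀ N, IsPermInv (φ N))
    (h : ∀ p : MvPolynomial (Fin (k ^ 2 - 1)) ℝ, ∃ x : ℝ,
      Tendsto (fun N => φ N (quantize T (p.map Complex.ofRealHom) N)) atTop (𝓝 (x : ℂ))) :
    HasClassicalLimit T fun N a => φ N a := by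
  choose x hx using h
  let L : MvPolynomial (Fin (k ^ 2 - 1)) ℝ →ₗ[ℝ] ℝ :=
    { toFun := x
      map_add' p q := by
        refine Complex.ofReal_injective (tendsto_nhds_unique (hx (p + q)) ?_)
        rw [Complex.ofReal_add]
        refine ((hx p).add (hx q)).congr fun N => ?_
        simp only [← quantizeₗ_apply, map_add]
      map_smul' c p := by
        refine Complex.ofReal_injective (tendsto_nhds_unique (hx (c • p)) ?_)
        rw [RingHom.id_apply, smul_eq_mul, Complex.ofReal_mul]
        refine ((hx p).const_mul (c : ℂ)).congr fun N => ?_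
        have e : (c • p).map Complex.ofRealHom = (c : ℂ) • p.map Complex.ofRealHom := by
          simp [smul_eq_C_mul]
        rw [e]
        simp only [← quantizeₗ_apply, map_smul, smul_eq_mul] }
  have hlist (l : List (ℝ × (Fin (k ^ 2 - 1) → ℝ))) {N : ℕ} (hN : l.length ≤ N) :
      quantize T ((l.map affPoly).prod.map Complex.ofRealHom) N =
        symTens N ((l.map complexify).map (affMat T)) := by
    have e : (l.map affPoly).prod.map Complex.ofRealHom =
        ((l.map complexify).map affPoly).prod := by
      rw [map_list_prod, List.map_map, List.map_map]
      congr 2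
      funext q
      exact map_affPoly q
    rw [e, ← quantizeₗ_apply, quantizeₗ_prod_affPoly T _ (by simpa using hN)]
  have hL1 : L 1 = 1 := by
    refine Complex.ofReal_injective (tendsto_nhds_unique (hx 1) ?_)
    rw [Complex.ofReal_one]
    refine tendsto_const_nhds.congr fun N => ?_
    have h1 := hlist [] (Nat.zero_le N)
    simp only [List.map_nil, List.prod_nil] at h1
    rw [h1, symTens, (hp N).map_symmetrize, ← (hφ N).2]
    congr 1
    ext a b
    simp [elemTensor_apply, Matrix.one_apply, Finset.prod_ite_zero, funext_iff]
  have hLpos : ∀ p, (∀ ρ, 0 ≤ aeval (coord T) p ρ) → 0 ≤ L p := by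
    refine map_nonneg_of_nonneg_on_stateSpace T L hL1 fun l hl => ?_
    have : (0 : ℂ) ≤ ((L (l.map affPoly).prod : ℝ) : ℂ) := by
      -- At finite N the product quantises to a symmetrised tensor product of positive matrices, so
      -- its expectation is already nonnegative.
      refine ge_of_tendsto (hx _) ?_
      filter_upwards [eventually_ge_atTop l.length] with N hN
      rw [hlist l hN]
      refine map_symTens_nonneg (hφ N) (hp N) fun B hB => ?_
      rw [List.map_map] at hB
      obtain ⟨q, hq, rfl⟩ := List.mem_map.mp hB
      exact hl q hq
    exact_mod_cast this
  obtain ⟨g, hg1, hg2⟩ := exists_positive_extension T L hLpos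
  have hg_one : g 1 = 1 := by
    rw [← map_one (aeval (R := ℝ) (coord T)), hg1, hL1]
  obtain ⟨ω₀, hω, hreal, hnorm⟩ := exists_complexification g hg_one hg2
  have hpoly (f : MvPolynomial (Fin (k ^ 2 - 1)) ℂ) :
      Tendsto (fun N => φ N (quantize T f N)) atTop (𝓝 (ω₀ (polyFun T f))) := by
    obtain ⟨p, q, rfl⟩ := exists_real_polys f
    have e (p) : ω₀ (polyFun T (p.map Complex.ofRealHom)) = (x p : ℂ) := by
      rw [hreal _ _ (polyFun_map T p), hg1]
      rfl
    rw [polyFun_add, polyFun_smul, map_add, map_smul, e, e, smul_eq_mul]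
    refine ((hx p).add ((hx q).const_mul Complex.I)).congr fun N => ?_
    simp only [← quantizeₗ_apply, map_add, map_smul, smul_eq_mul]
  refine ⟨ω₀, hω, hpoly, fun A hA => ?_⟩
  obtain ⟨a₀, ha₀, hclose⟩ := hA.exists_symbol T
  refine ⟨a₀, ha₀, ?_⟩
  rw [Metric.tendsto_nhds]
  intro ε hε
  obtain ⟨f, hf⟩ := hA.exists_quantize_approx T (show 0 < ε / 4 by positivity)
  -- The error splits as ε/4 for replacing A by Q(f), ε/4 for the convergence on f, and 2·ε/4 for
  -- replacing the symbol of f by a₀.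
  have h1 := hclose f (ε / 4) (by positivity) hf
  have h2 : dist (ω₀ (polyFun T f)) (ω₀ a₀) ≤ 2 * (ε / 4) := by
    rw [dist_comm, dist_eq_norm, ← map_sub]
    exact (hnorm _).trans (by linarith)
  filter_upwards [hf, Metric.tendsto_nhds.mp (hpoly f) (ε / 4) (by positivity)] with N h3 h4
  have h5 : dist (φ N (A N)) (φ N (quantize T f N)) < ε / 4 := by
    rw [dist_eq_norm, ← map_sub]
    exact ((hφ N).norm_le _).trans_lt h3
  linarith [dist_triangle4 (φ N (A N)) (φ N (quantize T f N)) (ω₀ (polyFun T f)) (ω₀ a₀)]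

end ClassicalLimit

end MeanField

end

/-! ### The main theorem -/

open MeanField
theorem mainTheorem6 (k : ℕ) [NeZero k] (β : ℝ) (hβ : 0 < β)
    (H : LocalSeq k) (hH : IsQuasiSymmetric H) (hHsa : ∀ N, IsSelfAdjoint (H N)) :
    (∀ A : LocalSeq k, IsQuasiSymmetric A → (∀ N, IsSelfAdjoint (A N)) →
      -- the free energy is well defined: the limits and the infimum exist
      (∀ (t : ℝ) (ω : PermInvState k),
        Tendsto (energyDensity (scaled H + (t : ℂ) • scaled A) ω.1) atTop
          (𝓝 (internalEnergy (scaled H + (t : ℂ) • scaled A) ω.1)) ∧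
        Tendsto (entropyDensity ω.1) atTop (𝓝 (meanEntropy ω.1))) ∧
      (∀ t : ℝ, IsGLB (Set.range fun ω : PermInvState k => stateFreeEnergy β H A t ω.1)
        (freeEnergy β H A t)) ∧
      ConcaveOn ℝ Set.univ (freeEnergy β H A) ∧
      -- differentiability at `0` implies convergence of the Gibbs expectations
      (DifferentiableAt ℝ (freeEnergy β H A) 0 →
        Tendsto (fun N => gibbs β (scaled H N) (A N)) atTop
          (𝓝 ((deriv (freeEnergy β H A) 0 : ℝ) : ℂ)))) ∧
    -- differentiability in all classical directions implies existence of the classical limit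
    (∀ T : SpinBasis k,
      (∀ p : MvPolynomial (Fin (k ^ 2 - 1)) ℝ,
        DifferentiableAt ℝ (freeEnergy β H (quantize T (p.map Complex.ofRealHom))) 0) →
      HasClassicalLimit T (fun N a => gibbs β (scaled H N) a)) := by
  refine ⟨fun A hA hAsa => ⟨fun t ω => ⟨?_, ω.2.tendsto_entropyDensity⟩,
    isGLB_freeEnergy hβ hH hA, concaveOn_freeEnergy hβ hH hA,
    tendsto_gibbs hβ hH hHsa hA hAsa⟩, fun T hT => ?_⟩
  · rw [scaled_add_smul]
    exact ω.2.tendsto_energyDensity (hH.add (hA.smul t))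
  -- Quantised real polynomials are self-adjoint, so the convergence of Gibbs expectations supplies
  -- the limits from which the classical state is built.
  · simp_rw [← gibbsₗ_apply]
    refine hasClassicalLimit_of_tendsto T (fun N => isAlgState_gibbs (isHermitian_scaled hHsa N))
      (fun N => isPermInv_gibbs (symmetrize_scaled hH N)) fun p =>
      ⟨deriv (freeEnergy β H (quantize T (p.map Complex.ofRealHom))) 0, ?_⟩
    simp_rw [gibbsₗ_apply]
    exact tendsto_gibbs hβ hH hHsa (isQuasiSymmetric_quantize T _)
      (fun N => isSelfAdjoint_quantize_real T p) (hT p)
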